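/- Let $d\ge 3$, $N=2^{\lfloor (d+1)/2\rfloor}$ and $m\ge 0$. Let $\alpha_1,\dots,\alpha_d,\beta\in\mathbb C^{N\times N}$ be Dirac matrices, i.e. Hermitian matrices with $\alpha_j\alpha_k+\alpha_k\alpha_j=2\delta_{jk}\mathbb I$, $\alpha_j\beta+\beta\alpha_j=0$ and $\beta^2=\mathbb I$. Write $L^2=L^2(\mathbb R^d;\mathbb C^N)$ with norm $\|\cdot\|$ and $H^1=H^1(\mathbb R^d;\mathbb C^N)$. For $A\colon\mathbb R^d\to\mathbb R^d$ put $\nabla_A=\nabla-iA$, and for a potential $V\colon\mathbb R^d\to\mathbb C^{N\times N}$ let $H_m(A,V)=-i\alpha\cdot\nabla_A+m\beta+V$, acting in $L^2$ on the functions of $H^1$ that it maps into $L^2$; $H_m(A)=H_m(A,0)$. Assume that $A\in L^2_{\rm loc}$, that the magnetic field $B=(\partial_jA_k-\partial_kA_j)_{j,k}$ (distributional derivatives) is in $L^2_{\rm loc}$, and that $H_m(A)$ is self-adjoint in $L^2$ with domain $H^1$. Let $|B(x)|$ denote the operator norm of the matrix $B(x)$. Let $v\in L^1_{\rm loc}(\mathbb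 R^d;\mathbb R)\cap C^\infty(\mathbb R^d\setminus\{0\})$ be bounded outside every ball containing the origin, let $V_{\rm sc}=v\beta$, and assume that $V_{\rm sc}$ is bounded relative to $H_m(A)$: there are $a\in(0,1]$ and $b>0$ with $\|V_{\rm sc}\psi\|^2\le a\|H_m(A)\psi\|^2+b\|\psi\|^2$ for all $\psi\in H^1$. Assume that there are $\varepsilon_1,\varepsilon_2,\varepsilon_3,\varepsilon_4\ge 0$ with $$\frac{4d-6}{d-2}\,\varepsilon_1+2\varepsilon_2\varepsilon_3+2m\varepsilon_4^2+\frac{4d-4}{d-2}\,\varepsilon_2<2$$ such that for every $\psi\in H^1$ $$\int|x|^2|B|^2|\psi|^2\le\varepsilon_1^2\|\nabla_A\psi\|^2,\qquad \int|x|^2|\nabla v|^2|\psi|^2\le\varepsilon_2^2\|\nabla_A\psi\|^2,\qquad \int|v|^2|\psi|^2\le\varepsilon_3^2\|\nabla_A\psi\|^2,$$ and, if $m\ne 0$, also $$\int|x||\nabla v||\psi|^2\le\varepsilon_4^2\|\nabla_A\psi\|^2 .$$ Then $H_m(A,V_{\rm sc})$ has empty point spectrum: $\sigma_p(H_m(A,V_{\rm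 sc}))=\varnothing$. -/

import Mathlib

open MeasureTheory
open scoped ENNReal ContDiff LineDeriv SchwartzMap

noncomputable section

namespace DiracOperator

/-- The Euclidean space `ℝ^d`. -/
abbrev Space (d : ℕ) : Type := EuclideanSpace ℝ (Fin d)

/-- The number of spinor components, `N = 2 ^ ⌊(d + 1) / 2⌋`. -/
abbrev spinorDim (d : ℕ) : ℕ := 2 ^ ((d + 1) / 2)

/-- Spinors: the Hermitian space `ℂ^N`. -/
abbrev Spinor (d : ℕ) : Type := EuclideanSpace ℂ (Fin (spinorDim d))

/-- Complex `N × N` matrices. -/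
abbrev SpinorMatrix (d : ℕ) : Type := Matrix (Fin (spinorDim d)) (Fin (spinorDim d)) ℂ

/-- The Hilbert space `L²(ℝ^d; ℂ^N)`. -/
abbrev SpinorL2 (d : ℕ) : Type := Lp (Spinor d) 2 (volume : Measure (Space d))

/-- The `j`-th vector of the standard basis of `ℝ^d`. -/
abbrev basisVec {d : ℕ} (j : Fin d) : Space d := EuclideanSpace.single j (1 : ℝ)

/-- The action of a matrix on a spinor. -/
abbrev act {d : ℕ} (M : SpinorMatrix d) : Spinor d →L[ℂ] Spinor d :=
  Matrix.toEuclideanCLM (n := Fin (spinorDim d)) (𝕜 := ℂ) M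

/-- Dirac matrices: Hermitian `N × N` matrices `α_1, …, α_d, β` with
`α_j α_k + α_k α_j = 2 δ_{jk}`, `α_j β + β α_j = 0` and `β² = 1`. -/
structure IsDiracMatrices {d : ℕ} (α : Fin d → SpinorMatrix d) (β : SpinorMatrix d) : Prop where
  hermitian_alpha : ∀ j, (α j).IsHermitian
  hermitian_beta : β.IsHermitian
  anticomm_alpha : ∀ j k, α j * α k + α k * α j = if j = k then 2 else 0
  anticomm_beta : ∀ j, α j * β + β * α j = 0
  beta_sq : β * β = 1

/-- The embedding of `L²(ℝ^d; ℂ^N)` into the tempered distributions, as a linear map. -/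
abbrev toDistribution (d : ℕ) : SpinorL2 d →L[ℂ] 𝓢'(Space d, Spinor d) :=
  Lp.toTemperedDistributionCLM (Spinor d) (volume : Measure (Space d)) 2

theorem toDistribution_injective (d : ℕ) : Function.Injective (toDistribution d) :=
  LinearMap.ker_eq_bot.mp Lp.ker_toTemperedDistributionCLM_eq_bot

/-- The Sobolev space `H¹(ℝ^d; ℂ^N)`: the functions in `L²` all of whose first order distributional
partial derivatives are in `L²`. -/
def H1 (d : ℕ) : Submodule ℂ (SpinorL2 d) where
  carrier := {ψ | ∀ j : Fin d, ∃ g : SpinorL2 d,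
    ∂_{basisVec j} (toDistribution d ψ) = toDistribution d g}
  add_mem' := by
    intro ψ φ hψ hφ j
    obtain ⟨g, hg⟩ := hψ j
    obtain ⟨h, hh⟩ := hφ j
    exact ⟨g + h, by rw [map_add, map_add, LineDeriv.lineDerivOp_add, hg, hh]⟩
  zero_mem' := by
    intro j
    refine ⟨0, ?_⟩
    have h := LineDeriv.lineDerivOp_add (basisVec j) (toDistribution d 0) (toDistribution d 0)
    rw [← map_add, add_zero, left_eq_add] at h
    rw [h, map_zero]
  smul_mem' := by
    intro c ψ hψ j
    obtain ⟨g, hg⟩ := hψ j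
    exact ⟨c • g, by rw [map_smul, map_smul, LineDeriv.lineDerivOp_smul, hg]⟩

/-- The weak partial derivative `∂_j ψ ∈ L²` of `ψ ∈ H¹`. -/
def weakDeriv {d : ℕ} (j : Fin d) (ψ : H1 d) : SpinorL2 d := (ψ.2 j).choose

theorem weakDeriv_spec {d : ℕ} (j : Fin d) (ψ : H1 d) :
    ∂_{basisVec j} (toDistribution d (ψ : SpinorL2 d)) = toDistribution d (weakDeriv j ψ) :=
  (ψ.2 j).choose_spec

theorem weakDeriv_add {d : ℕ} (j : Fin d) (ψ φ : H1 d) :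
    weakDeriv j (ψ + φ) = weakDeriv j ψ + weakDeriv j φ := by
  apply toDistribution_injective d
  rw [map_add, ← weakDeriv_spec, ← weakDeriv_spec, ← weakDeriv_spec, Submodule.coe_add, map_add,
    LineDeriv.lineDerivOp_add]

theorem weakDeriv_smul {d : ℕ} (j : Fin d) (c : ℂ) (ψ : H1 d) :
    weakDeriv j (c • ψ) = c • weakDeriv j ψ := by
  apply toDistribution_injective d
  rw [map_smul, ← weakDeriv_spec, ← weakDeriv_spec, Submodule.coe_smul, map_smul,
    LineDeriv.lineDerivOp_smul]

/-- The `j`-th magnetic derivative `∂_j^A ψ = ∂_j ψ - i A_j ψ` of `ψ ∈ H¹`. -/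
def magneticDeriv {d : ℕ} (A : Space d → Space d) (j : Fin d) (ψ : H1 d) (x : Space d) :
    Spinor d :=
  weakDeriv j ψ x - (Complex.I * (A x j : ℂ)) • (ψ : SpinorL2 d) x

/-- `‖∇_A ψ‖² = ∑_j ∫ |∂_j^A ψ|²`, with values in `[0, ∞]`. -/
def magneticEnergy {d : ℕ} (A : Space d → Space d) (ψ : H1 d) : ℝ≥0∞ :=
  ∫⁻ x, ∑ j, ‖magneticDeriv A j ψ x‖ₑ ^ 2

/-- The Dirac differential expression
`-i α · ∇_A ψ + m β ψ + V ψ` applied to `ψ ∈ H¹`. -/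
def diracExpr {d : ℕ} (α : Fin d → SpinorMatrix d) (β : SpinorMatrix d) (m : ℝ)
    (A : Space d → Space d) (V : Space d → SpinorMatrix d) (ψ : H1 d) (x : Space d) : Spinor d :=
  (∑ j, (-Complex.I) • act (α j) (magneticDeriv A j ψ x))
    + (m : ℂ) • act β ((ψ : SpinorL2 d) x) + act (V x) ((ψ : SpinorL2 d) x)

theorem magneticDeriv_add {d : ℕ} (A : Space d → Space d) (j : Fin d) (ψ φ : H1 d) :
    magneticDeriv A j (ψ + φ) =ᵐ[volume] magneticDeriv A j ψ + magneticDeriv A j φ := by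
  filter_upwards [Lp.coeFn_add (weakDeriv j ψ) (weakDeriv j φ),
    Lp.coeFn_add (ψ : SpinorL2 d) (φ : SpinorL2 d)] with x h1 h2
  simp only [magneticDeriv, weakDeriv_add, Submodule.coe_add, h1, h2, Pi.add_apply, smul_add]
  abel

theorem magneticDeriv_smul {d : ℕ} (A : Space d → Space d) (j : Fin d) (c : ℂ) (ψ : H1 d) :
    magneticDeriv A j (c • ψ) =ᵐ[volume] c • magneticDeriv A j ψ := by
  filter_upwards [Lp.coeFn_smul c (weakDeriv j ψ), Lp.coeFn_smul c (ψ : SpinorL2 d)] with x h1 h2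
  simp only [magneticDeriv, weakDeriv_smul, Submodule.coe_smul, h1, h2, Pi.smul_apply, smul_sub]
  rw [smul_comm c]

theorem diracExpr_add {d : ℕ} (α : Fin d → SpinorMatrix d) (β : SpinorMatrix d) (m : ℝ)
    (A : Space d → Space d) (V : Space d → SpinorMatrix d) (ψ φ : H1 d) :
    diracExpr α β m A V (ψ + φ) =ᵐ[volume] diracExpr α β m A V ψ + diracExpr α β m A V φ := by
  filter_upwards [ae_all_iff.mpr fun j => magneticDeriv_add A j ψ φ,
    Lp.coeFn_add (ψ : SpinorL2 d) (φ : SpinorL2 d)] with x h1 h2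
  simp only [diracExpr, h1, Submodule.coe_add, h2, Pi.add_apply, map_add, smul_add,
    Finset.sum_add_distrib]
  abel

theorem diracExpr_smul {d : ℕ} (α : Fin d → SpinorMatrix d) (β : SpinorMatrix d) (m : ℝ)
    (A : Space d → Space d) (V : Space d → SpinorMatrix d) (c : ℂ) (ψ : H1 d) :
    diracExpr α β m A V (c • ψ) =ᵐ[volume] c • diracExpr α β m A V ψ := by
  filter_upwards [ae_all_iff.mpr fun j => magneticDeriv_smul A j c ψ,
    Lp.coeFn_smul c (ψ : SpinorL2 d)] with x h1 h2
  simp only [diracExpr, h1, Submodule.coe_smul, h2, Pi.smul_apply, map_smul, smul_add,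
    Finset.smul_sum]
  congr 1
  · congr 1
    · exact Finset.sum_congr rfl fun j _ => smul_comm _ _ _
    · exact smul_comm _ _ _

/-- The domain of `H_m(A, V)` as an operator in `L²`: the functions in `H¹` which the Dirac
expression maps to `L²`. -/
def diracDomain {d : ℕ} (α : Fin d → SpinorMatrix d) (β : SpinorMatrix d) (m : ℝ)
    (A : Space d → Space d) (V : Space d → SpinorMatrix d) : Submodule ℂ (SpinorL2 d) where
  carrier := {ψ | ∃ h : ψ ∈ H1 d, MemLp (diracExpr α β m A V ⟨ψ, h⟩) 2 volume}
  add_mem' := by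
    rintro ψ φ ⟨hψ, hψ'⟩ ⟨hφ, hφ'⟩
    exact ⟨(H1 d).add_mem hψ hφ,
      (hψ'.add hφ').ae_eq (diracExpr_add α β m A V ⟨ψ, hψ⟩ ⟨φ, hφ⟩).symm⟩
  zero_mem' := by
    refine ⟨(H1 d).zero_mem, ?_⟩
    have h := diracExpr_smul α β m A V 0 (0 : H1 d)
    rw [zero_smul, zero_smul] at h
    exact (MemLp.zero' (ε := Spinor d)).ae_eq h.symm
  smul_mem' := by
    rintro c ψ ⟨hψ, hψ'⟩
    exact ⟨(H1 d).smul_mem c hψ,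
      (hψ'.const_smul c).ae_eq (diracExpr_smul α β m A V c ⟨ψ, hψ⟩).symm⟩

/-- The electromagnetic Dirac operator `H_m(A, V) = -i α · ∇_A + m β + V`, as an unbounded linear
operator in `L²(ℝ^d; ℂ^N)`. -/
def diracOp {d : ℕ} (α : Fin d → SpinorMatrix d) (β : SpinorMatrix d) (m : ℝ)
    (A : Space d → Space d) (V : Space d → SpinorMatrix d) : SpinorL2 d →ₗ.[ℂ] SpinorL2 d where
  domain := diracDomain α β m A V
  toFun :=
    { toFun := fun ψ => ψ.2.choose_spec.toLp
      map_add' := by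
        intro ψ φ
        rw [← MemLp.toLp_add]
        exact MemLp.toLp_congr _ _ (diracExpr_add α β m A V ⟨ψ, ψ.2.choose⟩ ⟨φ, φ.2.choose⟩)
      map_smul' := by
        intro c ψ
        rw [RingHom.id_apply, ← MemLp.toLp_const_smul]
        exact MemLp.toLp_congr _ _ (diracExpr_smul α β m A V c ⟨ψ, ψ.2.choose⟩) }

/-- The point spectrum of an unbounded linear operator: the set of its eigenvalues. -/
def pointSpectrum {E : Type*} [NormedAddCommGroup E] [NormedSpace ℂ E] (T : E →ₗ.[ℂ] E) : Set ℂ :=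
  {z | ∃ ψ : T.domain, (ψ : E) ≠ 0 ∧ T ψ = z • (ψ : E)}

/-- `f ∈ L²_loc(ℝ^d)`. -/
def MemL2Loc {d : ℕ} {F : Type*} [NormedAddCommGroup F] (f : Space d → F) : Prop :=
  ∀ K : Set (Space d), IsCompact K → MemLp f 2 (volume.restrict K)

/-- `B_{jk} = ∂_j A_k - ∂_k A_j` in the sense of distributions. -/
def IsMagneticField {d : ℕ} (A : Space d → Space d)
    (B : Space d → Matrix (Fin d) (Fin d) ℝ) : Prop :=
  ∀ (j k : Fin d) (φ : Space d → ℝ), ContDiff ℝ ∞ φ → HasCompactSupport φ →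
    ∫ x, B x j k * φ x =
      -∫ x, (A x k * fderiv ℝ φ x (basisVec j) - A x j * fderiv ℝ φ x (basisVec k))

/-- The operator norm of a real square matrix with respect to the Euclidean norm. -/
def matrixNorm {d : ℕ} (M : Matrix (Fin d) (Fin d) ℝ) : ℝ :=
  ‖Matrix.toEuclideanCLM (n := Fin d) (𝕜 := ℝ) M‖

/-- The Hardy-type inequality `∫ W |ψ|² ≤ c ‖∇_A ψ‖²` for every `ψ ∈ H¹(ℝ^d; ℂ^N)`. -/
def HardyBound {d : ℕ} (A : Space d → Space d) (W : Space d → ℝ) (c : ℝ) : Prop :=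
  ∀ ψ : H1 d, ∫⁻ x, ENNReal.ofReal (W x * ‖(ψ : SpinorL2 d) x‖ ^ 2)
    ≤ ENNReal.ofReal c * magneticEnergy A ψ

/-- `H_m(A) = H_m(A, 0)` is self-adjoint in `L²(ℝ^d; ℂ^N)` with domain `H¹(ℝ^d; ℂ^N)`. -/
def SelfAdjointOnH1 {d : ℕ} (α : Fin d → SpinorMatrix d) (β : SpinorMatrix d) (m : ℝ)
    (A : Space d → Space d) : Prop :=
  (diracOp α β m A 0).domain = H1 d ∧ IsSelfAdjoint (diracOp α β m A 0)

/-- The potential `V` is bounded relative to `H_m(A)`: there are `a, b > 0` with `a ≤ 1` such that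
`‖V ψ‖² ≤ a ‖H_m(A) ψ‖² + b ‖ψ‖²` for all `ψ` in the domain of `H_m(A)`. -/
def RelativelyBounded {d : ℕ} (α : Fin d → SpinorMatrix d) (β : SpinorMatrix d) (m : ℝ)
    (A : Space d → Space d) (V : Space d → SpinorMatrix d) : Prop :=
  ∃ a b : ℝ, 0 < a ∧ a ≤ 1 ∧ 0 < b ∧ ∀ ψ : (diracOp α β m A 0).domain,
    ∫⁻ x, ‖act (V x) ((ψ : SpinorL2 d) x)‖ₑ ^ 2
      ≤ ENNReal.ofReal (a * ‖diracOp α β m A 0 ψ‖ ^ 2 + b * ‖(ψ : SpinorL2 d)‖ ^ 2)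

/-- The scalar potential `V_sc = v β`. -/
def scalarPotential {d : ℕ} (β : SpinorMatrix d) (v : Space d → ℝ) (x : Space d) :
    SpinorMatrix d :=
  (v x : ℂ) • β

end DiracOperator

end

/-! Write Tψ = −iα·∇_A ψ and w = m + v, so that an eigenvector satisfies Tψ + wβψ = zψ; all inner
products below are real parts. By symmetry z is real (`eigenvalue_im_eq_zero`). The proof is the
method of multipliers: testing the equation against the dilation field gives the virial identity
⟨ψ,Tψ⟩ = ⟨ψ,α(Bx)ψ⟩ + ∫(x·∇w)⟨ψ,βψ⟩, where α(y) = ∑ y_j α_j. Multiply it by z and replace zψ by Tψ +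
wβψ. As β anticommutes with α(Bx) and β² = 1, the result (`virial_eigen`) is ‖Tψ‖² + ∫w⟨βψ,Tψ⟩ =
⟨Tψ,α(Bx)ψ⟩ + ∫(x·∇w)⟨Tψ,βψ⟩ + ∫(x·∇w)w|ψ|².

Every term except ‖Tψ‖² is small. The term with w itself is a divergence in disguise and is at most
½∫|∇w||ψ|² (`abs_integral_mass_le`), which Hardy's inequality with constant 2/(d−2) controls by ε₂.
The last term is bounded through ε₂ε₃ and mε₄². To compare with the energy Y = ‖∇_A ψ‖² there is the
Lichnerowicz formula ‖Tψ‖² = Y + ∫(spin term in B). If ‖Tψ‖² ≥ Y, the identity is contradictory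
directly; if ‖Tψ‖² ≤ Y, the Lichnerowicz formula is substituted for ‖Tψ‖² and the two magnetic terms
are estimated together by (2 + 1/(d−2)) ε₁ Y (`magnetic_le`, `smallness_contradiction`).

That constant depends on linear algebra. The spin term is a Clifford contraction ∑ α(e_l)α(Be_l),
whose trivial bound carries the factor d. In odd dimension the skew matrix B has a kernel vector, so
one summand drops out and the factor d−1 suffices. In even dimension B may be invertible; instead it
is compressed to the odd-dimensional space x^⊥, which leaves the factor d−2, and the remaining part
α(x)α(Bx)/|x|² is absorbed into ⟨Tψ,α(Bx)ψ⟩ by replacing Tψ with Tψ − i|x|⁻²α(x)ψ. The norm of this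
shifted vector is estimated by separating radial and tangential derivatives.

The analytic layer makes these manipulations legitimate for ψ with one weak derivative, A in L²_loc
and v singular at 0. Identities are proved for Schwartz functions, which are dense in H¹
(`exists_schwartz_approx`), and only antisymmetrised products ⟨∂_jψ, Γ∂_kψ⟩ − ⟨∂_kψ, Γ∂_jψ⟩ occur,
so that no second derivative is needed. Because the Dirac operator has domain H¹, the product Aψ is
in L² (`memLp_vectorPotential_smul`). The distributional definition of B is extended to quadratic
test functions of ψ by a bounded truncation (`magneticField_form`). Cutoffs vanishing near 0 and
near infinity are removed at the end by means of |x|⁻¹ψ ∈ L². -/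

noncomputable section

namespace DiracOperator

open Filter Topology

variable {d : ℕ}

/-! ### Density of Schwartz functions in H¹ -/

/-- A Schwartz function together with its partial derivatives, in `L²`. -/
def schwartzJet (d : ℕ) :
    𝓢(Space d, Spinor d) →ₗ[ℂ] PiLp 2 (fun _ : Option (Fin d) => SpinorL2 d) :=
  (WithLp.linearEquiv 2 ℂ _).symm.toLinearMap ∘ₗ LinearMap.pi fun o : Option (Fin d) =>
    match o with
    | none => (SchwartzMap.toLpCLM ℂ (Spinor d) 2 volume).toLinearMap
    | some j => (SchwartzMap.toLpCLM ℂ (Spinor d) 2 volume).toLinearMap ∘ₗ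
        (LineDeriv.lineDerivOpCLM ℂ 𝓢(Space d, Spinor d) (basisVec j)).toLinearMap

theorem schwartzJet_none (u : 𝓢(Space d, Spinor d)) :
    schwartzJet d u none = u.toLp 2 volume := rfl

theorem schwartzJet_some (u : 𝓢(Space d, Spinor d)) (j : Fin d) :
    schwartzJet d u (some j) = (∂_{basisVec j} u).toLp 2 volume := rfl

theorem lineDeriv_toDistribution_schwartz (u : 𝓢(Space d, Spinor d)) (j : Fin d) :
    ∂_{basisVec j} (toDistribution d (u.toLp 2 volume))
      = toDistribution d ((∂_{basisVec j} u).toLp 2 volume) := by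
  simp only [toDistribution, Lp.toTemperedDistributionCLM_apply,
    Lp.toTemperedDistribution_toLp_eq]
  exact TemperedDistribution.lineDerivOp_toTemperedDistributionCLM_eq u (basisVec j)

/-- The pairs `(ψ, ∇ψ)` with `ψ ∈ H¹`. -/
def sobolevJets (d : ℕ) : Set (PiLp 2 (fun _ : Option (Fin d) => SpinorL2 d)) :=
  {p | ∀ j : Fin d, ∂_{basisVec j} (toDistribution d (p none)) = toDistribution d (p (some j))}

theorem isClosed_sobolevJets : IsClosed (sobolevJets d) := by
  simp only [sobolevJets, Set.ofPred_forall]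
  refine isClosed_iInter fun j => isClosed_eq ?_ ?_
  · exact (LineDeriv.lineDerivOpCLM ℂ 𝓢'(Space d, Spinor d) (basisVec j)).continuous.comp
      ((toDistribution d).continuous.comp (PiLp.proj 2 (𝕜 := ℂ) _ none).continuous)
  · exact (toDistribution d).continuous.comp (PiLp.proj 2 (𝕜 := ℂ) _ (some j)).continuous

theorem hasTemperateGrowth_one_add_inv : (fun x : Space d =>
   (((1 + ‖(2 * Real.pi) • x‖ ^ 2) ^ (-1 : ℝ) : ℝ) : ℂ)).HasTemperateGrowth := by
  have h : (fun x : Space d => (((1 + ‖x‖ ^ 2) ^ (-1 : ℝ) : ℝ) : ℂ)).HasTemperateGrowth := by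
    fun_prop
  have h2 : (fun x : Space d => (2 * Real.pi) • x).HasTemperateGrowth := by fun_prop
  exact h.comp h2

/-- On the Fourier side 1 − Δ is multiplication by 1 + |2πξ|². The reciprocal of this symbol also
has temperate growth, so the multiplication can be undone on tempered distributions. -/
theorem eq_zero_of_sub_laplacian_eq_zero {T : 𝓢'(Space d, Spinor d)}
    (h : T - Laplacian.laplacian T = 0) : T = 0 := by
  have h1 : (fun x : Space d => Complex.ofReal (‖x‖ ^ 2)).HasTemperateGrowth := by fun_prop
  have h2 : T - Laplacian.laplacian T = TemperedDistribution.fourierMultiplierCLM (Spinor d)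
      (fun x : Space d => ((1 + ‖(2 * Real.pi) • x‖ ^ 2 : ℝ) : ℂ)) T := by
    rw [TemperedDistribution.laplacian_eq_fourierMultiplierCLM]
    have e : (fun x : Space d => ((1 + ‖(2 * Real.pi) • x‖ ^ 2 : ℝ) : ℂ))
      = (fun _ : Space d => (1 : ℂ)) + (((2 * Real.pi) ^ 2 : ℝ) : ℂ) • (fun x : Space d => Complex.ofReal (‖x‖ ^ 2)) := by
      ext x
      simp only [norm_smul, Pi.add_apply, Pi.smul_apply, smul_eq_mul]
      rw [mul_pow, Real.norm_eq_abs, sq_abs]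
      push_cast
      ring
    have f2 : ((((2 * Real.pi) ^ 2 : ℝ) : ℂ) • (fun x : Space d => Complex.ofReal (‖x‖ ^ 2))).HasTemperateGrowth := (Function.HasTemperateGrowth.const _).mul h1
    rw [e]
    rw [TemperedDistribution.fourierMultiplierCLM_apply (F := Spinor d) (_ + _),
      TemperedDistribution.smulLeftCLM_add (Function.HasTemperateGrowth.const (1 : ℂ)) f2,
      TemperedDistribution.smulLeftCLM_smul h1, add_apply,
      FourierTransform.fourierInv_add]
    simp only [TemperedDistribution.smulLeftCLM_const, smul_apply,
      FourierTransform.fourierInv_smul, FourierTransform.fourierInv_fourier_eq,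
      TemperedDistribution.fourierMultiplierCLM_apply, one_smul]
    ext φ
    simp
  have hh : (fun x : Space d => ((1 + ‖(2 * Real.pi) • x‖ ^ 2 : ℝ) : ℂ)).HasTemperateGrowth := by
    have h : (fun x : Space d => ((1 + ‖x‖ ^ 2 : ℝ) : ℂ)).HasTemperateGrowth := by fun_prop
    have h2 : (fun x : Space d => (2 * Real.pi) • x).HasTemperateGrowth := by fun_prop
    exact h.comp h2
  have h3 := congrArg (TemperedDistribution.fourierMultiplierCLM (Spinor d) (fun x : Space d =>
   (((1 + ‖(2 * Real.pi) • x‖ ^ 2) ^ (-1 : ℝ) : ℝ) : ℂ))) (h2.symm.trans h)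
  rw [TemperedDistribution.fourierMultiplierCLM_fourierMultiplierCLM_apply 
    hh hasTemperateGrowth_one_add_inv, map_zero] at h3
  rw [← h3]
  have e : ((fun x : Space d => ((1 + ‖(2 * Real.pi) • x‖ ^ 2 : ℝ) : ℂ)) * fun x : Space d =>
   (((1 + ‖(2 * Real.pi) • x‖ ^ 2) ^ (-1 : ℝ) : ℝ) : ℂ)) = fun _ => 1 := by
    ext x
    have : (0:ℝ) < 1 + ‖(2 * Real.pi) • x‖ ^ 2 := by positivity
    rw [Pi.mul_apply, Real.rpow_neg_one, ← Complex.ofReal_mul, mul_inv_cancel₀ this.ne', Complex.ofReal_one]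
  rw [e]
  simp

/-- The witness is u = φ̄ e_i: the L² inner product is conjugate linear on the left whereas a
distribution pairs linearly with φ. This translates orthogonality in L² into equations between
distributions. -/
theorem inner_schwartz_smul (φ : 𝓢(Space d, ℂ)) (i : Fin (spinorDim d)) :
    ∃ u : 𝓢(Space d, Spinor d), (∀ g : SpinorL2 d,
      inner ℂ (u.toLp 2 volume) g = toDistribution d g φ i) ∧
      ∀ j : Fin d, ∀ h : SpinorL2 d, inner ℂ (SchwartzMap.toLp (∂_{basisVec j} u) 2 volume) h
        = toDistribution d h (∂_{basisVec j} φ) i := by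
  let s : Spinor d := EuclideanSpace.single i 1
  let L : ℂ →L[ℝ] Spinor d :=
    ((ContinuousLinearMap.toSpanSingleton ℂ s).restrictScalars ℝ).comp (Complex.conjCLE : ℂ →L[ℝ] ℂ)
  have hL : ∀ c, L c = (starRingEnd ℂ c) • s := fun c => by simp [L]
  have key : ∀ (φ : 𝓢(Space d, ℂ)) (g : SpinorL2 d),
      inner ℂ ((SchwartzMap.postcompCLM L φ).toLp 2 volume) g = toDistribution d g φ i := by
    intro φ g
    rw [MeasureTheory.L2.inner_def]
    simp only [toDistribution, Lp.toTemperedDistributionCLM_apply, Lp.toTemperedDistribution_apply]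
    have hint : Integrable (fun x => φ x • g x) volume := by
      have h1 : MemLp φ 2 (volume : Measure (Space d)) := φ.memLp 2 volume
      exact (Lp.memLp g).smul h1 |> memLp_one_iff_integrable.mp
    have := (EuclideanSpace.proj i : Spinor d →L[ℂ] ℂ).integral_comp_comm hint
    refine Eq.trans ?_ this
    refine integral_congr_ae ?_
    filter_upwards [SchwartzMap.coeFn_toLp (SchwartzMap.postcompCLM L φ) 2 volume] with x hx
    rw [hx, SchwartzMap.postcompCLM_apply, hL, inner_smul_left]
    simp [s, EuclideanSpace.inner_single_left]
  refine ⟨SchwartzMap.postcompCLM L φ, key φ, fun j h => ?_⟩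
  rw [← key]
  congr 2
  ext1 x
  rw [SchwartzMap.postcompCLM_apply, SchwartzMap.lineDerivOp_apply_eq_fderiv, SchwartzMap.lineDerivOp_apply_eq_fderiv]
  have : (SchwartzMap.postcompCLM L φ : Space d → Spinor d) = fun x => L (φ x) := by
    ext1 x; simp
  rw [this]
  have := (L.hasFDerivAt.comp x φ.differentiableAt.hasFDerivAt).fderiv
  simp only [Function.comp_def] at this
  rw [this]; rfl
-- Orthogonality of (ψ, ∇ψ) to every Schwartz jet (u, ∇u) is the weak form of ψ − Δψ = 0.
theorem sobolevJets_eq_zero {p : PiLp 2 (fun _ : Option (Fin d) => SpinorL2 d)}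
    (hp : p ∈ sobolevJets d) (ho : p ∈ (LinearMap.range (schwartzJet d))ᗮ) : p = 0 := by
  set T := toDistribution d (p none) with hT
  have hlap : T - Laplacian.laplacian T = 0 := by
    rw [TemperedDistribution.laplacian_eq_sum (EuclideanSpace.basisFun (Fin d) ℝ)]
    ext φ i
    obtain ⟨u, hu, hu'⟩ := inner_schwartz_smul φ i
    have h0 := ho _ (LinearMap.mem_range_self (schwartzJet d) u)
    rw [PiLp.inner_apply, Fintype.sum_option, schwartzJet_none, hu] at h0
    have hp' : ∀ j : Fin d, toDistribution d (p (some j)) = ∂_{basisVec j} T := fun j => (hp j).symm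
    simp only [schwartzJet_some, hu', hp'] at h0
    simp only [EuclideanSpace.basisFun_apply]
    rw [sub_apply, sum_apply]
    simp only [TemperedDistribution.lineDerivOp_apply_apply, map_neg, neg_neg] at h0 ⊢
    simp only [PiLp.sub_apply, PiLp.neg_apply, WithLp.ofLp_sum, Finset.sum_apply, PiLp.zero_apply, zero_apply,
      Finset.sum_neg_distrib] at h0 ⊢
    rw [← h0, sub_eq_add_neg]
  have h0 : p none = 0 := toDistribution_injective d
    (by rw [map_zero]; exact eq_zero_of_sub_laplacian_eq_zero hlap)
  ext1 o
  match o with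
  | none => exact h0
  | some j =>
    refine toDistribution_injective d ?_
    rw [← hp j, h0, map_zero]
    exact (map_zero (LineDeriv.lineDerivOpCLM ℂ 𝓢'(Space d, Spinor d) (basisVec j))).trans
      (map_zero _).symm

/-- Project the jet of ψ onto the closure of the Schwartz jets. Projection and remainder are both
Sobolev jets, since these form a closed set given by linear equations; the remainder is orthogonal
to all Schwartz jets and hence zero. -/
theorem exists_schwartz_approx (ψ : H1 d) : ∃ u : ℕ → 𝓢(Space d, Spinor d),
    Tendsto (fun n => (u n).toLp 2 volume) atTop (𝓝 (ψ : SpinorL2 d)) ∧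
    ∀ j, Tendsto (fun n => (∂_{basisVec j} (u n)).toLp 2 volume) atTop (𝓝 (weakDeriv j ψ)) := by
  let p : PiLp 2 (fun _ : Option (Fin d) => SpinorL2 d) :=
    WithLp.toLp 2 fun o => match o with
      | none => (ψ : SpinorL2 d)
      | some j => weakDeriv j ψ
  have hp : p ∈ sobolevJets d := fun j => weakDeriv_spec j ψ
  let S := LinearMap.range (schwartzJet d)
  obtain ⟨q, hq, r, hr, hpqr⟩ := S.topologicalClosure.exists_add_mem_mem_orthogonal p
  have hqG : q ∈ sobolevJets d := by
    have : (S.topologicalClosure : Set _) ⊆ sobolevJets d := by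
      rw [Submodule.topologicalClosure_coe]
      refine isClosed_sobolevJets.closure_subset_iff.mpr ?_
      rintro _ ⟨u, rfl⟩ j
      exact lineDeriv_toDistribution_schwartz u j
    exact this hq
  have hrG : r ∈ sobolevJets d := by
    intro j
    have hr' : r = p - q := by rw [hpqr]; abel
    have e : ∀ o, r o = p o - q o := fun o => by rw [hr']; rfl
    rw [e, e, map_sub, map_sub, ← hp j, ← hqG j]
    exact map_sub (LineDeriv.lineDerivOpCLM ℂ 𝓢'(Space d, Spinor d) (basisVec j)) _ _
  have hr0 : r = 0 := by
    refine sobolevJets_eq_zero hrG ?_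
    exact Submodule.orthogonal_le S.le_topologicalClosure hr
  have hpS : p ∈ closure (S : Set _) := by
    rw [← Submodule.topologicalClosure_coe, hpqr, hr0, add_zero]
    exact hq
  obtain ⟨s, hs, hlim⟩ := mem_closure_iff_seq_limit.mp hpS
  choose u hu using hs
  refine ⟨u, ?_, fun j => ?_⟩
  · have := ((PiLp.proj 2 (𝕜 := ℂ) (fun _ : Option (Fin d) => SpinorL2 d) none).continuous.tendsto
      p).comp hlim
    refine this.congr fun n => ?_
    simp only [Function.comp, ← hu]
    rfl
  · have := ((PiLp.proj 2 (𝕜 := ℂ) (fun _ : Option (Fin d) => SpinorL2 d) (some j)).continuous.tendsto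
      p).comp hlim
    refine this.congr fun n => ?_
    simp only [Function.comp, ← hu]
    rfl

/-! ### Integration by parts in H¹ against smooth compactly supported weights -/

theorem integral_fderiv_eq_zero {F : Space d → ℝ} (hF : ContDiff ℝ 1 F) (hc : HasCompactSupport F)
    (v : Space d) : ∫ x, fderiv ℝ F x v = 0 := by
  have h1 : Continuous fun x => fderiv ℝ F x v :=
    (hF.continuous_fderiv one_ne_zero).clm_apply continuous_const
  have h2 : HasCompactSupport fun x => fderiv ℝ F x v := hc.fderiv_apply ℝ v
  have := integral_mul_fderiv_eq_neg_fderiv_mul_of_integrable (𝕜 := ℝ) (μ := volume)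
    (f := fun _ : Space d => (1 : ℝ)) (g := F) (v := v) (by simp) (by simpa using h1.integrable_of_hasCompactSupport h2)
    (by simpa using hF.continuous.integrable_of_hasCompactSupport hc) (by fun_prop)
    (fun x _ => hF.differentiable one_ne_zero x)
  simpa using this

/-- Hölder with exponents ∞, 2, 2 makes the weighted pairing jointly continuous on L² × L². It
carries quadratic identities from Schwartz functions to H¹. -/
theorem tendsto_integral_mul_bilin (b : Spinor d →L[ℝ] Spinor d →L[ℝ] ℝ) {w : Space d → ℝ}
    (hw : MemLp w ∞ volume) {f h : ℕ → SpinorL2 d} {f₀ h₀ : SpinorL2 d}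
    (hf : Tendsto f atTop (𝓝 f₀)) (hh : Tendsto h atTop (𝓝 h₀)) :
    Tendsto (fun n => ∫ x, w x * b (f n x) (h n x)) atTop (𝓝 (∫ x, w x * b (f₀ x) (h₀ x))) := by
  have key : ∀ f h : SpinorL2 d, (ContinuousLinearMap.mul ℝ ℝ).lpPairing volume ∞ 1 (hw.toLp w)
      (b.holder 1 f h) = ∫ x, w x * b (f x) (h x) := by
    intro f h
    rw [ContinuousLinearMap.lpPairing_eq_integral]
    refine integral_congr_ae ?_
    filter_upwards [hw.coeFn_toLp, b.coeFn_holder (r := 1) f h] with x h1 h2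
    rw [h1, h2]; rfl
  simp only [← key]
  refine (ContinuousLinearMap.continuous _).continuousAt.tendsto.comp ?_
  have := ((b.holderL (volume : Measure (Space d)) 2 2 1).isBoundedBilinearMap.continuous.tendsto
    (f₀, h₀)).comp (hf.prodMk_nhds hh)
  exact this

theorem abs_integral_mul_le {f g : Space d → ℝ} (hf : MemLp f 2 volume) (hg : MemLp g 2 volume) :
    |∫ x, f x * g x| ≤ √(∫ x, f x ^ 2) * √(∫ x, g x ^ 2) := by
  have hn : ∀ {f : Space d → ℝ} (hf : MemLp f 2 volume), ‖hf.toLp f‖ = √(∫ x, f x ^ 2) := by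
    intro f hf
    have h := real_inner_self_eq_norm_sq (hf.toLp f)
    rw [L2.inner_def] at h
    rw [← Real.sqrt_sq (norm_nonneg (hf.toLp f)), ← h]
    congr 1
    refine integral_congr_ae ?_
    filter_upwards [hf.coeFn_toLp] with x h1
    rw [h1, real_inner_self_eq_norm_sq, Real.norm_eq_abs, sq_abs]
  have h := abs_real_inner_le_norm (hf.toLp f) (hg.toLp g)
  rw [hn, hn, L2.inner_def] at h
  refine le_of_eq_of_le (congrArg _ (integral_congr_ae ?_)) h
  filter_upwards [hf.coeFn_toLp, hg.coeFn_toLp] with x h1 h2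
  rw [h1, h2]
  simp [mul_comm]

theorem norm_sq_eq_integral (f : SpinorL2 d) : ‖f‖ ^ 2 = ∫ x, ‖f x‖ ^ 2 := by
  have h := inner_self_eq_norm_sq_to_K (𝕜 := ℂ) f
  rw [L2.inner_def] at h
  simp only [inner_self_eq_norm_sq_to_K] at h
  have h2 : ((∫ x, ‖f x‖ ^ 2 : ℝ) : ℂ) = ((‖f‖ ^ 2 : ℝ) : ℂ) := by
    rw [← integral_complex_ofReal]
    simpa using h
  exact_mod_cast h2.symm

/-- Split f_n = f₀ + (f_n − f₀): dominated convergence treats the fixed part, Cauchy–Schwarz the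
rest. Almost everywhere convergence of the functionals is enough, which is all one has when they are
derivatives of a nonlinear function along an approximating sequence. -/
theorem tendsto_integral_mul_clm {h : Space d → ℝ} (hh : MemLp h 2 volume)
    {f : ℕ → SpinorL2 d} {f₀ : SpinorL2 d} (hf : Tendsto f atTop (𝓝 f₀))
    {L : ℕ → Space d → (Spinor d →L[ℝ] ℝ)} {L₀ : Space d → (Spinor d →L[ℝ] ℝ)} {C : ℝ}
    (hLm : ∀ n, AEStronglyMeasurable (L n) volume)
    (hL : ∀ n x, ‖L n x‖ ≤ C) (hLlim : ∀ᵐ x, Tendsto (fun n => L n x) atTop (𝓝 (L₀ x))) :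
    Tendsto (fun n => ∫ x, h x * L n x (f n x)) atTop (𝓝 (∫ x, h x * L₀ x (f₀ x))) := by
  have hbound : ∀ (n : ℕ) (g : SpinorL2 d) (x : Space d), ‖h x * L n x (g x)‖ ≤ C * (‖h x‖ * ‖g x‖) := by
    intro n g x
    rw [norm_mul]
    nlinarith [mul_le_mul_of_nonneg_left (((L n x).le_opNorm (g x)).trans
      (mul_le_mul_of_nonneg_right (hL n x) (norm_nonneg _))) (norm_nonneg (h x))]
  have hint : ∀ g : SpinorL2 d, Integrable (fun x => ‖h x‖ * ‖g x‖) volume := fun g =>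
    hh.norm.integrable_mul (Lp.memLp g).norm
  have hmeas : ∀ (n : ℕ) (g : SpinorL2 d), AEStronglyMeasurable (fun x => h x * L n x (g x)) volume :=
    fun n g => hh.1.mul (isBoundedBilinearMap_apply.continuous.comp_aestronglyMeasurable
      ((hLm n).prodMk (Lp.aestronglyMeasurable g)))
  have h1 : Tendsto (fun n => ∫ x, h x * L n x (f₀ x)) atTop (𝓝 (∫ x, h x * L₀ x (f₀ x))) := by
    refine tendsto_integral_of_dominated_convergence _ (fun n => hmeas n f₀)
      ((hint f₀).const_mul C) (fun n => Eventually.of_forall (hbound n f₀)) ?_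
    filter_upwards [hLlim] with x hx
    exact (((ContinuousLinearMap.apply ℝ ℝ (f₀ x)).continuous.tendsto _).comp hx).const_mul _
  have h2 : Tendsto (fun n => ∫ x, h x * L n x ((f n - f₀ : SpinorL2 d) x)) atTop (𝓝 0) := by
    have hlim : Tendsto (fun n => C * (√(∫ x, ‖h x‖ ^ 2) * ‖f n - f₀‖)) atTop (𝓝 0) := by
      have := (tendsto_iff_norm_sub_tendsto_zero.mp hf).const_mul (C * √(∫ x, ‖h x‖ ^ 2))
      simpa [mul_assoc] using this
    refine squeeze_zero_norm (fun n => ?_) hlim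
    have h3 := abs_integral_mul_le hh.norm (Lp.memLp (f n - f₀)).norm
    rw [← norm_sq_eq_integral, Real.sqrt_sq (norm_nonneg _)] at h3
    calc ‖∫ x, h x * L n x ((f n - f₀ : SpinorL2 d) x)‖
        ≤ ∫ x, C * (‖h x‖ * ‖(f n - f₀ : SpinorL2 d) x‖) :=
          norm_integral_le_of_norm_le ((hint _).const_mul C)
            (Eventually.of_forall (hbound n (f n - f₀)))
      _ = C * ∫ x, ‖h x‖ * ‖(f n - f₀ : SpinorL2 d) x‖ := integral_const_mul _ _
      _ ≤ C * (√(∫ x, ‖h x‖ ^ 2) * ‖f n - f₀‖) :=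
          mul_le_mul_of_nonneg_left ((le_abs_self _).trans h3)
            ((norm_nonneg _).trans (hL 0 0))
  have h4 := h1.add h2
  rw [add_zero] at h4
  refine h4.congr fun n => ?_
  have hi : ∀ g : SpinorL2 d, Integrable (fun x => h x * L n x (g x)) volume := fun g =>
    ((hint g).const_mul C).mono' (hmeas n g) (Eventually.of_forall (hbound n g))
  rw [← integral_add (hi _) (hi _)]
  refine integral_congr_ae ?_
  filter_upwards [Lp.coeFn_sub (f n) f₀] with x hx
  rw [hx, Pi.sub_apply, map_sub]
  ring

theorem memLp_top_of_hasCompactSupport {w : Space d → ℝ} (hw : Continuous w)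
    (hc : HasCompactSupport w) : MemLp w ∞ volume := by
  obtain ⟨C, hC⟩ := hc.exists_bound_of_continuous hw
  exact memLp_top_of_bound hw.aestronglyMeasurable C (Eventually.of_forall hC)

theorem exists_schwartz_approx_ae (ψ : H1 d) : ∃ u : ℕ → 𝓢(Space d, Spinor d),
    Tendsto (fun n => (u n).toLp 2 volume) atTop (𝓝 (ψ : SpinorL2 d)) ∧
    (∀ j : Fin d, Tendsto (fun n => SchwartzMap.toLp (∂_{basisVec j} (u n)) 2 volume) atTop
      (𝓝 (weakDeriv j ψ))) ∧
    ∀ᵐ x, Tendsto (fun n => u n x) atTop (𝓝 ((ψ : SpinorL2 d) x)) := by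
  obtain ⟨u, h1, h2⟩ := exists_schwartz_approx ψ
  obtain ⟨ns, hns, hae⟩ := (tendstoInMeasure_of_tendsto_Lp h1).exists_seq_tendsto_ae
  refine ⟨fun n => u (ns n), h1.comp hns.tendsto_atTop,
    fun j => (h2 j).comp hns.tendsto_atTop, ?_⟩
  filter_upwards [hae, ae_all_iff.mpr fun n => (u n).coeFn_toLp 2 volume] with x hx hx'
  exact hx.congr fun n => hx' (ns n)

theorem hasFDerivAt_bilin (b : Spinor d →L[ℝ] Spinor d →L[ℝ] ℝ) {g : Space d → ℝ}
    (hg : ContDiff ℝ ∞ g) (u w : 𝓢(Space d, Spinor d)) (j : Fin d) (x : Space d) :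
    fderiv ℝ (fun x => g x * b (u x) (w x)) x (basisVec j)
      = fderiv ℝ g x (basisVec j) * b (u x) (w x)
        + g x * (b ((∂_{basisVec j} u) x) (w x) + b (u x) ((∂_{basisVec j} w) x)) := by
  have hg' : HasFDerivAt g (fderiv ℝ g x) x := (hg.differentiable (by simp) x).hasFDerivAt
  have h := hg'.mul (b.hasFDerivAt_of_bilinear u.differentiableAt.hasFDerivAt
    w.differentiableAt.hasFDerivAt)
  have h' := h.fderiv
  simp only [Pi.mul_def] at h'
  rw [h']
  simp [SchwartzMap.lineDerivOp_apply_eq_fderiv]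
  ring

theorem contDiff_bilin (b : Spinor d →L[ℝ] Spinor d →L[ℝ] ℝ) {g : Space d → ℝ}
    (hg : ContDiff ℝ ∞ g) (u w : 𝓢(Space d, Spinor d)) :
    ContDiff ℝ ∞ (fun x => g x * b (u x) (w x)) :=
  hg.mul ((b.contDiff.comp (u.smooth ⊤)).clm_apply (w.smooth ⊤))

theorem lineDerivOp_comm (u : 𝓢(Space d, Spinor d)) (j k : Fin d) :
    ∂_{basisVec j} (∂_{basisVec k} u) = (∂_{basisVec k} (∂_{basisVec j} u) : 𝓢(Space d, Spinor d)) := by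
  ext1 x
  simp only [SchwartzMap.lineDerivOp_apply_eq_fderiv]
  have hu : ContDiff ℝ ∞ u := u.smooth ⊤
  have hd : Differentiable ℝ (fderiv ℝ u) := (hu.fderiv_right (m := 1) (by norm_cast)).differentiable one_ne_zero
  have e : ∀ k : Fin d, (∂_{basisVec k} u : 𝓢(Space d, Spinor d)) = fun x => fderiv ℝ u x (basisVec k) := by
    intro k; ext1 x; rw [SchwartzMap.lineDerivOp_apply_eq_fderiv]
  rw [e, e, fderiv_clm_apply (hd x) (by fun_prop), fderiv_clm_apply (hd x) (by fun_prop)]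
  have := (hu.contDiffAt (x := x)).isSymmSndFDerivAt (by simp; norm_cast)
  simp [this.eq]

theorem integrable_mul_bilin (b : Spinor d →L[ℝ] Spinor d →L[ℝ] ℝ) {w : Space d → ℝ}
    (hw : MemLp w ∞ volume) (f h : SpinorL2 d) :
    Integrable (fun x => w x * b (f x) (h x)) volume := by
  have h1 : Integrable (fun x => b (f x) (h x)) volume :=
    (L1.integrable_coeFn (b.holder 1 f h)).congr (b.coeFn_holder f h)
  exact memLp_one_iff_integrable.mp ((memLp_one_iff_integrable.mpr h1).mul hw)

theorem integral_mul_bilin_toLp (b : Spinor d →L[ℝ] Spinor d →L[ℝ] ℝ) (w : Space d → ℝ)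
    (f h : 𝓢(Space d, Spinor d)) :
    ∫ x, w x * b (f.toLp 2 volume x) (h.toLp 2 volume x) = ∫ x, w x * b (f x) (h x) := by
  refine integral_congr_ae ?_
  filter_upwards [f.coeFn_toLp 2 volume, h.coeFn_toLp 2 volume] with x h1 h2
  rw [h1, h2]

theorem contDiff_partial {g : Space d → ℝ} (hg : ContDiff ℝ ∞ g) (v : Space d) :
    ContDiff ℝ ∞ fun x => fderiv ℝ g x v :=
  (hg.fderiv_right (by norm_cast)).clm_apply contDiff_const

theorem memLp_top_partial {g : Space d → ℝ} (hg : ContDiff ℝ ∞ g) (hc : HasCompactSupport g)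
    (v : Space d) : MemLp (fun x => fderiv ℝ g x v) ∞ volume :=
  memLp_top_of_hasCompactSupport (contDiff_partial hg v).continuous (hc.fderiv_apply ℝ v)

theorem integral_partial_bilin_schwartz (b : Spinor d →L[ℝ] Spinor d →L[ℝ] ℝ) {g : Space d → ℝ}
    (hg : ContDiff ℝ ∞ g) (hc : HasCompactSupport g) (u w : 𝓢(Space d, Spinor d)) (j : Fin d) :
    (∫ x, fderiv ℝ g x (basisVec j) * b (u x) (w x))
      + (∫ x, g x * b ((∂_{basisVec j} u) x) (w x))
      + ∫ x, g x * b (u x) ((∂_{basisVec j} w) x) = 0 := by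
  have hcF : HasCompactSupport (fun x => g x * b (u x) (w x)) := hc.mul_right
  have h0 := integral_fderiv_eq_zero ((contDiff_bilin b hg u w).of_le (by norm_cast)) hcF (basisVec j)
  simp only [hasFDerivAt_bilin b hg u w j, mul_add] at h0
  have hi : ∀ {w : Space d → ℝ}, MemLp w ∞ volume → ∀ f h : 𝓢(Space d, Spinor d),
      Integrable (fun x => w x * b (f x) (h x)) volume := by
    intro w hw f h
    refine (integrable_mul_bilin b hw (f.toLp 2 volume) (h.toLp 2 volume)).congr ?_
    filter_upwards [f.coeFn_toLp 2 volume, h.coeFn_toLp 2 volume] with x h1 h2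
    rw [h1, h2]
  have hgb := memLp_top_of_hasCompactSupport hg.continuous hc
  have hgj := memLp_top_partial hg hc (basisVec j)
  have hadd : Integrable (fun x => g x * b ((∂_{basisVec j} u) x) (w x)
      + g x * b (u x) ((∂_{basisVec j} w) x)) volume := (hi hgb _ _).add (hi hgb _ _)
  rw [integral_add (hi hgj u w) hadd,
    integral_add (hi hgb _ _) (hi hgb _ _), ← add_assoc] at h0
  exact h0

theorem integral_mul_weakDeriv (b : Spinor d →L[ℝ] Spinor d →L[ℝ] ℝ) {g : Space d → ℝ}
    (hg : ContDiff ℝ ∞ g) (hc : HasCompactSupport g) (ψ : H1 d) (j : Fin d) :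
    ∫ x, g x * (b (weakDeriv j ψ x) ((ψ : SpinorL2 d) x) + b ((ψ : SpinorL2 d) x) (weakDeriv j ψ x))
      = -∫ x, fderiv ℝ g x (basisVec j) * b ((ψ : SpinorL2 d) x) ((ψ : SpinorL2 d) x) := by
  obtain ⟨u, hu, hu'⟩ := exists_schwartz_approx ψ
  have hgb := memLp_top_of_hasCompactSupport hg.continuous hc
  have hgj := memLp_top_partial hg hc (basisVec j)
  have h1 := ((tendsto_integral_mul_bilin b hgj hu hu).add
    (tendsto_integral_mul_bilin b hgb (hu' j) hu)).add (tendsto_integral_mul_bilin b hgb hu (hu' j))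
  simp only [integral_mul_bilin_toLp, integral_partial_bilin_schwartz b hg hc] at h1
  have h2 := tendsto_nhds_unique h1 tendsto_const_nhds
  simp only [mul_add]
  rw [integral_add (integrable_mul_bilin b hgb _ _) (integrable_mul_bilin b hgb _ _)]
  linarith

/-- For smooth u, integrate ∂_j of g b(u, ∂_k u) and ∂_k of g b(u, ∂_j u) and subtract. The second
derivatives cancel, so the identity survives for ψ with only one weak derivative. -/
theorem integral_mul_weakDeriv_antisymm (b : Spinor d →L[ℝ] Spinor d →L[ℝ] ℝ) {g : Space d → ℝ}
    (hg : ContDiff ℝ ∞ g) (hc : HasCompactSupport g) (ψ : H1 d) (j k : Fin d) :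
    ∫ x, g x * (b (weakDeriv j ψ x) (weakDeriv k ψ x) - b (weakDeriv k ψ x) (weakDeriv j ψ x))
      = -(∫ x, fderiv ℝ g x (basisVec j) * b ((ψ : SpinorL2 d) x) (weakDeriv k ψ x))
        + ∫ x, fderiv ℝ g x (basisVec k) * b ((ψ : SpinorL2 d) x) (weakDeriv j ψ x) := by
  obtain ⟨u, hu, hu'⟩ := exists_schwartz_approx ψ
  have hgb := memLp_top_of_hasCompactSupport hg.continuous hc
  have hgp := fun j : Fin d => memLp_top_partial hg hc (basisVec j)
  have hs : ∀ n, (∫ x, fderiv ℝ g x (basisVec j) * b (u n x) ((∂_{basisVec k} (u n)) x))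
      + (∫ x, g x * b ((∂_{basisVec j} (u n)) x) ((∂_{basisVec k} (u n)) x))
      - (∫ x, fderiv ℝ g x (basisVec k) * b (u n x) ((∂_{basisVec j} (u n)) x))
      - (∫ x, g x * b ((∂_{basisVec k} (u n)) x) ((∂_{basisVec j} (u n)) x)) = 0 := by
    intro n
    have e1 := integral_partial_bilin_schwartz b hg hc (u n) (∂_{basisVec k} (u n)) j
    have e2 := integral_partial_bilin_schwartz b hg hc (u n) (∂_{basisVec j} (u n)) k
    rw [lineDerivOp_comm] at e1
    linarith
  have h1 := (((tendsto_integral_mul_bilin b (hgp j) hu (hu' k)).add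
    (tendsto_integral_mul_bilin b hgb (hu' j) (hu' k))).sub
    (tendsto_integral_mul_bilin b (hgp k) hu (hu' j))).sub
    (tendsto_integral_mul_bilin b hgb (hu' k) (hu' j))
  simp only [integral_mul_bilin_toLp, hs] at h1
  have h2 := tendsto_nhds_unique h1 tendsto_const_nhds
  simp only [mul_sub]
  rw [integral_sub (integrable_mul_bilin b hgb _ _) (integrable_mul_bilin b hgb _ _)]
  linarith

/-! ### Testing the magnetic field against quadratic expressions in ψ -/

theorem MemL2Loc.locallyIntegrable {f : Space d → ℝ} (hf : MemL2Loc f) :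
    LocallyIntegrable f volume := by
  rw [locallyIntegrable_iff]
  intro K hK
  have : IsFiniteMeasure (volume.restrict K : Measure (Space d)) :=
    isFiniteMeasure_restrict.mpr hK.measure_lt_top.ne
  exact memLp_one_iff_integrable.mp ((hf K hK).mono_exponent one_le_two)

theorem MemL2Loc.aestronglyMeasurable {F : Type*} [NormedAddCommGroup F] {f : Space d → F}
    (hf : MemL2Loc f) : AEStronglyMeasurable f volume := by
  have h : AEStronglyMeasurable f
      (volume.restrict (⋃ n : ℕ, Metric.closedBall (0 : Space d) n)) :=
    aestronglyMeasurable_iUnion_iff.mpr fun n =>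
      (hf _ (isCompact_closedBall (0 : Space d) n)).1
  rwa [Metric.iUnion_closedBall_nat, Measure.restrict_univ] at h

theorem MemL2Loc.mul_memLp {f g : Space d → ℝ} (hf : MemL2Loc f) (hg : Continuous g)
    (hc : HasCompactSupport g) : MemLp (fun x => g x * f x) 2 volume := by
  have h1 : MemLp (fun x => g x * f x) 2 (volume.restrict (tsupport g)) :=
    (hf _ hc).mul ((memLp_top_of_hasCompactSupport hg hc).restrict _)
  have h2 : (tsupport g).indicator (fun x => g x * f x) = fun x => g x * f x := by
    refine Set.indicator_eq_self.mpr fun x hx => subset_tsupport g ?_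
    exact left_ne_zero_of_mul hx
  rw [← h2]
  exact (memLp_indicator_iff_restrict (isClosed_tsupport g).measurableSet).mpr h1

theorem MemL2Loc.mul_integrable {f g : Space d → ℝ} (hf : MemL2Loc f) (hg : Continuous g)
    (hc : HasCompactSupport g) : Integrable (fun x => g x * f x) volume :=
  hf.locallyIntegrable.integrable_smul_left_of_hasCompactSupport hg hc

theorem MemL2Loc.apply {A : Space d → Space d} (hA : MemL2Loc A) (k : Fin d) :
    MemL2Loc (fun x => A x k) := fun K hK =>
  (hA K hK).continuousLinearMap_comp (EuclideanSpace.proj k : Space d →L[ℝ] ℝ)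

/-- The functions gΦ(u_n) with u_n Schwartz are admissible test functions. Boundedness of Φ
dominates the terms without derivatives of u_n, where gB and (∂g)A are integrable; boundedness of
its derivative allows gA ∈ L² to be paired with ∂u_n, which converges in L². -/
theorem magneticField_nonlinear {A : Space d → Space d} {B : Space d → Matrix (Fin d) (Fin d) ℝ}
    (hA : MemL2Loc A) (hB : ∀ j k, MemL2Loc (fun x => B x j k)) (hAB : IsMagneticField A B)
    {Φ : Spinor d → ℝ} (hΦ : ContDiff ℝ ∞ Φ) {C : ℝ} (hC : ∀ u, |Φ u| ≤ C)
    (hC' : ∀ u, ‖fderiv ℝ Φ u‖ ≤ C) {g : Space d → ℝ} (hg : ContDiff ℝ ∞ g)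
    (hc : HasCompactSupport g) (ψ : H1 d) (j k : Fin d) :
    ∫ x, g x * B x j k * Φ ((ψ : SpinorL2 d) x)
      = -(((∫ x, fderiv ℝ g x (basisVec j) * A x k * Φ ((ψ : SpinorL2 d) x))
            + ∫ x, g x * A x k * fderiv ℝ Φ ((ψ : SpinorL2 d) x) (weakDeriv j ψ x))
          - ((∫ x, fderiv ℝ g x (basisVec k) * A x j * Φ ((ψ : SpinorL2 d) x))
            + ∫ x, g x * A x j * fderiv ℝ Φ ((ψ : SpinorL2 d) x) (weakDeriv k ψ x))) := by
  obtain ⟨u, hu, hu', hae⟩ := exists_schwartz_approx_ae ψ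
  have hΦ' : Continuous (fderiv ℝ Φ) := hΦ.continuous_fderiv (by simp)
  have lim0 : ∀ {w : Space d → ℝ}, Integrable w volume →
      Tendsto (fun n => ∫ x, w x * Φ (u n x)) atTop (𝓝 (∫ x, w x * Φ ((ψ : SpinorL2 d) x))) := by
    intro w hw
    refine tendsto_integral_of_dominated_convergence (fun x => ‖w x‖ * C)
      (fun n => hw.1.mul (hΦ.continuous.comp (u n).continuous).aestronglyMeasurable)
      (hw.norm.mul_const C) (fun n => Eventually.of_forall fun x => ?_) ?_
    · rw [norm_mul]
      exact mul_le_mul_of_nonneg_left (hC _) (norm_nonneg _)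
    · filter_upwards [hae] with x hx
      exact ((hΦ.continuous.tendsto _).comp hx).const_mul _
  have lim1 : ∀ {w : Space d → ℝ}, MemLp w 2 volume → ∀ i : Fin d,
      Tendsto (fun n => ∫ x, w x * fderiv ℝ Φ (u n x) ((∂_{basisVec i} (u n)) x)) atTop
        (𝓝 (∫ x, w x * fderiv ℝ Φ ((ψ : SpinorL2 d) x) (weakDeriv i ψ x))) := by
    intro w hw i
    refine (tendsto_integral_mul_clm hw (hu' i) (L := fun n x => fderiv ℝ Φ (u n x))
      (fun n => (hΦ'.comp (u n).continuous).aestronglyMeasurable) (fun n x => hC' _)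
      (L₀ := fun x => fderiv ℝ Φ ((ψ : SpinorL2 d) x)) ?_).congr fun n => ?_
    · filter_upwards [hae] with x hx
      exact (hΦ'.tendsto _).comp hx
    · refine integral_congr_ae ?_
      filter_upwards [SchwartzMap.coeFn_toLp (∂_{basisVec i} (u n)) 2 volume] with x hx
      rw [hx]
  have hgc := fun i : Fin d => (contDiff_partial hg (basisVec i)).continuous
  have hgs := fun i : Fin d => hc.fderiv_apply ℝ (basisVec i)
  have hAi := fun i : Fin d => hA.apply i
  have hsm : ∀ n, ContDiff ℝ ∞ fun x => g x * Φ (u n x) := fun n =>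
    hg.mul (hΦ.comp ((u n).smooth ⊤))
  have hpd : ∀ n x, ∀ i : Fin d, fderiv ℝ (fun x => g x * Φ (u n x)) x (basisVec i)
      = fderiv ℝ g x (basisVec i) * Φ (u n x)
        + g x * fderiv ℝ Φ (u n x) ((∂_{basisVec i} (u n)) x) := by
    intro n x i
    have hg' : HasFDerivAt g (fderiv ℝ g x) x := (hg.differentiable (by simp) x).hasFDerivAt
    have h2 : HasFDerivAt Φ (fderiv ℝ Φ (u n x)) (u n x) :=
      (hΦ.differentiable (by simp) _).hasFDerivAt
    have h := (hg'.mul (h2.comp x (u n).differentiableAt.hasFDerivAt)).fderiv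
    simp only [Pi.mul_def, Function.comp_def] at h
    rw [h]
    simp [SchwartzMap.lineDerivOp_apply_eq_fderiv]
    ring
  have hint0 : ∀ {w : Space d → ℝ}, Integrable w volume → ∀ n,
      Integrable (fun x => w x * Φ (u n x)) volume := fun hw n =>
    (hw.norm.mul_const C).mono'
      (hw.1.mul (hΦ.continuous.comp (u n).continuous).aestronglyMeasurable)
      (Eventually.of_forall fun x => by
        rw [norm_mul]; exact mul_le_mul_of_nonneg_left (hC _) (norm_nonneg _))
  have hint1 : ∀ {w : Space d → ℝ}, MemLp w 2 volume → ∀ n, ∀ i : Fin d,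
      Integrable (fun x => w x * fderiv ℝ Φ (u n x) ((∂_{basisVec i} (u n)) x)) volume := by
    intro w hw n i
    refine ((hw.norm.integrable_mul
      (SchwartzMap.memLp (∂_{basisVec i} (u n)) 2 volume).norm).const_mul C).mono'
      (hw.1.mul ((hΦ'.comp (u n).continuous).clm_apply
        (SchwartzMap.continuous _)).aestronglyMeasurable) (Eventually.of_forall fun x => ?_)
    rw [norm_mul]
    have := (fderiv ℝ Φ (u n x)).le_of_opNorm_le (hC' _) ((∂_{basisVec i} (u n)) x)
    calc _ ≤ ‖w x‖ * (C * ‖(∂_{basisVec i} (u n)) x‖) :=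
          mul_le_mul_of_nonneg_left this (norm_nonneg _)
      _ = _ := by simp only [Pi.mul_apply]; ring
  have hn : ∀ n, (∫ x, g x * B x j k * Φ (u n x))
      = -(((∫ x, fderiv ℝ g x (basisVec j) * A x k * Φ (u n x))
            + ∫ x, g x * A x k * fderiv ℝ Φ (u n x) ((∂_{basisVec j} (u n)) x))
          - ((∫ x, fderiv ℝ g x (basisVec k) * A x j * Φ (u n x))
            + ∫ x, g x * A x j * fderiv ℝ Φ (u n x) ((∂_{basisVec k} (u n)) x))) := by
    intro n
    have h := hAB j k _ (hsm n) hc.mul_right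
    have e1 : ∀ x, B x j k * (g x * Φ (u n x)) = g x * B x j k * Φ (u n x) := fun x => by ring
    simp only [e1] at h
    rw [h]
    have i1 := fun j k : Fin d => hint0 ((hAi k).mul_integrable (hgc j) (hgs j)) n
    have i2 := fun j k : Fin d => hint1 ((hAi k).mul_memLp hg.continuous hc) n j
    rw [← integral_add (i1 j k) (i2 j k), ← integral_add (i1 k j) (i2 k j)]
    have i3 := fun j k : Fin d => (i1 j k).add (i2 j k)
    simp only [Pi.add_def] at i3
    rw [← integral_sub (i3 j k) (i3 k j)]
    congr 1
    refine integral_congr_ae (Eventually.of_forall fun x => ?_)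
    simp only [hpd]
    ring
  have L := lim0 ((hB j k).mul_integrable hg.continuous hc)
  have R := ((((lim0 ((hAi k).mul_integrable (hgc j) (hgs j))).add
    (lim1 ((hAi k).mul_memLp hg.continuous hc) j)).sub
    ((lim0 ((hAi j).mul_integrable (hgc k) (hgs k))).add
    (lim1 ((hAi j).mul_memLp hg.continuous hc) k)))).neg
  exact tendsto_nhds_unique L (R.congr fun n => (hn n).symm)

/-- A bounded smooth truncation of the quadratic form `u ↦ b u u`. -/
def truncForm (b : Spinor d →L[ℝ] Spinor d →L[ℝ] ℝ) (s : ℝ) (u : Spinor d) : ℝ :=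
  b u u * (1 + s * ‖u‖ ^ 2)⁻¹

section truncForm

variable (b : Spinor d →L[ℝ] Spinor d →L[ℝ] ℝ) {s : ℝ}

theorem truncForm_denom_pos (hs : 0 ≤ s) (u : Spinor d) : 0 < 1 + s * ‖u‖ ^ 2 := by positivity

theorem contDiff_truncForm (hs : 0 ≤ s) : ContDiff ℝ ∞ (truncForm b s) := by
  refine ContDiff.mul (b.contDiff.clm_apply contDiff_id) (ContDiff.inv ?_ fun u =>
    (truncForm_denom_pos hs u).ne')
  exact contDiff_const.add (contDiff_const.mul (contDiff_norm_sq ℝ))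

theorem fderiv_truncForm (hs : 0 ≤ s) (u v : Spinor d) :
    fderiv ℝ (truncForm b s) u v = (b u v + b v u) * (1 + s * ‖u‖ ^ 2)⁻¹
      - b u u * (2 * s * inner ℝ u v) * ((1 + s * ‖u‖ ^ 2)⁻¹) ^ 2 := by
  have h1 : HasFDerivAt (fun u : Spinor d => b u u) _ u :=
    b.hasFDerivAt_of_bilinear (hasFDerivAt_id u) (hasFDerivAt_id u)
  have h2 : HasFDerivAt (fun u : Spinor d => 1 + s * ‖u‖ ^ 2) _ u :=
    ((hasStrictFDerivAt_norm_sq u).hasFDerivAt.const_mul s).const_add 1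
  have h3 := (h1.mul ((hasDerivAt_inv (truncForm_denom_pos hs u).ne').comp_hasFDerivAt u h2)).fderiv
  have e : truncForm b s = (fun u : Spinor d => b u u)
      * (Inv.inv ∘ fun u : Spinor d => 1 + s * ‖u‖ ^ 2) := rfl
  rw [e, h3]
  simp
  ring

theorem abs_truncForm_le (hs : 0 ≤ s) (u : Spinor d) : |truncForm b s u| ≤ ‖b‖ * ‖u‖ ^ 2 := by
  rw [truncForm, abs_mul, abs_of_pos (inv_pos.mpr (truncForm_denom_pos hs u))]
  have h1 : |b u u| ≤ ‖b‖ * ‖u‖ * ‖u‖ := b.le_opNorm₂ u u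
  have h2 : (1 + s * ‖u‖ ^ 2)⁻¹ ≤ 1 := inv_le_one_of_one_le₀ (by nlinarith [mul_nonneg hs (sq_nonneg ‖u‖)])
  calc _ ≤ |b u u| * 1 := mul_le_mul_of_nonneg_left h2 (abs_nonneg _)
    _ ≤ _ := by rw [mul_one]; exact h1.trans_eq (by ring)

/-- Of the factor 4, one half comes from the two slots of b and the other from the denominator,
where s‖u‖² is absorbed by one power of (1 + s‖u‖²)⁻¹. -/
theorem abs_fderiv_truncForm_le (hs : 0 ≤ s) (u v : Spinor d) :
    |fderiv ℝ (truncForm b s) u v| ≤ 4 * ‖b‖ * ‖u‖ * ‖v‖ * (1 + s * ‖u‖ ^ 2)⁻¹ := by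
  rw [fderiv_truncForm b hs]
  set q := (1 + s * ‖u‖ ^ 2)⁻¹ with hq
  have hq0 : 0 < q := inv_pos.mpr (truncForm_denom_pos hs u)
  have hqs : s * ‖u‖ ^ 2 * q ≤ 1 := by
    rw [hq, ← div_eq_mul_inv, div_le_one (truncForm_denom_pos hs u)]; linarith
  have h1 : |b u v| ≤ ‖b‖ * ‖u‖ * ‖v‖ := b.le_opNorm₂ u v
  have h2 : |b v u| ≤ ‖b‖ * ‖v‖ * ‖u‖ := b.le_opNorm₂ v u
  have h3 : |b u u| ≤ ‖b‖ * ‖u‖ * ‖u‖ := b.le_opNorm₂ u u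
  have h4 : |inner ℝ u v| ≤ ‖u‖ * ‖v‖ := abs_real_inner_le_norm u v
  have h5 : |b u u * (2 * s * inner ℝ u v) * q ^ 2| ≤ 2 * ‖b‖ * ‖u‖ * ‖v‖ * q := by
    rw [abs_mul, abs_mul, abs_mul, abs_of_nonneg (by positivity : (0:ℝ) ≤ 2 * s),
      abs_of_pos (by positivity : 0 < q ^ 2)]
    calc _ ≤ (‖b‖ * ‖u‖ * ‖u‖) * (2 * s * (‖u‖ * ‖v‖)) * q ^ 2 := by gcongr
      _ = 2 * ‖b‖ * ‖u‖ * ‖v‖ * q * (s * ‖u‖ ^ 2 * q) := by ring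
      _ ≤ 2 * ‖b‖ * ‖u‖ * ‖v‖ * q * 1 := by gcongr
      _ = _ := mul_one _
  have h6 : |(b u v + b v u) * q| ≤ 2 * ‖b‖ * ‖u‖ * ‖v‖ * q := by
    rw [abs_mul, abs_of_pos hq0]
    calc _ ≤ (‖b‖ * ‖u‖ * ‖v‖ + ‖b‖ * ‖v‖ * ‖u‖) * q := by
          gcongr; exact (abs_add_le _ _).trans (add_le_add h1 h2)
      _ = _ := by ring
  calc _ ≤ _ := abs_sub _ _
    _ ≤ _ := add_le_add h6 h5
    _ = _ := by ring

/-- Independent of s: this is the dominating function for removing the truncation. The bounds of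
`exists_bound_truncForm` blow up as s → 0 and serve only at fixed s. -/
theorem abs_fderiv_truncForm_le' (hs : 0 ≤ s) (u v : Spinor d) :
    |fderiv ℝ (truncForm b s) u v| ≤ 4 * ‖b‖ * (‖u‖ * ‖v‖) := by
  refine (abs_fderiv_truncForm_le b hs u v).trans ?_
  have h2 : (1 + s * ‖u‖ ^ 2)⁻¹ ≤ 1 :=
    inv_le_one_of_one_le₀ (by nlinarith [mul_nonneg hs (sq_nonneg ‖u‖)])
  calc _ ≤ 4 * ‖b‖ * ‖u‖ * ‖v‖ * 1 := by gcongr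
    _ = _ := by ring

theorem exists_bound_truncForm (hs : 0 < s) (hs1 : s ≤ 1) :
    ∃ C, (∀ u, |truncForm b s u| ≤ C) ∧ ∀ u, ‖fderiv ℝ (truncForm b s) u‖ ≤ C := by
  refine ⟨4 * ‖b‖ / s, fun u => ?_, fun u => ContinuousLinearMap.opNorm_le_bound _ (by positivity) fun v => ?_⟩
  · rw [truncForm, abs_mul, abs_of_pos (inv_pos.mpr (truncForm_denom_pos hs.le u)),
      ← div_eq_mul_inv, div_le_div_iff₀ (truncForm_denom_pos hs.le u) hs]
    have h3 : |b u u| ≤ ‖b‖ * ‖u‖ * ‖u‖ := b.le_opNorm₂ u u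
    nlinarith [norm_nonneg b, norm_nonneg u, mul_le_mul_of_nonneg_right h3 hs.le,
      mul_nonneg (norm_nonneg b) (mul_nonneg hs.le (sq_nonneg ‖u‖))]
  · refine (abs_fderiv_truncForm_le b hs.le u v).trans ?_
    have h : ‖u‖ * (1 + s * ‖u‖ ^ 2)⁻¹ ≤ 1 / s := by
      rw [← div_eq_mul_inv, div_le_div_iff₀ (truncForm_denom_pos hs.le u) hs]
      nlinarith [sq_nonneg (‖u‖ - 1), norm_nonneg u]
    calc _ = 4 * ‖b‖ * ‖v‖ * (‖u‖ * (1 + s * ‖u‖ ^ 2)⁻¹) := by ring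
      _ ≤ 4 * ‖b‖ * ‖v‖ * (1 / s) := by gcongr
      _ = _ := by ring

theorem tendsto_truncForm {σ : ℕ → ℝ} (hσ : Tendsto σ atTop (𝓝 0)) (u : Spinor d) :
    Tendsto (fun n => truncForm b (σ n) u) atTop (𝓝 (b u u)) := by
  have h : Tendsto (fun n => b u u * (1 + σ n * ‖u‖ ^ 2)⁻¹) atTop
      (𝓝 (b u u * (1 + 0 * ‖u‖ ^ 2)⁻¹)) :=
    (((hσ.mul_const _).const_add 1).inv₀ (by simp)).const_mul _
  simpa [truncForm] using h

theorem tendsto_fderiv_truncForm {σ : ℕ → ℝ} (hσ : Tendsto σ atTop (𝓝 0)) (hσ0 : ∀ n, 0 ≤ σ n)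
    (u v : Spinor d) :
    Tendsto (fun n => fderiv ℝ (truncForm b (σ n)) u v) atTop (𝓝 (b v u + b u v)) := by
  simp only [fun n => fderiv_truncForm b (hσ0 n) u v]
  have h1 : Tendsto (fun n => (1 + σ n * ‖u‖ ^ 2)⁻¹) atTop (𝓝 (1 + 0 * ‖u‖ ^ 2)⁻¹) :=
    ((hσ.mul_const _).const_add 1).inv₀ (by simp)
  have h := (h1.const_mul (b u v + b v u)).sub
    ((((hσ.const_mul 2).mul_const (inner ℝ u v)).const_mul (b u u)).mul (h1.pow 2))
  simpa [add_comm] using h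

end truncForm

/-- Apply the bounded case to `truncForm b s` and let s → 0. Since b(ψ,ψ) itself is unbounded,
domination comes from Aψ ∈ L² for the terms with A and from the integrability of gB|ψ|² for the term
with B. -/
theorem magneticField_form {A : Space d → Space d} {B : Space d → Matrix (Fin d) (Fin d) ℝ}
    (hA : MemL2Loc A) (hB : ∀ j k, MemL2Loc (fun x => B x j k)) (hAB : IsMagneticField A B)
    (b : Spinor d →L[ℝ] Spinor d →L[ℝ] ℝ) {g : Space d → ℝ} (hg : ContDiff ℝ ∞ g)
    (hc : HasCompactSupport g) (ψ : H1 d) (j k : Fin d)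
    (hAψ : ∀ i, MemLp (fun x => A x i • (ψ : SpinorL2 d) x) 2 volume)
    (hBψ : Integrable (fun x => g x * B x j k * ‖(ψ : SpinorL2 d) x‖ ^ 2) volume) :
    ∫ x, g x * B x j k * b ((ψ : SpinorL2 d) x) ((ψ : SpinorL2 d) x)
      = -(((∫ x, fderiv ℝ g x (basisVec j) * A x k * b ((ψ : SpinorL2 d) x) ((ψ : SpinorL2 d) x))
            + ∫ x, g x * A x k * (b (weakDeriv j ψ x) ((ψ : SpinorL2 d) x)
                + b ((ψ : SpinorL2 d) x) (weakDeriv j ψ x)))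
          - ((∫ x, fderiv ℝ g x (basisVec k) * A x j * b ((ψ : SpinorL2 d) x) ((ψ : SpinorL2 d) x))
            + ∫ x, g x * A x j * (b (weakDeriv k ψ x) ((ψ : SpinorL2 d) x)
                + b ((ψ : SpinorL2 d) x) (weakDeriv k ψ x)))) := by
  set σ : ℕ → ℝ := fun n => 1 / ((n : ℝ) + 1) with hσdef
  have hσ : Tendsto σ atTop (𝓝 0) := tendsto_one_div_add_atTop_nhds_zero_nat
  have hσ0 : ∀ n, 0 < σ n := fun n => by positivity
  have hσ1 : ∀ n, σ n ≤ 1 := fun n => by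
    rw [hσdef, div_le_one (by positivity)]; linarith [(Nat.cast_nonneg n : (0:ℝ) ≤ n)]
  have hψm := Lp.aestronglyMeasurable (ψ : SpinorL2 d)
  have hAi := fun i : Fin d => hA.apply i
  have lim0 : ∀ {w : Space d → ℝ}, AEStronglyMeasurable w volume →
      Integrable (fun x => w x * ‖(ψ : SpinorL2 d) x‖ ^ 2) volume →
      Tendsto (fun n => ∫ x, w x * truncForm b (σ n) ((ψ : SpinorL2 d) x)) atTop
        (𝓝 (∫ x, w x * b ((ψ : SpinorL2 d) x) ((ψ : SpinorL2 d) x))) := by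
    intro w hwm hw
    refine tendsto_integral_of_dominated_convergence
      (fun x => ‖b‖ * ‖w x * ‖(ψ : SpinorL2 d) x‖ ^ 2‖)
      (fun n => hwm.mul ((contDiff_truncForm b (hσ0 n).le).continuous.comp_aestronglyMeasurable hψm))
      (hw.norm.const_mul _) (fun n => Eventually.of_forall fun x => ?_)
      (Eventually.of_forall fun x => (tendsto_truncForm b hσ _).const_mul _)
    rw [norm_mul, norm_mul, Real.norm_eq_abs (truncForm _ _ _), Real.norm_eq_abs (_ ^ 2),
      abs_of_nonneg (sq_nonneg ‖(ψ : SpinorL2 d) x‖)]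
    calc _ ≤ ‖w x‖ * (‖b‖ * ‖(ψ : SpinorL2 d) x‖ ^ 2) := by
          gcongr; exact abs_truncForm_le b (hσ0 n).le _
      _ = _ := by ring
  have lim1 : ∀ {w : Space d → ℝ}, AEStronglyMeasurable w volume → ∀ i : Fin d,
      Integrable (fun x => w x * (‖(ψ : SpinorL2 d) x‖ * ‖weakDeriv i ψ x‖)) volume →
      Tendsto (fun n => ∫ x, w x * fderiv ℝ (truncForm b (σ n)) ((ψ : SpinorL2 d) x)
          (weakDeriv i ψ x)) atTop
        (𝓝 (∫ x, w x * (b (weakDeriv i ψ x) ((ψ : SpinorL2 d) x)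
          + b ((ψ : SpinorL2 d) x) (weakDeriv i ψ x)))) := by
    intro w hwm i hw
    refine tendsto_integral_of_dominated_convergence
      (fun x => 4 * ‖b‖ * ‖w x * (‖(ψ : SpinorL2 d) x‖ * ‖weakDeriv i ψ x‖)‖)
      (fun n => hwm.mul (isBoundedBilinearMap_apply.continuous.comp_aestronglyMeasurable
        ((((contDiff_truncForm b (hσ0 n).le).continuous_fderiv
          (by simp)).comp_aestronglyMeasurable hψm).prodMk (Lp.aestronglyMeasurable _))))
      (hw.norm.const_mul _) (fun n => Eventually.of_forall fun x => ?_)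
      (Eventually.of_forall fun x =>
        (tendsto_fderiv_truncForm b hσ (fun n => (hσ0 n).le) _ _).const_mul _)
    rw [norm_mul, norm_mul, Real.norm_eq_abs (fderiv _ _ _ _), Real.norm_eq_abs (_ * _),
      abs_of_nonneg (by positivity : 0 ≤ ‖(ψ : SpinorL2 d) x‖ * ‖weakDeriv i ψ x‖)]
    calc _ ≤ ‖w x‖ * (4 * ‖b‖ * (‖(ψ : SpinorL2 d) x‖ * ‖weakDeriv i ψ x‖)) := by
          gcongr; exact abs_fderiv_truncForm_le' b (hσ0 n).le _ _
      _ = _ := by ring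
  have hgc := fun i : Fin d => (contDiff_partial hg (basisVec i)).continuous
  have hgs := fun i : Fin d => hc.fderiv_apply ℝ (basisVec i)
  have hw : ∀ {w : Space d → ℝ}, Continuous w → HasCompactSupport w → ∀ i,
      ∀ f : SpinorL2 d, Integrable (fun x => w x * A x i * (‖(ψ : SpinorL2 d) x‖ * ‖f x‖)) volume := by
    intro w hw hwc i f
    have h1 : Integrable (fun x => ‖A x i • (ψ : SpinorL2 d) x‖ * ‖f x‖) volume :=
      (hAψ i).norm.integrable_mul (Lp.memLp f).norm
    have h2 := memLp_one_iff_integrable.mp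
      ((memLp_one_iff_integrable.mpr h1).mul (memLp_top_of_hasCompactSupport hw hwc))
    refine h2.mono ((hw.aestronglyMeasurable.mul (hAi i).aestronglyMeasurable).mul
      (hψm.norm.mul (Lp.aestronglyMeasurable f).norm)) (Eventually.of_forall fun x => ?_)
    simp [norm_smul, mul_assoc]
  have i0 : ∀ j k, Integrable (fun x => fderiv ℝ g x (basisVec j) * A x k
      * ‖(ψ : SpinorL2 d) x‖ ^ 2) volume := fun j k => by
    simpa only [sq] using hw (hgc j) (hgs j) k (ψ : SpinorL2 d)
  have i1 : ∀ j k, Integrable (fun x => g x * A x k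
      * (‖(ψ : SpinorL2 d) x‖ * ‖weakDeriv j ψ x‖)) volume := fun j k =>
    hw hg.continuous hc k (weakDeriv j ψ)
  have m0 := fun j k => (hgc j).aestronglyMeasurable.mul (hAi k).aestronglyMeasurable
    (μ := (volume : Measure (Space d)))
  have m1 := fun k => hg.continuous.aestronglyMeasurable.mul (hAi k).aestronglyMeasurable
    (μ := (volume : Measure (Space d)))
  have L := lim0 (hg.continuous.aestronglyMeasurable.mul (hB j k).aestronglyMeasurable) hBψ
  have R := (((lim0 (m0 j k) (i0 j k)).add (lim1 (m1 k) j (i1 j k))).sub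
    ((lim0 (m0 k j) (i0 k j)).add (lim1 (m1 j) k (i1 k j)))).neg
  refine tendsto_nhds_unique L (R.congr fun n => ?_)
  obtain ⟨C, hC, hC'⟩ := exists_bound_truncForm b (hσ0 n) (hσ1 n)
  exact (magneticField_nonlinear hA hB hAB (contDiff_truncForm b (hσ0 n).le) hC hC' hg hc
    ψ j k).symm

/-! ### Real parts of Hermitian forms and magnetic integration by parts -/

theorem real_inner_eq_re (u w : Spinor d) : inner ℝ u w = (inner ℂ u w).re := by
  simp [PiLp.inner_apply, Complex.inner]

theorem real_inner_I_smul_I_smul (u w : Spinor d) :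
    inner ℝ (Complex.I • u) (Complex.I • w) = inner ℝ u w := by
  rw [real_inner_eq_re, real_inner_eq_re, inner_smul_left, inner_smul_right, ← mul_assoc]
  simp

theorem real_inner_I_smul_left (u w : Spinor d) :
    inner ℝ (Complex.I • u) w = -inner ℝ u (Complex.I • w) := by
  rw [← real_inner_I_smul_I_smul u, smul_smul, Complex.I_mul_I, neg_one_smul, inner_neg_right,
    neg_neg]

theorem real_smul_eq (r : ℝ) (u : Spinor d) : ((r : ℂ) • u) = r • u := by
  ext i; simp

theorem real_inner_act_left {Γ : SpinorMatrix d} (h : Γ.IsHermitian) (u w : Spinor d) :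
    inner ℝ (act Γ u) w = inner ℝ u (act Γ w) := by
  rw [real_inner_eq_re, real_inner_eq_re]
  congr 1
  have h1 : ContinuousLinearMap.adjoint (act Γ) = act Γ := by
    have := map_star (Matrix.toEuclideanCLM (n := Fin (spinorDim d)) (𝕜 := ℂ)) Γ
    rw [Matrix.star_eq_conjTranspose, h.eq] at this
    exact this.symm
  conv_lhs => rw [← h1]
  exact ContinuousLinearMap.adjoint_inner_left _ _ _

/-- ⟨u,Γu⟩ is real, so ⟨u,iΓu⟩ is purely imaginary. This is why the vector potential disappears from
first order identities. -/
theorem real_inner_act_I_self {Γ : SpinorMatrix d} (h : Γ.IsHermitian) (u : Spinor d) :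
    inner ℝ u (act Γ (Complex.I • u)) = 0 := by
  have h1 : inner ℝ u (act Γ (Complex.I • u)) = -inner ℝ u (act Γ (Complex.I • u)) := by
    conv_lhs => rw [map_smul, ← neg_neg (inner ℝ u _), ← real_inner_I_smul_left,
      ← real_inner_act_left h, real_inner_comm]
  linarith

theorem clm_real_smul (L : Spinor d →L[ℂ] Spinor d) (r : ℝ) (u : Spinor d) :
    L (r • u) = r • L u := by
  rw [← real_smul_eq, map_smul, real_smul_eq]

theorem real_inner_I_act_antisymm {Γ : SpinorMatrix d} (hΓ : Γ.IsHermitian) (u w : Spinor d) :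
    inner ℝ u (Complex.I • act Γ w) = -inner ℝ w (Complex.I • act Γ u) := by
  rw [← neg_neg (inner ℝ u _), ← real_inner_I_smul_left, ← real_inner_act_left hΓ, map_smul,
    real_inner_comm]

theorem real_inner_I_act_I (Γ : SpinorMatrix d) (u w : Spinor d) :
    inner ℝ u (Complex.I • act Γ (Complex.I • w)) = -inner ℝ u (act Γ w) := by
  rw [map_smul, smul_smul, Complex.I_mul_I, neg_one_smul, inner_neg_right]

theorem real_inner_act_comm {Γ : SpinorMatrix d} (hΓ : Γ.IsHermitian) (u w : Spinor d) :
    inner ℝ u (act Γ w) = inner ℝ w (act Γ u) := by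
  rw [← real_inner_act_left hΓ, real_inner_comm]

/-- The term quadratic in the potential is ab Re⟨iu,Γu⟩ up to sign and vanishes; only terms linear
in the potential remain. -/
theorem real_inner_I_act_sub {Γ : SpinorMatrix d} (hΓ : Γ.IsHermitian) (p q u : Spinor d)
    (a b : ℝ) :
    inner ℝ (p - a • (Complex.I • u)) (Complex.I • act Γ (q - b • (Complex.I • u)))
      = inner ℝ p (Complex.I • act Γ q) + b * inner ℝ u (act Γ p) - a * inner ℝ u (act Γ q) := by
  have h1 : inner ℝ (Complex.I • u) (Complex.I • act Γ q) = inner ℝ u (act Γ q) :=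
    real_inner_I_smul_I_smul _ _
  have h2 : inner ℝ (Complex.I • u) (act Γ u) = 0 := by
    rw [real_inner_act_comm hΓ, real_inner_act_I_self hΓ]
  simp only [map_sub, smul_sub, inner_sub_left, inner_sub_right, clm_real_smul,
    smul_comm Complex.I b, real_inner_smul_left, real_inner_smul_right,
    real_inner_I_act_I, h1, h2, real_inner_act_comm hΓ p u]
  ring

theorem real_inner_I_act_sub_right {Γ : SpinorMatrix d} (q u : Spinor d) (b : ℝ) :
    inner ℝ u (Complex.I • act Γ (q - b • (Complex.I • u)))
      = inner ℝ u (Complex.I • act Γ q) + b * inner ℝ u (act Γ u) := by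
  simp only [map_sub, smul_sub, inner_sub_right, clm_real_smul, smul_comm Complex.I b,
    real_inner_smul_right, real_inner_I_act_I]
  ring

/-- The real bilinear form `(u, w) ↦ Re ⟨u, L w⟩`. -/
def reForm (L : Spinor d →L[ℂ] Spinor d) : Spinor d →L[ℝ] Spinor d →L[ℝ] ℝ :=
  ((innerSL ℝ : Spinor d →L[ℝ] Spinor d →L[ℝ] ℝ).flip.comp (L.restrictScalars ℝ)).flip

@[simp]
theorem reForm_apply (L : Spinor d →L[ℂ] Spinor d) (u w : Spinor d) :
    reForm L u w = inner ℝ u (L w) := rfl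

theorem integrable_inner_act {f h : Space d → Spinor d} (hf : MemLp f 2 volume)
    (hh : MemLp h 2 volume) (L : Spinor d →L[ℂ] Spinor d) {w : Space d → ℝ}
    (hw : MemLp w ∞ volume) :
    Integrable (fun x => w x * inner ℝ (f x) (L (h x))) volume := by
  refine (integrable_mul_bilin (reForm L) hw (hf.toLp f) (hh.toLp h)).congr ?_
  filter_upwards [hf.coeFn_toLp, hh.coeFn_toLp] with x h1 h2
  rw [h1, h2, reForm_apply]

theorem magneticDeriv_eq (A : Space d → Space d) (j : Fin d) (ψ : H1 d) (x : Space d) :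
    magneticDeriv A j ψ x = weakDeriv j ψ x - A x j • (Complex.I • (ψ : SpinorL2 d) x) := by
  rw [magneticDeriv, mul_comm, mul_smul, real_smul_eq]

theorem memLp_magneticDeriv {A : Space d → Space d} {j : Fin d} {ψ : H1 d}
    (hAψ : MemLp (fun x => A x j • (ψ : SpinorL2 d) x) 2 volume) :
    MemLp (magneticDeriv A j ψ) 2 volume := by
  have h := (Lp.memLp (weakDeriv j ψ)).sub (hAψ.const_smul Complex.I)
  refine h.ae_eq (Eventually.of_forall fun x => ?_)
  rw [magneticDeriv_eq]
  rw [Pi.sub_apply, Pi.smul_apply, smul_comm]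

/-- The potential contributes Re⟨ψ,Γ(iψ)⟩ = 0, so this is the nonmagnetic integration by parts. -/
theorem integral_mul_inner_magneticDeriv (A : Space d → Space d) {Γ : SpinorMatrix d}
    (hΓ : Γ.IsHermitian) {g : Space d → ℝ} (hg : ContDiff ℝ ∞ g) (hc : HasCompactSupport g)
    (ψ : H1 d) (j : Fin d) :
    ∫ x, g x * (2 * inner ℝ ((ψ : SpinorL2 d) x) (act Γ (magneticDeriv A j ψ x)))
      = -∫ x, fderiv ℝ g x (basisVec j)
          * inner ℝ ((ψ : SpinorL2 d) x) (act Γ ((ψ : SpinorL2 d) x)) := by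
  refine Eq.trans ?_ (integral_mul_weakDeriv (reForm (act Γ)) hg hc ψ j)
  refine integral_congr_ae (Eventually.of_forall fun x => ?_)
  simp only [reForm_apply, magneticDeriv_eq, map_sub, inner_sub_right, clm_real_smul,
    real_inner_smul_right, real_inner_act_I_self hΓ,
    real_inner_act_comm hΓ (weakDeriv j ψ x) ((ψ : SpinorL2 d) x)]
  ring

/-- Integrated form of the commutator of two magnetic derivatives. After expansion the terms free of
A are the antisymmetric identity for weak derivatives, and the terms linear in A assemble to B_{jk}
through `magneticField_form`. -/
theorem integral_mul_inner_magneticDeriv_antisymm {A : Space d → Space d}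
    {B : Space d → Matrix (Fin d) (Fin d) ℝ}
    (hA : MemL2Loc A) (hB : ∀ j k, MemL2Loc (fun x => B x j k)) (hAB : IsMagneticField A B)
    {Γ : SpinorMatrix d} (hΓ : Γ.IsHermitian) {g : Space d → ℝ} (hg : ContDiff ℝ ∞ g)
    (hc : HasCompactSupport g) (ψ : H1 d) (j k : Fin d)
    (hAψ : ∀ i, MemLp (fun x => A x i • (ψ : SpinorL2 d) x) 2 volume)
    (hBψ : Integrable (fun x => g x * B x j k * ‖(ψ : SpinorL2 d) x‖ ^ 2) volume) :
    ∫ x, g x * (2 * inner ℝ (magneticDeriv A j ψ x) (Complex.I • act Γ (magneticDeriv A k ψ x)))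
      = -(∫ x, fderiv ℝ g x (basisVec j)
            * inner ℝ ((ψ : SpinorL2 d) x) (Complex.I • act Γ (magneticDeriv A k ψ x)))
        + (∫ x, fderiv ℝ g x (basisVec k)
            * inner ℝ ((ψ : SpinorL2 d) x) (Complex.I • act Γ (magneticDeriv A j ψ x)))
        - ∫ x, g x * B x j k * inner ℝ ((ψ : SpinorL2 d) x) (act Γ ((ψ : SpinorL2 d) x)) := by
  have h1 := integral_mul_weakDeriv_antisymm (reForm (Complex.I • act Γ)) hg hc ψ j k
  have h2 := magneticField_form hA hB hAB (reForm (act Γ)) hg hc ψ j k hAψ hBψ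
  have hgb := memLp_top_of_hasCompactSupport hg.continuous hc
  have hgp := fun j : Fin d => memLp_top_partial hg hc (basisVec j)
  have hψ := Lp.memLp (ψ : SpinorL2 d)
  have hdψ := fun j : Fin d => Lp.memLp (weakDeriv j ψ)
  have hgA : ∀ {w : Space d → ℝ}, MemLp w ∞ volume → ∀ (k : Fin d) (f : SpinorL2 d),
      Integrable (fun x => w x * A x k * inner ℝ ((ψ : SpinorL2 d) x) (act Γ (f x))) volume := by
    intro w hw k f
    refine (integrable_inner_act (hAψ k) (Lp.memLp f) (act Γ) hw).congr
      (Eventually.of_forall fun x => ?_)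
    simp only [real_inner_smul_left]
    ring
  have hI : ∀ {w : Space d → ℝ}, MemLp w ∞ volume → ∀ f h : SpinorL2 d,
      Integrable (fun x => w x * inner ℝ (f x) (Complex.I • act Γ (h x))) volume := fun hw f h =>
    integrable_inner_act (Lp.memLp f) (Lp.memLp h) (Complex.I • act Γ) hw
  have e1 : ∀ x, g x * (2 * inner ℝ (magneticDeriv A j ψ x)
        (Complex.I • act Γ (magneticDeriv A k ψ x)))
      = 2 * (g x * inner ℝ (weakDeriv j ψ x) (Complex.I • act Γ (weakDeriv k ψ x)))
        + (2 * (g x * A x k * inner ℝ ((ψ : SpinorL2 d) x) (act Γ (weakDeriv j ψ x)))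
          - 2 * (g x * A x j * inner ℝ ((ψ : SpinorL2 d) x) (act Γ (weakDeriv k ψ x)))) := by
    intro x
    rw [magneticDeriv_eq, magneticDeriv_eq, real_inner_I_act_sub hΓ]
    ring
  have e2 : ∀ j k x, fderiv ℝ g x (basisVec j)
        * inner ℝ ((ψ : SpinorL2 d) x) (Complex.I • act Γ (magneticDeriv A k ψ x))
      = fderiv ℝ g x (basisVec j) * inner ℝ ((ψ : SpinorL2 d) x) (Complex.I • act Γ (weakDeriv k ψ x))
        + fderiv ℝ g x (basisVec j) * A x k
          * inner ℝ ((ψ : SpinorL2 d) x) (act Γ ((ψ : SpinorL2 d) x)) := by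
    intro j k x
    rw [magneticDeriv_eq, real_inner_I_act_sub_right]
    ring
  have i1 := ((hgA hgb k (weakDeriv j ψ)).const_mul 2).sub ((hgA hgb j (weakDeriv k ψ)).const_mul 2)
  simp only [Pi.sub_def] at i1
  simp only [e1, e2]
  rw [integral_add ((hI hgb _ _).const_mul 2) i1, integral_sub ((hgA hgb _ _).const_mul 2)
    ((hgA hgb _ _).const_mul 2), integral_add (hI (hgp j) _ _) (hgA (hgp j) _ _),
    integral_add (hI (hgp k) _ _) (hgA (hgp k) _ _)]
  have h1' : ∀ x, g x * (inner ℝ (weakDeriv j ψ x) (Complex.I • act Γ (weakDeriv k ψ x))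
      - inner ℝ (weakDeriv k ψ x) (Complex.I • act Γ (weakDeriv j ψ x)))
      = 2 * (g x * inner ℝ (weakDeriv j ψ x) (Complex.I • act Γ (weakDeriv k ψ x))) := by
    intro x
    rw [real_inner_I_act_antisymm hΓ (weakDeriv k ψ x)]
    ring
  have h2' : ∀ (j k : Fin d) (x : Space d), g x * A x k * (inner ℝ (weakDeriv j ψ x) (act Γ ((ψ : SpinorL2 d) x))
      + inner ℝ ((ψ : SpinorL2 d) x) (act Γ (weakDeriv j ψ x)))
      = 2 * (g x * A x k * inner ℝ ((ψ : SpinorL2 d) x) (act Γ (weakDeriv j ψ x))) := by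
    intro j k x
    rw [real_inner_act_comm hΓ (weakDeriv j ψ x)]
    ring
  simp only [reForm_apply, smul_apply, h1', h2', integral_const_mul] at h1 h2 ⊢
  linarith

/-! ### Cutoffs and weights that are singular at the origin -/

/-- A smooth bump function on `ℝ^d`: `1` on the unit ball, `0` outside the ball of radius `2`. -/
def unitBump (d : ℕ) : ContDiffBump (0 : Space d) := ⟨1, 2, one_pos, one_lt_two⟩

/-- The bump function `x ↦ φ (c x)`. -/
def scaledBump (d : ℕ) (c : ℝ) (x : Space d) : ℝ := unitBump d (c • x)

theorem contDiff_scaledBump (c : ℝ) : ContDiff ℝ ∞ (scaledBump d c) :=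
  (unitBump d).contDiff.comp (contDiff_const_smul c)

theorem scaledBump_nonneg (c : ℝ) (x : Space d) : 0 ≤ scaledBump d c x := (unitBump d).nonneg

theorem scaledBump_le_one (c : ℝ) (x : Space d) : scaledBump d c x ≤ 1 := (unitBump d).le_one

theorem scaledBump_eq_one {c : ℝ} (hc : 0 ≤ c) {x : Space d} (h : c * ‖x‖ ≤ 1) :
    scaledBump d c x = 1 := by
  refine (unitBump d).one_of_mem_closedBall ?_
  rw [mem_closedBall_zero_iff, norm_smul, Real.norm_of_nonneg hc]
  exact h

theorem scaledBump_eq_zero {c : ℝ} (hc : 0 ≤ c) {x : Space d} (h : 2 ≤ c * ‖x‖) :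
    scaledBump d c x = 0 := by
  refine (unitBump d).zero_of_le_dist ?_
  rw [dist_zero_right, norm_smul, Real.norm_of_nonneg hc]
  exact h

theorem hasCompactSupport_scaledBump {c : ℝ} (hc : 0 < c) :
    HasCompactSupport (scaledBump d c) :=
  (unitBump d).hasCompactSupport.comp_smul hc.ne'

/-- The quantity |x||∇φ(cx)| is scale invariant; the gradient is supported in c|x| ≤ 2, which gives
twice the supremum of |∇φ|. -/
theorem exists_bound_fderiv_scaledBump (d : ℕ) :
    ∃ C, 0 ≤ C ∧ ∀ c : ℝ, 0 ≤ c → ∀ x : Space d, ‖x‖ * ‖fderiv ℝ (scaledBump d c) x‖ ≤ C := by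
  have hs : ContDiff ℝ ∞ (unitBump d : Space d → ℝ) := (unitBump d).contDiff
  obtain ⟨C, hC⟩ := ((unitBump d).hasCompactSupport.fderiv ℝ).exists_bound_of_continuous
    (hs.continuous_fderiv (by simp))
  have hC0 : 0 ≤ C := (norm_nonneg _).trans (hC 0)
  refine ⟨2 * C, by positivity, fun c hc x => ?_⟩
  have h1 : fderiv ℝ (scaledBump d c) x = c • fderiv ℝ (unitBump d) (c • x) :=
    fderiv_comp_smul ..
  rw [h1, norm_smul, Real.norm_of_nonneg hc]
  by_cases h : 2 < c * ‖x‖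
  · have hx : c • x ∉ tsupport (unitBump d : Space d → ℝ) := by
      rw [(unitBump d).tsupport_eq, mem_closedBall_zero_iff, norm_smul, Real.norm_of_nonneg hc]
      exact not_le.mpr h
    have h0 : fderiv ℝ (unitBump d) (c • x) = 0 := by
      by_contra h0
      exact hx (support_fderiv_subset ℝ h0)
    rw [h0]; simp; positivity
  · calc ‖x‖ * (c * ‖fderiv ℝ (unitBump d) (c • x)‖)
        = (c * ‖x‖) * ‖fderiv ℝ (unitBump d) (c • x)‖ := by ring
      _ ≤ 2 * C := by gcongr; exacts [not_lt.mp h, hC _]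

theorem fderiv_scaledBump_eq_zero {c : ℝ} (hc : 0 ≤ c) {x : Space d} (h : c * ‖x‖ < 1) :
    fderiv ℝ (scaledBump d c) x = 0 := by
  have : scaledBump d c =ᶠ[𝓝 x] fun _ => 1 := by
    have : ∀ᶠ y in 𝓝 x, c * ‖y‖ < 1 :=
      (continuous_const.mul continuous_norm).continuousAt.eventually_lt continuousAt_const h
    filter_upwards [this] with y hy using scaledBump_eq_one hc hy.le
  rw [this.fderiv_eq]; simp

/-- A smooth cutoff with compact support away from the origin. -/
def cutoff (d n : ℕ) (x : Space d) : ℝ :=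
  scaledBump d ((n : ℝ) + 1)⁻¹ x - scaledBump d ((n : ℝ) + 1) x

theorem contDiff_cutoff (n : ℕ) : ContDiff ℝ ∞ (cutoff d n) :=
  (contDiff_scaledBump _).sub (contDiff_scaledBump _)

theorem hasCompactSupport_cutoff (n : ℕ) : HasCompactSupport (cutoff d n) :=
  (hasCompactSupport_scaledBump (by positivity)).sub (hasCompactSupport_scaledBump (by positivity))

theorem abs_cutoff_le_one (n : ℕ) (x : Space d) : |cutoff d n x| ≤ 1 := by
  rw [cutoff, abs_le]
  constructor <;> linarith [scaledBump_nonneg ((n : ℝ) + 1) x, scaledBump_le_one ((n : ℝ) + 1) x,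
    scaledBump_nonneg ((n : ℝ) + 1)⁻¹ x, scaledBump_le_one ((n : ℝ) + 1)⁻¹ x]

theorem cutoff_eventually_eq_zero (n : ℕ) : cutoff d n =ᶠ[𝓝 0] fun _ => 0 := by
  have h : ∀ᶠ y : Space d in 𝓝 0, ((n : ℝ) + 1) * ‖y‖ < 1 :=
    (continuous_const.mul continuous_norm).continuousAt.eventually_lt continuousAt_const (by simp)
  filter_upwards [h] with y hy
  have h1 : ((n : ℝ) + 1)⁻¹ * ‖y‖ ≤ ((n : ℝ) + 1) * ‖y‖ := by
    gcongr
    have : (1 : ℝ) ≤ (n : ℝ) + 1 := by linarith [(Nat.cast_nonneg n : (0:ℝ) ≤ n)]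
    exact (inv_le_one_of_one_le₀ this).trans this
  rw [cutoff, scaledBump_eq_one (by positivity) (h1.trans hy.le),
    scaledBump_eq_one (by positivity) hy.le, sub_self]

theorem cutoff_eventually_eq_one {x : Space d} (hx : x ≠ 0) :
    ∀ᶠ n in atTop, cutoff d n =ᶠ[𝓝 x] fun _ => 1 := by
  have hx0 : 0 < ‖x‖ := norm_pos_iff.mpr hx
  have ht : Tendsto (fun n : ℕ => (n : ℝ) + 1) atTop atTop :=
    tendsto_atTop_add_const_right _ _ tendsto_natCast_atTop_atTop
  filter_upwards [ht.eventually_gt_atTop ‖x‖, ht.eventually_gt_atTop (2 / ‖x‖)] with n h1 h2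
  rw [div_lt_iff₀ hx0] at h2
  have e1 : ∀ᶠ y : Space d in 𝓝 x, ‖y‖ < (n : ℝ) + 1 :=
    continuous_norm.continuousAt.eventually_lt continuousAt_const h1
  have e2 : ∀ᶠ y : Space d in 𝓝 x, 2 < ((n : ℝ) + 1) * ‖y‖ :=
    continuousAt_const.eventually_lt (continuous_const.mul continuous_norm).continuousAt h2
  filter_upwards [e1, e2] with y h3 h4
  rw [cutoff, scaledBump_eq_zero (by positivity) h4.le, scaledBump_eq_one (by positivity), sub_zero]
  rw [inv_mul_le_iff₀ (by positivity)]; linarith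

theorem exists_bound_fderiv_cutoff (d : ℕ) :
    ∃ C, 0 ≤ C ∧ ∀ n, ∀ x : Space d, ‖x‖ * ‖fderiv ℝ (cutoff d n) x‖ ≤ C := by
  obtain ⟨C, hC0, hC⟩ := exists_bound_fderiv_scaledBump d
  refine ⟨C + C, by positivity, fun n x => ?_⟩
  have hd : ∀ c, DifferentiableAt ℝ (scaledBump d c) x := fun c =>
    (contDiff_scaledBump c).differentiable (by simp) x
  have e : fderiv ℝ (cutoff d n) x = fderiv ℝ (scaledBump d ((n : ℝ) + 1)⁻¹) x
      - fderiv ℝ (scaledBump d ((n : ℝ) + 1)) x := fderiv_sub (hd _) (hd _)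
  rw [e]
  calc _ ≤ ‖x‖ * (‖fderiv ℝ (scaledBump d ((n : ℝ) + 1)⁻¹) x‖
        + ‖fderiv ℝ (scaledBump d ((n : ℝ) + 1)) x‖) := by gcongr; exact norm_sub_le _ _
    _ ≤ C + C := by
      rw [mul_add]; exact add_le_add (hC _ (by positivity) x) (hC _ (by positivity) x)

theorem tendsto_cutoff {x : Space d} (hx : x ≠ 0) :
    Tendsto (fun n => cutoff d n x) atTop (𝓝 1) :=
  tendsto_const_nhds.congr' ((cutoff_eventually_eq_one hx).mono fun _ h => h.eq_of_nhds.symm)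

theorem tendsto_fderiv_cutoff {x : Space d} (hx : x ≠ 0) (v : Space d) :
    Tendsto (fun n => fderiv ℝ (cutoff d n) x v) atTop (𝓝 0) :=
  tendsto_const_nhds.congr' ((cutoff_eventually_eq_one hx).mono fun n h => by
    change 0 = fderiv ℝ (cutoff d n) x v
    rw [h.fderiv_eq]; simp)

theorem contDiff_cutoff_mul {w : Space d → ℝ} (hw : ContDiffOn ℝ ∞ w {0}ᶜ) (n : ℕ) :
    ContDiff ℝ ∞ fun x => cutoff d n x * w x := by
  rw [contDiff_iff_contDiffAt]
  intro x
  by_cases hx : x = 0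
  · subst hx
    refine (contDiffAt_const (c := (0 : ℝ))).congr_of_eventuallyEq ?_
    filter_upwards [cutoff_eventually_eq_zero (d := d) n] with y hy
    rw [hy, zero_mul]
  · exact (contDiff_cutoff n).contDiffAt.mul
      (hw.contDiffAt (isOpen_compl_singleton.mem_nhds hx))

theorem hasCompactSupport_cutoff_mul (w : Space d → ℝ) (n : ℕ) :
    HasCompactSupport fun x => cutoff d n x * w x :=
  (hasCompactSupport_cutoff n).mul_right

theorem fderiv_cutoff_mul {w : Space d → ℝ} (hw : ContDiffOn ℝ ∞ w {0}ᶜ) (n : ℕ) {x : Space d}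
    (hx : x ≠ 0) (v : Space d) :
    fderiv ℝ (fun x => cutoff d n x * w x) x v
      = fderiv ℝ (cutoff d n) x v * w x + cutoff d n x * fderiv ℝ w x v := by
  have h1 := (contDiff_cutoff (d := d) n).differentiable (by simp) x
  have h2 := (hw.contDiffAt (isOpen_compl_singleton.mem_nhds hx)).differentiableAt (by simp)
  have h := (h1.hasFDerivAt.mul h2.hasFDerivAt).fderiv
  simp only [Pi.mul_def] at h
  rw [h]
  simp; ring

theorem ae_ne_zero (hd : 0 < d) : ∀ᵐ x : Space d, x ≠ 0 := by
  have : Nonempty (Fin d) := ⟨⟨0, hd⟩⟩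
  have : Nontrivial (Space d) := inferInstance
  exact Measure.ae_ne volume 0

theorem tendsto_integral_cutoff_mul (hd : 0 < d) {F : Space d → ℝ} (hF : Integrable F volume) :
    Tendsto (fun n => ∫ x, cutoff d n x * F x) atTop (𝓝 (∫ x, F x)) := by
  refine tendsto_integral_of_dominated_convergence (fun x => ‖F x‖)
    (fun n => (contDiff_cutoff n).continuous.aestronglyMeasurable.mul hF.1) hF.norm
    (fun n => Eventually.of_forall fun x => ?_) ?_
  · rw [norm_mul]
    exact mul_le_of_le_one_left (norm_nonneg _) (abs_cutoff_le_one n x)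
  · filter_upwards [ae_ne_zero hd] with x hx
    simpa using (tendsto_cutoff hx).mul_const (F x)

theorem abs_fderiv_basisVec_le (g : Space d → ℝ) (x : Space d) (j : Fin d) :
    |fderiv ℝ g x (basisVec j)| ≤ ‖fderiv ℝ g x‖ := by
  have := (fderiv ℝ g x).le_opNorm (basisVec j)
  simpa using this

theorem exists_bound_fderiv_cutoff_mul (d : ℕ) : ∃ C, 0 ≤ C ∧ ∀ (n : ℕ) (j : Fin d)
    (F : Space d → ℝ) (x : Space d), x ≠ 0 →
    ‖fderiv ℝ (cutoff d n) x (basisVec j) * F x‖ ≤ C * ‖‖x‖⁻¹ * F x‖ := by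
  obtain ⟨C, hC0, hC⟩ := exists_bound_fderiv_cutoff d
  refine ⟨C, hC0, fun n j F x hx => ?_⟩
  have hx0 := norm_pos_iff.mpr hx
  rw [norm_mul, norm_mul, norm_inv, norm_norm, ← mul_assoc]
  gcongr
  rw [← div_eq_mul_inv, le_div_iff₀ hx0, mul_comm]
  exact (mul_le_mul_of_nonneg_left (abs_fderiv_basisVec_le _ x j) hx0.le).trans (hC n x)

theorem aestronglyMeasurable_of_inv_norm_mul (hd : 0 < d) {F : Space d → ℝ}
    (hF : AEStronglyMeasurable (fun x => ‖x‖⁻¹ * F x) volume) :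
    AEStronglyMeasurable F volume := by
  refine (continuous_norm.aestronglyMeasurable.mul hF).congr ?_
  filter_upwards [ae_ne_zero hd] with x hx
  simp [mul_inv_cancel_left₀ (norm_ne_zero_iff.mpr hx)]

theorem integrable_fderiv_cutoff_mul (hd : 0 < d) {F : Space d → ℝ}
    (hF : Integrable (fun x => ‖x‖⁻¹ * F x) volume) (n : ℕ) (j : Fin d) :
    Integrable (fun x => fderiv ℝ (cutoff d n) x (basisVec j) * F x) volume := by
  obtain ⟨C, hC0, hC⟩ := exists_bound_fderiv_cutoff_mul d
  refine (hF.norm.const_mul C).mono' ((contDiff_partial (contDiff_cutoff n)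
    _).continuous.aestronglyMeasurable.mul (aestronglyMeasurable_of_inv_norm_mul hd hF.1)) ?_
  filter_upwards [ae_ne_zero hd] with x hx using hC n j F x hx

theorem integrable_cutoff_mul {F : Space d → ℝ} (hF : Integrable F volume) (n : ℕ) :
    Integrable (fun x => cutoff d n x * F x) volume :=
  hF.bdd_mul (c := 1) (contDiff_cutoff n).continuous.aestronglyMeasurable
    (Eventually.of_forall fun x => abs_cutoff_le_one n x)

/-- The gradients of the cutoffs are O(|x|⁻¹) uniformly in n and tend to 0 pointwise off the origin,
so integrability of |x|⁻¹F suffices for dominated convergence. For F quadratic in ψ this is where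
Hardy's inequality enters. -/
theorem tendsto_integral_fderiv_cutoff_mul (hd : 0 < d) {F : Space d → ℝ}
    (hF : Integrable (fun x => ‖x‖⁻¹ * F x) volume) (j : Fin d) :
    Tendsto (fun n => ∫ x, fderiv ℝ (cutoff d n) x (basisVec j) * F x) atTop (𝓝 0) := by
  obtain ⟨C, hC0, hC⟩ := exists_bound_fderiv_cutoff_mul d
  rw [← integral_zero (Space d) ℝ (μ := volume)]
  refine tendsto_integral_of_dominated_convergence (fun x => C * ‖‖x‖⁻¹ * F x‖)
    (fun n => (integrable_fderiv_cutoff_mul hd hF n j).1) (hF.norm.const_mul C) (fun n => ?_) ?_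
  · filter_upwards [ae_ne_zero hd] with x hx using hC n j F x hx
  · filter_upwards [ae_ne_zero hd] with x hx
    simpa using (tendsto_fderiv_cutoff hx (basisVec j)).mul_const (F x)

/-- Use the weight times a cutoff and remove the cutoff. The hypothesis `h3` makes the contributions
at the origin and at infinity vanish in the limit. -/
theorem integral_mul_inner_magneticDeriv_of_contDiffOn (hd : 0 < d) (A : Space d → Space d)
    {Γ : SpinorMatrix d} (hΓ : Γ.IsHermitian) {w : Space d → ℝ} (hw : ContDiffOn ℝ ∞ w {0}ᶜ)
    (ψ : H1 d) (j : Fin d)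
    (h1 : Integrable (fun x => w x * inner ℝ ((ψ : SpinorL2 d) x) (act Γ (magneticDeriv A j ψ x)))
      volume)
    (h2 : Integrable (fun x => fderiv ℝ w x (basisVec j)
      * inner ℝ ((ψ : SpinorL2 d) x) (act Γ ((ψ : SpinorL2 d) x))) volume)
    (h3 : Integrable (fun x => ‖x‖⁻¹ * (w x
      * inner ℝ ((ψ : SpinorL2 d) x) (act Γ ((ψ : SpinorL2 d) x)))) volume) :
    ∫ x, w x * (2 * inner ℝ ((ψ : SpinorL2 d) x) (act Γ (magneticDeriv A j ψ x)))
      = -∫ x, fderiv ℝ w x (basisVec j)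
          * inner ℝ ((ψ : SpinorL2 d) x) (act Γ ((ψ : SpinorL2 d) x)) := by
  have e1 : ∀ x, w x * (2 * inner ℝ ((ψ : SpinorL2 d) x) (act Γ (magneticDeriv A j ψ x)))
      = 2 * (w x * inner ℝ ((ψ : SpinorL2 d) x) (act Γ (magneticDeriv A j ψ x))) := fun x => by ring
  have hn : ∀ n, (∫ x, cutoff d n x * (2 * (w x * inner ℝ ((ψ : SpinorL2 d) x)
        (act Γ (magneticDeriv A j ψ x)))))
      = -((∫ x, fderiv ℝ (cutoff d n) x (basisVec j) * (w x
          * inner ℝ ((ψ : SpinorL2 d) x) (act Γ ((ψ : SpinorL2 d) x))))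
        + ∫ x, cutoff d n x * (fderiv ℝ w x (basisVec j)
          * inner ℝ ((ψ : SpinorL2 d) x) (act Γ ((ψ : SpinorL2 d) x)))) := by
    intro n
    have h := integral_mul_inner_magneticDeriv A hΓ (contDiff_cutoff_mul hw n)
      (hasCompactSupport_cutoff_mul w n) ψ j
    refine Eq.trans (integral_congr_ae (Eventually.of_forall fun x => ?_)) (h.trans ?_)
    · simp only; ring
    congr 1
    rw [← integral_add]
    · refine integral_congr_ae ?_
      filter_upwards [ae_ne_zero hd] with x hx
      rw [fderiv_cutoff_mul hw n hx]
      ring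
    · exact integrable_fderiv_cutoff_mul hd h3 n j
    · exact integrable_cutoff_mul h2 n
  have L := tendsto_integral_cutoff_mul hd (h1.const_mul 2)
  have R := ((tendsto_integral_fderiv_cutoff_mul hd h3 j).add
    (tendsto_integral_cutoff_mul hd h2)).neg
  rw [zero_add] at R
  simp only [e1]
  exact tendsto_nhds_unique L (R.congr fun n => (hn n).symm)

/-- Weight tending to 1: the two boundary integrals carry a gradient of the cutoff and vanish by
|x|⁻¹ψ ∈ L², leaving only the field. -/
theorem integral_inner_magneticDeriv_commutator (hd : 0 < d) {A : Space d → Space d}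
    {B : Space d → Matrix (Fin d) (Fin d) ℝ}
    (hA : MemL2Loc A) (hB : ∀ j k, MemL2Loc (fun x => B x j k)) (hAB : IsMagneticField A B)
    {Γ : SpinorMatrix d} (hΓ : Γ.IsHermitian) (ψ : H1 d) (j k : Fin d)
    (hAψ : ∀ i, MemLp (fun x => A x i • (ψ : SpinorL2 d) x) 2 volume)
    (hψ : MemLp (fun x => ‖x‖⁻¹ • (ψ : SpinorL2 d) x) 2 volume)
    (hBψ : Integrable (fun x => B x j k * ‖(ψ : SpinorL2 d) x‖ ^ 2) volume) :
    ∫ x, 2 * inner ℝ (magneticDeriv A j ψ x) (Complex.I • act Γ (magneticDeriv A k ψ x))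
      = -∫ x, B x j k * inner ℝ ((ψ : SpinorL2 d) x) (act Γ ((ψ : SpinorL2 d) x)) := by
  have hD := fun i => memLp_magneticDeriv (hAψ i)
  have h1 : MemLp (fun _ : Space d => (1 : ℝ)) ∞ volume := memLp_top_const 1
  have hψm := (Lp.aestronglyMeasurable (ψ : SpinorL2 d))
  have i0 : Integrable (fun x => 2 * inner ℝ (magneticDeriv A j ψ x)
      (Complex.I • act Γ (magneticDeriv A k ψ x))) volume := by
    have := (integrable_inner_act (hD j) (hD k) (Complex.I • act Γ) h1).const_mul 2
    simpa using this
  have i1 : ∀ k, Integrable (fun x => ‖x‖⁻¹ * inner ℝ ((ψ : SpinorL2 d) x)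
      (Complex.I • act Γ (magneticDeriv A k ψ x))) volume := by
    intro k
    have := integrable_inner_act hψ (hD k) (Complex.I • act Γ) h1
    simpa [real_inner_smul_left] using this
  have i2 : Integrable (fun x => B x j k * inner ℝ ((ψ : SpinorL2 d) x)
      (act Γ ((ψ : SpinorL2 d) x))) volume := by
    refine (hBψ.norm.const_mul ‖act Γ‖).mono' ((hB j k).aestronglyMeasurable.mul
      (hψm.inner ((act Γ).continuous.comp_aestronglyMeasurable hψm)))
      (Eventually.of_forall fun x => ?_)
    rw [norm_mul, norm_mul, norm_pow, norm_norm]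
    calc _ ≤ ‖B x j k‖ * (‖(ψ : SpinorL2 d) x‖ * (‖act Γ‖ * ‖(ψ : SpinorL2 d) x‖)) := by
          gcongr
          exact (norm_inner_le_norm _ _).trans
            (mul_le_mul_of_nonneg_left ((act Γ).le_opNorm _) (norm_nonneg _))
      _ = _ := by ring
  have hn : ∀ n, (∫ x, cutoff d n x * (2 * inner ℝ (magneticDeriv A j ψ x)
        (Complex.I • act Γ (magneticDeriv A k ψ x)))) = _ := fun n =>
    integral_mul_inner_magneticDeriv_antisymm hA hB hAB hΓ (contDiff_cutoff n)
      (hasCompactSupport_cutoff n) ψ j k hAψ (by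
        refine (integrable_cutoff_mul hBψ n).congr (Eventually.of_forall fun x => ?_)
        ring)
  have L := tendsto_integral_cutoff_mul hd i0
  have R := ((tendsto_integral_fderiv_cutoff_mul hd (i1 k) j).neg.add
    (tendsto_integral_fderiv_cutoff_mul hd (i1 j) k)).sub (tendsto_integral_cutoff_mul hd i2)
  have := tendsto_nhds_unique L (R.congr fun n => by
    rw [hn n]; simp only [mul_assoc])
  rw [this]; simp

/-! ### Hardy's inequality -/

theorem norm_sq_eq_sum (x : Space d) : ‖x‖ ^ 2 = ∑ j, x j ^ 2 := by
  rw [EuclideanSpace.norm_sq_eq]; simp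

theorem fderiv_coord (x : Space d) (j k : Fin d) :
    fderiv ℝ (fun x : Space d => x k) x (basisVec j) = if j = k then 1 else 0 := by
  have : (fun x : Space d => x k) = (EuclideanSpace.proj k : Space d →L[ℝ] ℝ) := rfl
  rw [this, ContinuousLinearMap.fderiv]
  simp [eq_comm]

/-- The shift serves two purposes: it is positive for the regularised field and zero for the
singular field x/|x|². -/
theorem fderiv_regularized_inv {ε : ℝ} {x : Space d} (h : ‖x‖ ^ 2 + ε ≠ 0) (j : Fin d) :
    fderiv ℝ (fun x : Space d => x j * (‖x‖ ^ 2 + ε)⁻¹) x (basisVec j)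
      = (‖x‖ ^ 2 + ε)⁻¹ - 2 * x j ^ 2 * ((‖x‖ ^ 2 + ε)⁻¹) ^ 2 := by
  have h1 : HasFDerivAt (fun x : Space d => x j) (EuclideanSpace.proj j : Space d →L[ℝ] ℝ) x :=
    (EuclideanSpace.proj j : Space d →L[ℝ] ℝ).hasFDerivAt
  have h2 : HasFDerivAt (fun x : Space d => ‖x‖ ^ 2 + ε) _ x :=
    (hasStrictFDerivAt_norm_sq x).hasFDerivAt.add_const ε
  have h3 := (h1.mul ((hasDerivAt_inv h).comp_hasFDerivAt x h2)).fderiv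
  have e : (fun x : Space d => x j * (‖x‖ ^ 2 + ε)⁻¹) = (fun x : Space d => x j)
      * (Inv.inv ∘ fun x : Space d => ‖x‖ ^ 2 + ε) := rfl
  have h4 : inner ℝ x (basisVec j) = x j := by simp [basisVec, EuclideanSpace.inner_single_right]
  rw [e, h3]
  simp [h4]
  ring

theorem contDiffOn_inv_norm_sq : ContDiffOn ℝ ∞ (fun x : Space d => (‖x‖ ^ 2)⁻¹) {0}ᶜ :=
  (contDiff_norm_sq ℝ).contDiffOn.inv fun x hx => by
    have := norm_pos_iff.mpr (Set.mem_compl_singleton_iff.mp hx)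
    positivity

theorem contDiff_coord (j : Fin d) : ContDiff ℝ ∞ fun x : Space d => x j :=
  (EuclideanSpace.proj j : Space d →L[ℝ] ℝ).contDiff

theorem isHermitian_one : (1 : SpinorMatrix d).IsHermitian := Matrix.isHermitian_one

theorem act_one (u : Spinor d) : act (1 : SpinorMatrix d) u = u := by
  simp [act]

/-- Test with the field φ x/(|x|² + c), φ a bump at scale 1/c. With q = (|x|² + c)⁻¹ its divergence
is at least φ(d−2)q minus a bounded term from ∇φ, and Young's inequality on the gradient term costs
at most φq/2. The bound is crude: only its uniformity in c matters. -/
theorem hardy_regularized (hd : 3 ≤ d) (A : Space d → Space d) (ψ : H1 d)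
    (hD : ∀ j, MemLp (magneticDeriv A j ψ) 2 volume) :
    ∃ M : ℝ, ∀ c : ℝ, 0 < c → c ≤ 1 →
      ∫ x, scaledBump d c x * (‖x‖ ^ 2 + c)⁻¹ * ‖(ψ : SpinorL2 d) x‖ ^ 2 ≤ M := by
  obtain ⟨C, hC0, hC⟩ := exists_bound_fderiv_scaledBump d
  have hψ := Lp.memLp (ψ : SpinorL2 d)
  refine ⟨2 * ∫ x, (d * C * ‖(ψ : SpinorL2 d) x‖ ^ 2 + 2 * ∑ j, ‖magneticDeriv A j ψ x‖ ^ 2),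
    fun c hc hc1 => ?_⟩
  have hq0 : ∀ x : Space d, 0 < ‖x‖ ^ 2 + c := fun x => by positivity
  have hqs : ContDiff ℝ ∞ (fun x : Space d => (‖x‖ ^ 2 + c)⁻¹) :=
    ((contDiff_norm_sq ℝ).add contDiff_const).inv fun x => (hq0 x).ne'
  have hws : ∀ j : Fin d, ContDiff ℝ ∞ (fun x : Space d => x j * (‖x‖ ^ 2 + c)⁻¹) := fun j =>
    (contDiff_coord j).mul hqs
  set φ := scaledBump d c
  have hφs : ContDiff ℝ ∞ φ := contDiff_scaledBump c
  have hφc : HasCompactSupport φ := hasCompactSupport_scaledBump hc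
  have hgs : ∀ j : Fin d, ContDiff ℝ ∞ (fun x : Space d => φ x * (x j * (‖x‖ ^ 2 + c)⁻¹)) :=
    fun j => hφs.mul (hws j)
  have hgc : ∀ j : Fin d, HasCompactSupport (fun x : Space d => φ x * (x j * (‖x‖ ^ 2 + c)⁻¹)) :=
    fun j => hφc.mul_right
  have hpd : ∀ (j : Fin d) (x : Space d),
      fderiv ℝ (fun x : Space d => φ x * (x j * (‖x‖ ^ 2 + c)⁻¹)) x (basisVec j)
      = fderiv ℝ φ x (basisVec j) * (x j * (‖x‖ ^ 2 + c)⁻¹)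
        + φ x * ((‖x‖ ^ 2 + c)⁻¹ - 2 * x j ^ 2 * ((‖x‖ ^ 2 + c)⁻¹) ^ 2) := by
    intro j x
    rw [← fderiv_regularized_inv (hq0 x).ne']
    have h := (((hφs.differentiable (by simp)) x).hasFDerivAt.mul
      (((hws j).differentiable (by simp)) x).hasFDerivAt).fderiv
    simp only [Pi.mul_def] at h
    rw [h]
    simp; ring
  have hi := fun j => integral_mul_inner_magneticDeriv A isHermitian_one (hgs j) (hgc j) ψ j
  simp only [act_one, real_inner_self_eq_norm_sq] at hi
  have i1 : ∀ j, Integrable (fun x => φ x * (x j * (‖x‖ ^ 2 + c)⁻¹)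
      * (2 * inner ℝ ((ψ : SpinorL2 d) x) (magneticDeriv A j ψ x))) volume := by
    intro j
    have := (integrable_inner_act hψ (hD j) (act 1)
      (memLp_top_of_hasCompactSupport (hgs j).continuous (hgc j))).const_mul 2
    refine this.congr (Eventually.of_forall fun x => ?_)
    simp only [act_one]; ring
  have i2 : ∀ {w : Space d → ℝ}, MemLp w ∞ volume →
      Integrable (fun x => w x * ‖(ψ : SpinorL2 d) x‖ ^ 2) volume := by
    intro w hw
    refine (integrable_inner_act hψ hψ (act 1) hw).congr (Eventually.of_forall fun x => ?_)
    simp only [act_one, real_inner_self_eq_norm_sq]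
  have i2' := fun j : Fin d => i2 (memLp_top_partial (hgs j) (hgc j) (basisVec j))
  have i3 : Integrable (fun x => φ x * (‖x‖ ^ 2 + c)⁻¹ * ‖(ψ : SpinorL2 d) x‖ ^ 2) volume :=
    i2 (memLp_top_of_hasCompactSupport (hφs.mul hqs).continuous hφc.mul_right)
  have i4 : Integrable (fun x => d * C * ‖(ψ : SpinorL2 d) x‖ ^ 2
      + 2 * ∑ j, ‖magneticDeriv A j ψ x‖ ^ 2) volume :=
    ((hψ.integrable_norm_pow two_ne_zero).const_mul _).add
      ((integrable_finsetSum _ fun j _ => (hD j).integrable_norm_pow two_ne_zero).const_mul 2)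
  have i5 := integrable_finsetSum (Finset.univ : Finset (Fin d)) fun j _ => (i1 j).add (i2' j)
  have z5 : ∫ x, ∑ j, ((fun x => φ x * (x j * (‖x‖ ^ 2 + c)⁻¹)
      * (2 * inner ℝ ((ψ : SpinorL2 d) x) (magneticDeriv A j ψ x))) + (fun x =>
        fderiv ℝ (fun x : Space d => φ x * (x j * (‖x‖ ^ 2 + c)⁻¹)) x (basisVec j)
          * ‖(ψ : SpinorL2 d) x‖ ^ 2)) x = 0 := by
    rw [integral_finsetSum _ fun j _ => (i1 j).add (i2' j)]
    refine Finset.sum_eq_zero fun j _ => ?_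
    rw [integral_add' (i1 j) (i2' j), hi j]
    ring
  have key : ∀ x, φ x * (‖x‖ ^ 2 + c)⁻¹ * ‖(ψ : SpinorL2 d) x‖ ^ 2
      ≤ 2 * (∑ j, ((fun x => φ x * (x j * (‖x‖ ^ 2 + c)⁻¹)
      * (2 * inner ℝ ((ψ : SpinorL2 d) x) (magneticDeriv A j ψ x))) + (fun x =>
        fderiv ℝ (fun x : Space d => φ x * (x j * (‖x‖ ^ 2 + c)⁻¹)) x (basisVec j)
          * ‖(ψ : SpinorL2 d) x‖ ^ 2)) x
        + (d * C * ‖(ψ : SpinorL2 d) x‖ ^ 2 + 2 * ∑ j, ‖magneticDeriv A j ψ x‖ ^ 2)) := by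
    intro x
    simp only [Pi.add_apply, hpd]
    set q := (‖x‖ ^ 2 + c)⁻¹ with hq
    have hqpos : 0 < q := inv_pos.mpr (hq0 x)
    have hqq : q * ‖x‖ ^ 2 ≤ 1 := by
      rw [hq, inv_mul_le_iff₀ (hq0 x)]; linarith
    have hφ0 : 0 ≤ φ x := scaledBump_nonneg c x
    have hφ1 : φ x ≤ 1 := scaledBump_le_one c x
    set s := ‖(ψ : SpinorL2 d) x‖
    have hs0 : 0 ≤ s := norm_nonneg _
    -- the contribution of the derivative of the bump function
    have a1 : ∀ j, -C ≤ fderiv ℝ φ x (basisVec j) * (x j * q) := by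
      intro j
      by_cases hx : c * ‖x‖ < 1
      · rw [fderiv_scaledBump_eq_zero hc.le hx]; simpa using hC0
      -- As c ≤ 1, the gradient of the bump is supported where ‖x‖ ≥ 1, and there q ≤ 1.
      · have hx1 : 1 ≤ ‖x‖ := by
          have := not_lt.mp hx
          nlinarith [norm_nonneg x]
        have hq1 : q ≤ 1 := inv_le_one_of_one_le₀ (by nlinarith)
        refine (abs_le.mp ?_).1
        have hxj : |x j| ≤ ‖x‖ := by simpa using PiLp.norm_apply_le x j
        rw [abs_mul, abs_mul, abs_of_pos hqpos]
        calc _ ≤ ‖fderiv ℝ φ x‖ * (‖x‖ * 1) := by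
              gcongr
              exact abs_fderiv_basisVec_le φ x j
          _ = ‖x‖ * ‖fderiv ℝ φ x‖ := by ring
          _ ≤ C := hC c hc.le x
    -- the contribution of the gradient
    have a2 : ∀ j, -(2 * ‖magneticDeriv A j ψ x‖ ^ 2 + φ x * (1 / 2 * q ^ 2 * x j ^ 2 * s ^ 2))
        ≤ φ x * (x j * q) * (2 * inner ℝ ((ψ : SpinorL2 d) x) (magneticDeriv A j ψ x)) := by
      intro j
      have h1 := abs_le.mp (abs_real_inner_le_norm ((ψ : SpinorL2 d) x) (magneticDeriv A j ψ x))
      have h2 : |x j * q * (2 * inner ℝ ((ψ : SpinorL2 d) x) (magneticDeriv A j ψ x))|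
          ≤ 2 * ‖magneticDeriv A j ψ x‖ ^ 2 + 1 / 2 * q ^ 2 * x j ^ 2 * s ^ 2 := by
        rw [abs_mul, abs_mul, abs_mul, abs_of_pos hqpos, abs_two]
        calc _ ≤ |x j| * q * (2 * (s * ‖magneticDeriv A j ψ x‖)) := by
              gcongr; exact abs_real_inner_le_norm _ _
          _ ≤ _ := by
              rw [← sq_abs (x j)]
              nlinarith [sq_nonneg (|x j| * q * s - 2 * ‖magneticDeriv A j ψ x‖)]
      have h3 := (abs_le.mp h2).1
      have h4 := mul_le_mul_of_nonneg_left h3 hφ0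
      nlinarith [mul_nonneg (sub_nonneg.mpr hφ1) (sq_nonneg ‖magneticDeriv A j ψ x‖)]
    have hsum : ∑ j, (-(2 * ‖magneticDeriv A j ψ x‖ ^ 2 + φ x * (1 / 2 * q ^ 2 * x j ^ 2 * s ^ 2))
        + (-C + φ x * (q - 2 * x j ^ 2 * q ^ 2)) * s ^ 2)
        ≤ ∑ j, (φ x * (x j * q) * (2 * inner ℝ ((ψ : SpinorL2 d) x) (magneticDeriv A j ψ x))
          + (fderiv ℝ φ x (basisVec j) * (x j * q) + φ x * (q - 2 * x j ^ 2 * q ^ 2)) * s ^ 2) := by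
      refine Finset.sum_le_sum fun j _ => add_le_add (a2 j) ?_
      gcongr
      exact a1 j
    have hsum2 : ∑ j, (-(2 * ‖magneticDeriv A j ψ x‖ ^ 2 + φ x * (1 / 2 * q ^ 2 * x j ^ 2 * s ^ 2))
        + (-C + φ x * (q - 2 * x j ^ 2 * q ^ 2)) * s ^ 2)
        = -(2 * ∑ j, ‖magneticDeriv A j ψ x‖ ^ 2) - φ x * (1 / 2 * q ^ 2 * s ^ 2) * ‖x‖ ^ 2
          - d * C * s ^ 2 + φ x * (d * q - 2 * ‖x‖ ^ 2 * q ^ 2) * s ^ 2 := by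
      have : ∀ j : Fin d, -(2 * ‖magneticDeriv A j ψ x‖ ^ 2 + φ x * (1 / 2 * q ^ 2 * x j ^ 2 * s ^ 2))
        + (-C + φ x * (q - 2 * x j ^ 2 * q ^ 2)) * s ^ 2
        = (-2) * ‖magneticDeriv A j ψ x‖ ^ 2 + (-(φ x * (1 / 2 * q ^ 2 * s ^ 2))
          - φ x * 2 * q ^ 2 * s ^ 2) * x j ^ 2 + (-C + φ x * q) * s ^ 2 := fun j => by ring
      simp only [this, Finset.sum_add_distrib, ← Finset.mul_sum, ← norm_sq_eq_sum,
        Finset.sum_const, Finset.card_univ, Fintype.card_fin, nsmul_eq_mul]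
      ring
    rw [hsum2] at hsum
    -- What is left of φq|ψ|² has coefficient at least d − 2 − ½ ≥ ½, whence the factor 2 in the
    -- bound.
    have hd' : (3 : ℝ) ≤ d := by exact_mod_cast hd
    have hp : 0 ≤ φ x * q * s ^ 2 := by positivity
    have hp2 : φ x * q * s ^ 2 * (q * ‖x‖ ^ 2) ≤ φ x * q * s ^ 2 := mul_le_of_le_one_right hp hqq
    nlinarith
  calc _ ≤ _ := integral_mono i3 ((i5.add i4).const_mul 2) key
    _ = _ := by
      simp only [Pi.add_apply] at z5 ⊢
      rw [integral_const_mul, integral_add _ i4, z5, zero_add]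
      simpa using i5

/-- Fatou's lemma along c → 0 in the regularised bound. -/
theorem memLp_inv_norm_smul (hd : 3 ≤ d) (A : Space d → Space d) (ψ : H1 d)
    (hD : ∀ j, MemLp (magneticDeriv A j ψ) 2 volume) :
    MemLp (fun x => ‖x‖⁻¹ • (ψ : SpinorL2 d) x) 2 volume := by
  obtain ⟨M, hM⟩ := hardy_regularized hd A ψ hD
  have hψ := Lp.memLp (ψ : SpinorL2 d)
  have hm : AEStronglyMeasurable (fun x => ‖x‖⁻¹ • (ψ : SpinorL2 d) x) volume :=
    (measurable_norm.inv.aestronglyMeasurable).smul hψ.1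
  rw [memLp_two_iff_integrable_sq_norm hm]
  refine ⟨hm.norm.pow 2, ?_⟩
  set c : ℕ → ℝ := fun n => 1 / ((n : ℝ) + 1) with hcdef
  have hc : Tendsto c atTop (𝓝 0) := tendsto_one_div_add_atTop_nhds_zero_nat
  have hc0 : ∀ n, 0 < c n := fun n => by positivity
  have hc1 : ∀ n, c n ≤ 1 := fun n => by
    rw [hcdef, div_le_one (by positivity)]; linarith [(Nat.cast_nonneg n : (0:ℝ) ≤ n)]
  set F : ℕ → Space d → ℝ := fun n x =>
    scaledBump d (c n) x * (‖x‖ ^ 2 + c n)⁻¹ * ‖(ψ : SpinorL2 d) x‖ ^ 2 with hF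
  have hF0 : ∀ n x, 0 ≤ F n x := fun n x =>
    mul_nonneg (mul_nonneg (scaledBump_nonneg _ _)
      (inv_nonneg.mpr (add_nonneg (sq_nonneg _) (hc0 n).le))) (sq_nonneg _)
  have hFs : ∀ n, ContDiff ℝ ∞ fun x : Space d => scaledBump d (c n) x * (‖x‖ ^ 2 + c n)⁻¹ :=
    fun n => (contDiff_scaledBump _).mul (((contDiff_norm_sq ℝ).add contDiff_const).inv
      fun x => (add_pos_of_nonneg_of_pos (sq_nonneg _) (hc0 n)).ne')
  have hFm : ∀ n, AEStronglyMeasurable (F n) volume := fun n =>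
    (hFs n).continuous.aestronglyMeasurable.mul (hψ.1.norm.pow 2)
  have hFi : ∀ n, Integrable (F n) volume := by
    intro n
    obtain ⟨C, hC⟩ := (hasCompactSupport_scaledBump (d := d) (hc0 n)).mul_right
      (f' := fun x : Space d => (‖x‖ ^ 2 + c n)⁻¹) |>.exists_bound_of_continuous (hFs n).continuous
    exact (hψ.integrable_norm_pow two_ne_zero).bdd_mul (c := C)
      (hFs n).continuous.aestronglyMeasurable (Eventually.of_forall hC)
  have hlim : ∀ᵐ x, Tendsto (fun n => ENNReal.ofReal (F n x)) atTop
      (𝓝 ‖‖‖x‖⁻¹ • (ψ : SpinorL2 d) x‖ ^ 2‖ₑ) := by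
    filter_upwards [ae_ne_zero (by omega : 0 < d)] with x hx
    have hx0 := norm_pos_iff.mpr hx
    rw [Real.enorm_of_nonneg (sq_nonneg _)]
    refine (ENNReal.continuous_ofReal.tendsto _).comp ?_
    have h1 : Tendsto (fun n => (‖x‖ ^ 2 + c n)⁻¹ * ‖(ψ : SpinorL2 d) x‖ ^ 2) atTop
        (𝓝 ((‖x‖ ^ 2 + 0)⁻¹ * ‖(ψ : SpinorL2 d) x‖ ^ 2)) :=
      ((hc.const_add _).inv₀ (by positivity)).mul_const _
    have e : ‖‖x‖⁻¹ • (ψ : SpinorL2 d) x‖ ^ 2 = (‖x‖ ^ 2 + 0)⁻¹ * ‖(ψ : SpinorL2 d) x‖ ^ 2 := by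
      rw [norm_smul, norm_inv, norm_norm, mul_pow, add_zero, inv_pow]
    rw [e]
    refine h1.congr' ?_
    have h2 : ∀ᶠ n in atTop, c n * ‖x‖ < 1 := by
      have : Tendsto (fun n => c n * ‖x‖) atTop (𝓝 0) := by simpa using hc.mul_const ‖x‖
      exact this.eventually_lt_const one_pos
    filter_upwards [h2] with n hn
    simp only [hF]
    rw [scaledBump_eq_one (hc0 n).le hn.le, one_mul]
  calc ∫⁻ x, ‖‖‖x‖⁻¹ • (ψ : SpinorL2 d) x‖ ^ 2‖ₑ
      = ∫⁻ x, liminf (fun n => ENNReal.ofReal (F n x)) atTop :=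
        lintegral_congr_ae (hlim.mono fun x hx => hx.liminf_eq.symm)
    _ ≤ liminf (fun n => ∫⁻ x, ENNReal.ofReal (F n x)) atTop :=
        lintegral_liminf_le' fun n => (hFm n).aemeasurable.ennreal_ofReal
    _ ≤ ENNReal.ofReal M := by
        refine liminf_le_of_le (by isBoundedDefault) fun b hb => ?_
        obtain ⟨n, hn⟩ := hb.exists
        refine hn.trans ?_
        rw [← ofReal_integral_eq_lintegral_ofReal (hFi n) (Eventually.of_forall (hF0 n))]
        exact ENNReal.ofReal_le_ofReal (hM (c n) (hc0 n) (hc1 n))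
    _ < ⊤ := ENNReal.ofReal_lt_top

/-- The divergence of x/|x|² is (d−2)/|x|². Once |x|⁻¹ψ is known to be in L², the singular weight
can be used directly, and the identity is exact; the sharp Hardy constant follows from it by
Cauchy–Schwarz. -/
theorem integral_radial_magneticDeriv (hd : 3 ≤ d) (A : Space d → Space d) (ψ : H1 d)
    (hD : ∀ j, MemLp (magneticDeriv A j ψ) 2 volume) :
    ∫ x, ∑ j, ((‖x‖ ^ 2)⁻¹ * x j) * inner ℝ ((ψ : SpinorL2 d) x) (magneticDeriv A j ψ x)
      = -(((d : ℝ) - 2) / 2) * ∫ x, (‖x‖ ^ 2)⁻¹ * ‖(ψ : SpinorL2 d) x‖ ^ 2 := by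
  have hd0 : 0 < d := by omega
  have hu := memLp_inv_norm_smul hd A ψ hD
  have hψm := (Lp.memLp (ψ : SpinorL2 d)).1
  have hxj : ∀ (x : Space d) j, |x j| ≤ ‖x‖ := fun x j => by simpa using PiLp.norm_apply_le x j
  have iz : Integrable (fun x => (‖x‖ ^ 2)⁻¹ * ‖(ψ : SpinorL2 d) x‖ ^ 2) volume := by
    refine (hu.integrable_norm_pow two_ne_zero).congr (Eventually.of_forall fun x => ?_)
    simp only [norm_smul, norm_inv, norm_norm, mul_pow, inv_pow]
  set w : Fin d → Space d → ℝ := fun j x => x j * (‖x‖ ^ 2 + 0)⁻¹ with hw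
  have hws : ∀ j, ContDiffOn ℝ ∞ (w j) {0}ᶜ := fun j => by
    simp only [hw, add_zero]
    exact (contDiff_coord j).contDiffOn.mul contDiffOn_inv_norm_sq
  have hwd : ∀ᵐ x, ∀ j, fderiv ℝ (w j) x (basisVec j)
      = (‖x‖ ^ 2)⁻¹ - 2 * x j ^ 2 * ((‖x‖ ^ 2)⁻¹) ^ 2 := by
    filter_upwards [ae_ne_zero hd0] with x hx j
    rw [hw, fderiv_regularized_inv (by simpa using hx), add_zero]
  have hwm : ∀ j, AEStronglyMeasurable (w j) volume := fun j =>
    ((contDiff_coord j).continuous.measurable.mul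
      ((measurable_norm.pow_const 2).add_const 0).inv).aestronglyMeasurable
  have hsm : ∀ x : Space d, ∀ j, |w j x| ≤ ‖x‖⁻¹ := by
    intro x j
    by_cases hx : x = 0
    · simp [hw, hx]
    have hx0 := norm_pos_iff.mpr hx
    simp only [hw, add_zero]
    rw [abs_mul, abs_of_nonneg (by positivity : 0 ≤ (‖x‖ ^ 2)⁻¹)]
    calc _ ≤ ‖x‖ * (‖x‖ ^ 2)⁻¹ := by gcongr; exact hxj x j
      _ = _ := by field_simp
  have i1 : ∀ j, Integrable (fun x => w j x * inner ℝ ((ψ : SpinorL2 d) x)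
      (magneticDeriv A j ψ x)) volume := by
    intro j
    refine (hu.norm.integrable_mul (hD j).norm).mono' ((hwm j).mul (hψm.inner (hD j).1))
      (Eventually.of_forall fun x => ?_)
    rw [norm_mul, Pi.mul_apply, norm_smul, norm_inv, norm_norm, mul_assoc]
    gcongr
    exacts [hsm x j, norm_inner_le_norm _ _]
  have hqm : AEStronglyMeasurable (fun x : Space d => (‖x‖ ^ 2)⁻¹) volume :=
    (measurable_norm.pow_const 2).inv.aestronglyMeasurable
  have i2 : ∀ j, Integrable (fun x => fderiv ℝ (w j) x (basisVec j) * ‖(ψ : SpinorL2 d) x‖ ^ 2)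
      volume := by
    intro j
    have hm : AEStronglyMeasurable (fun x => fderiv ℝ (w j) x (basisVec j)) volume := by
      refine AEStronglyMeasurable.congr (f := fun x : Space d =>
        (‖x‖ ^ 2)⁻¹ - 2 * x j ^ 2 * ((‖x‖ ^ 2)⁻¹) ^ 2) ?_ (hwd.mono fun x hx => (hx j).symm)
      exact hqm.sub ((((contDiff_coord j).continuous.aestronglyMeasurable.pow 2).const_mul 2).mul
        (hqm.pow 2))
    refine (iz.const_mul 3).mono' (hm.mul (hψm.norm.pow 2)) ?_
    filter_upwards [hwd, ae_ne_zero hd0] with x hx hx0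
    have hx1 := norm_pos_iff.mpr hx0
    rw [norm_mul, hx j, norm_pow, norm_norm, ← mul_assoc]
    gcongr
    have h1 : x j ^ 2 * (‖x‖ ^ 2)⁻¹ ≤ 1 := by
      rw [← div_eq_mul_inv, div_le_one (by positivity)]
      exact sq_le_sq' (by linarith [neg_abs_le (x j), hxj x j]) ((le_abs_self _).trans (hxj x j))
    have h2 : 0 ≤ (‖x‖ ^ 2)⁻¹ := by positivity
    rw [Real.norm_eq_abs, abs_le]
    constructor <;> nlinarith [mul_nonneg h2 (sub_nonneg.mpr h1), mul_nonneg h2 (sq_nonneg (x j)),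
      mul_nonneg h2 (mul_nonneg h2 (sq_nonneg (x j)))]
  have hj : ∀ j, ∫ x, w j x * (2 * inner ℝ ((ψ : SpinorL2 d) x) (magneticDeriv A j ψ x))
      = -∫ x, fderiv ℝ (w j) x (basisVec j) * ‖(ψ : SpinorL2 d) x‖ ^ 2 := by
    intro j
    have h := integral_mul_inner_magneticDeriv_of_contDiffOn hd0 A isHermitian_one (hws j) ψ j
    simp only [act_one, real_inner_self_eq_norm_sq] at h
    refine h (i1 j) (i2 j) (iz.mono ?_ (Eventually.of_forall fun x => ?_))
    · exact measurable_norm.inv.aestronglyMeasurable.mul ((hwm j).mul (hψm.norm.pow 2))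
    · rw [norm_mul, norm_mul (w j x), ← mul_assoc, norm_mul ((‖x‖ ^ 2)⁻¹)]
      refine mul_le_mul_of_nonneg_right ?_ (norm_nonneg _)
      calc ‖‖x‖⁻¹‖ * ‖w j x‖ ≤ ‖‖x‖⁻¹‖ * ‖x‖⁻¹ :=
            mul_le_mul_of_nonneg_left (hsm x j) (norm_nonneg _)
        _ = ‖(‖x‖ ^ 2)⁻¹‖ := by
            rw [norm_inv, norm_norm, norm_inv, norm_pow, norm_norm, sq, mul_inv]
  have hs := Finset.sum_congr (rfl : (Finset.univ : Finset (Fin d)) = _) fun j _ => hj j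
  rw [Finset.sum_neg_distrib, ← integral_finsetSum _ fun j _ => i2 j] at hs
  have e2 : ∫ x, ∑ j, fderiv ℝ (w j) x (basisVec j) * ‖(ψ : SpinorL2 d) x‖ ^ 2
      = ((d : ℝ) - 2) * ∫ x, (‖x‖ ^ 2)⁻¹ * ‖(ψ : SpinorL2 d) x‖ ^ 2 := by
    rw [← integral_const_mul]
    refine integral_congr_ae ?_
    filter_upwards [hwd, ae_ne_zero hd0] with x hx hx0
    have hx1 := norm_pos_iff.mpr hx0
    rw [← Finset.sum_mul]
    simp only [hx, Finset.sum_sub_distrib, ← Finset.sum_mul, ← Finset.mul_sum, ← norm_sq_eq_sum,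
      Finset.sum_const, Finset.card_univ, Fintype.card_fin, nsmul_eq_mul]
    field_simp
  have e1 : ∀ j, ∫ x, w j x * (2 * inner ℝ ((ψ : SpinorL2 d) x) (magneticDeriv A j ψ x))
      = 2 * ∫ x, ((‖x‖ ^ 2)⁻¹ * x j) * inner ℝ ((ψ : SpinorL2 d) x) (magneticDeriv A j ψ x) := by
    intro j
    rw [← integral_const_mul]
    refine integral_congr_ae (Eventually.of_forall fun x => ?_)
    simp only [hw, add_zero]; ring
  rw [integral_finsetSum _ fun j _ => (i1 j).congr (Eventually.of_forall fun x => by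
    simp only [hw, add_zero]; ring)]
  simp only [e1, ← Finset.mul_sum, e2] at hs
  linarith

/-! ### Clifford algebra -/

/-- Clifford multiplication `α(x) = ∑_j x_j α_j`. -/
def clifford (α : Fin d → SpinorMatrix d) : Space d →ₗ[ℝ] (Spinor d →L[ℂ] Spinor d) :=
  ∑ j, (EuclideanSpace.proj j : Space d →L[ℝ] ℝ).toLinearMap.smulRight (act (α j))

theorem clifford_apply (α : Fin d → SpinorMatrix d) (x : Space d) (u : Spinor d) :
    clifford α x u = ∑ j, x j • act (α j) u := by
  simp [clifford, LinearMap.sum_apply]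

theorem clifford_basisVec (α : Fin d → SpinorMatrix d) (j : Fin d) (u : Spinor d) :
    clifford α (basisVec j) u = act (α j) u := by
  rw [clifford_apply, Finset.sum_eq_single j]
  · simp
  · intro k _ hk; simp [hk]
  · simp

theorem real_inner_clifford_left {α : Fin d → SpinorMatrix d} {β : SpinorMatrix d}
    (h : IsDiracMatrices α β) (x : Space d) (u w : Spinor d) :
    inner ℝ (clifford α x u) w = inner ℝ u (clifford α x w) := by
  simp only [clifford_apply, sum_inner, inner_sum, real_inner_smul_left, real_inner_smul_right,
    real_inner_act_left (h.hermitian_alpha _)]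

theorem act_act_alpha_add {α : Fin d → SpinorMatrix d} {β : SpinorMatrix d}
    (h : IsDiracMatrices α β) (j k : Fin d) (u : Spinor d) :
    act (α j) (act (α k) u) + act (α k) (act (α j) u) = if j = k then (2 : ℝ) • u else 0 := by
  have e : act (α j) (act (α k) u) + act (α k) (act (α j) u)
      = act (α j * α k + α k * α j) u := by
    rw [act, act, act, map_add, map_mul, map_mul]; rfl
  rw [e, h.anticomm_alpha]
  split_ifs
  · have : (2 : SpinorMatrix d) = 1 + 1 := by norm_num
    rw [act, this, map_add, add_apply, act_one, two_smul]
  · simp [act]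

theorem clifford_clifford_add {α : Fin d → SpinorMatrix d} {β : SpinorMatrix d}
    (h : IsDiracMatrices α β) (x y : Space d) (u : Spinor d) :
    clifford α x (clifford α y u) + clifford α y (clifford α x u) = (2 * inner ℝ x y) • u := by
  have e1 : clifford α x (clifford α y u)
      = ∑ j, ∑ k, (x j * y k) • act (α j) (act (α k) u) := by
    rw [clifford_apply α x]
    refine Finset.sum_congr rfl fun j _ => ?_
    rw [clifford_apply, map_sum, Finset.smul_sum]
    exact Finset.sum_congr rfl fun k _ => by rw [clm_real_smul, smul_smul]
  have e2 : clifford α y (clifford α x u)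
      = ∑ j, ∑ k, (x j * y k) • act (α k) (act (α j) u) := by
    rw [clifford_apply α y, Finset.sum_comm]
    refine Finset.sum_congr rfl fun j _ => ?_
    rw [clifford_apply, map_sum, Finset.smul_sum]
    exact Finset.sum_congr rfl fun k _ => by rw [clm_real_smul, smul_smul, mul_comm]
  rw [e1, e2, ← Finset.sum_add_distrib]
  simp only [← Finset.sum_add_distrib, ← smul_add, act_act_alpha_add h, smul_ite, smul_zero,
    Finset.sum_ite_eq, Finset.mem_univ, if_true, smul_smul, ← Finset.sum_smul]
  congr 1
  rw [PiLp.inner_apply, Finset.mul_sum]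
  exact Finset.sum_congr rfl fun j _ => by simp; ring

theorem clifford_clifford_self {α : Fin d → SpinorMatrix d} {β : SpinorMatrix d}
    (h : IsDiracMatrices α β) (x : Space d) (u : Spinor d) :
    clifford α x (clifford α x u) = (‖x‖ ^ 2) • u := by
  have h1 := clifford_clifford_add h x x u
  rw [← two_smul ℝ, mul_smul, real_inner_self_eq_norm_sq] at h1
  exact smul_right_injective _ (two_ne_zero' ℝ) h1

/-- α(x) is symmetric and squares to |x|². -/
theorem norm_clifford {α : Fin d → SpinorMatrix d} {β : SpinorMatrix d}
    (h : IsDiracMatrices α β) (x : Space d) (u : Spinor d) :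
    ‖clifford α x u‖ = ‖x‖ * ‖u‖ := by
  rw [← sq_eq_sq₀ (norm_nonneg _) (by positivity), ← real_inner_self_eq_norm_sq,
    real_inner_clifford_left h, clifford_clifford_self h, real_inner_smul_right,
    real_inner_self_eq_norm_sq, mul_pow]

theorem norm_act_alpha {α : Fin d → SpinorMatrix d} {β : SpinorMatrix d}
    (h : IsDiracMatrices α β) (j : Fin d) (u : Spinor d) : ‖act (α j) u‖ = ‖u‖ := by
  rw [← clifford_basisVec, norm_clifford h]; simp

theorem act_beta_beta {α : Fin d → SpinorMatrix d} {β : SpinorMatrix d}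
    (h : IsDiracMatrices α β) (u : Spinor d) : act β (act β u) = u := by
  have : act β (act β u) = act (β * β) u := by rw [act, act, map_mul]; rfl
  rw [this, h.beta_sq, act_one]

theorem norm_act_beta {α : Fin d → SpinorMatrix d} {β : SpinorMatrix d}
    (h : IsDiracMatrices α β) (u : Spinor d) : ‖act β u‖ = ‖u‖ := by
  rw [← sq_eq_sq₀ (norm_nonneg _) (norm_nonneg _), ← real_inner_self_eq_norm_sq,
    real_inner_act_left h.hermitian_beta, act_beta_beta h, real_inner_self_eq_norm_sq]

theorem act_beta_alpha {α : Fin d → SpinorMatrix d} {β : SpinorMatrix d}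
    (h : IsDiracMatrices α β) (j : Fin d) (u : Spinor d) :
    act β (act (α j) u) = -act (α j) (act β u) := by
  have e : act (α j) (act β u) + act β (act (α j) u) = act (α j * β + β * α j) u := by
    rw [act, act, act, map_add, map_mul, map_mul]; rfl
  rw [h.anticomm_beta] at e
  rw [eq_neg_iff_add_eq_zero, add_comm, e]; simp [act]

theorem act_beta_clifford {α : Fin d → SpinorMatrix d} {β : SpinorMatrix d}
    (h : IsDiracMatrices α β) (x : Space d) (u : Spinor d) :
    act β (clifford α x u) = -clifford α x (act β u) := by
  simp only [clifford_apply, map_sum, clm_real_smul, act_beta_alpha h, smul_neg,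
    Finset.sum_neg_distrib]

/-- β and α(x) are Hermitian and anticommute, so βα(x) is anti-Hermitian. This removes the product
of potential and magnetic field from the virial identity. -/
theorem real_inner_beta_clifford {α : Fin d → SpinorMatrix d} {β : SpinorMatrix d}
    (h : IsDiracMatrices α β) (x : Space d) (u : Spinor d) :
    inner ℝ (act β u) (clifford α x u) = 0 := by
  have h1 : inner ℝ (act β u) (clifford α x u) = -inner ℝ (act β u) (clifford α x u) := by
    conv_lhs => rw [real_inner_act_left h.hermitian_beta, act_beta_clifford h, inner_neg_right,
      ← real_inner_clifford_left h, real_inner_comm]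
  linarith

theorem norm_sum_act_alpha_sq_le {α : Fin d → SpinorMatrix d} {β : SpinorMatrix d}
    (h : IsDiracMatrices α β) (ξ : Fin d → Spinor d) :
    ‖∑ j, act (α j) (ξ j)‖ ^ 2 ≤ d * ∑ j, ‖ξ j‖ ^ 2 := by
  calc ‖∑ j, act (α j) (ξ j)‖ ^ 2 ≤ (∑ j, ‖ξ j‖) ^ 2 := by
        gcongr
        exact (norm_sum_le _ _).trans_eq (Finset.sum_congr rfl fun j _ => norm_act_alpha h j _)
    _ ≤ _ := by
        have := sq_sum_le_card_mul_sum_sq (s := (Finset.univ : Finset (Fin d))) (f := fun j => ‖ξ j‖)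
        simpa using this

/-! ### Pointwise bounds for the spin term -/

/-- A skew-symmetric map on an odd-dimensional Euclidean space has a unit kernel vector. -/
theorem exists_unit_kernel_of_skew {W : Type*} [NormedAddCommGroup W] [InnerProductSpace ℝ W]
    [FiniteDimensional ℝ W] (hW : Odd (Module.finrank ℝ W)) (g : W →ₗ[ℝ] W)
    (hg : ∀ x y, inner ℝ (g x) y = -inner ℝ x (g y)) : ∃ w, ‖w‖ = 1 ∧ g w = 0 := by
  have b := stdOrthonormalBasis ℝ W
  have hT : (LinearMap.toMatrix b.toBasis b.toBasis g).transpose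
      = -LinearMap.toMatrix b.toBasis b.toBasis g := by
    ext i j
    simp only [Matrix.transpose_apply, Matrix.neg_apply, LinearMap.toMatrix_apply,
      OrthonormalBasis.coe_toBasis, OrthonormalBasis.coe_toBasis_repr_apply,
      OrthonormalBasis.repr_apply_apply]
    rw [← real_inner_comm, hg]
  have hdet : LinearMap.det g = 0 := by
    rw [← LinearMap.det_toMatrix b.toBasis]
    have h1 := Matrix.det_transpose (LinearMap.toMatrix b.toBasis b.toBasis g)
    rw [hT, Matrix.det_neg, Fintype.card_fin, hW.neg_one_pow] at h1
    linarith
  obtain ⟨w, hw, hw0⟩ := (Submodule.ne_bot_iff _).mp (LinearMap.bot_lt_ker_of_det_eq_zero hdet).ne'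
  refine ⟨(‖w‖⁻¹ : ℝ) • w, ?_, ?_⟩
  · rw [norm_smul, norm_inv, norm_norm, inv_mul_cancel₀ (norm_ne_zero_iff.mpr hw0)]
  · rw [map_smul, LinearMap.mem_ker.mp hw, smul_zero]

/-- The Clifford contraction `∑_l α(e_l) α(f e_l)` of a linear map. -/
def spinSum (α : Fin d → SpinorMatrix d) (f : Space d →L[ℝ] Space d) (u : Spinor d) : Spinor d :=
  ∑ l, clifford α (basisVec l) (clifford α (f (basisVec l)) u)

theorem sum_bilin_orthonormalBasis {V E ι κ : Type*} [NormedAddCommGroup V] [InnerProductSpace ℝ V]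
    [AddCommGroup E] [Module ℝ E] [Fintype ι] [Fintype κ] (Φ : V →ₗ[ℝ] V →ₗ[ℝ] E)
    (b : OrthonormalBasis ι ℝ V) (b' : OrthonormalBasis κ ℝ V) :
    ∑ i, Φ (b i) (b i) = ∑ k, Φ (b' k) (b' k) := by
  calc ∑ i, Φ (b i) (b i) = ∑ i, ∑ k, inner ℝ (b' k) (b i) • Φ (b' k) (b i) := by
        refine Finset.sum_congr rfl fun i _ => ?_
        have e : Φ (b i) = ∑ k, inner ℝ (b' k) (b i) • Φ (b' k) := by
          conv_lhs => rw [← b'.sum_repr (b i), map_sum]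
          exact Finset.sum_congr rfl fun k _ => by rw [map_smul, b'.repr_apply_apply]
        rw [e, LinearMap.sum_apply]
        rfl
    _ = ∑ k, Φ (b' k) (∑ i, inner ℝ (b i) (b' k) • b i) := by
        rw [Finset.sum_comm]
        refine Finset.sum_congr rfl fun k _ => ?_
        rw [map_sum]
        exact Finset.sum_congr rfl fun i _ => by rw [map_smul, real_inner_comm]
    _ = _ := Finset.sum_congr rfl fun k _ => by
        congr 1
        conv_rhs => rw [← b.sum_repr (b' k)]
        exact Finset.sum_congr rfl fun i _ => by rw [b.repr_apply_apply]

theorem spinSum_eq_sum {ι : Type*} [Fintype ι] (α : Fin d → SpinorMatrix d)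
    (b : OrthonormalBasis ι ℝ (Space d)) (f : Space d →L[ℝ] Space d) (u : Spinor d) :
    spinSum α f u = ∑ i, clifford α (b i) (clifford α (f (b i)) u) := by
  let Φ : Space d →ₗ[ℝ] Space d →ₗ[ℝ] Spinor d := LinearMap.mk₂ ℝ
    (fun x y => clifford α x (clifford α (f y) u))
    (fun x y z => by simp) (fun c x y => by simp) (fun x y z => by simp)
    (fun c x y => by simp)
  have h := sum_bilin_orthonormalBasis Φ (EuclideanSpace.basisFun (Fin d) ℝ) b
  simpa [Φ, spinSum] using h

/-- The contraction is a trace and may be computed in any orthonormal basis. In one that extends the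
given kernel vectors, only d − |s| summands survive, each of norm at most C‖u‖. -/
theorem norm_spinSum_le_of_kernel {α : Fin d → SpinorMatrix d} {β : SpinorMatrix d}
    (h : IsDiracMatrices α β) (f : Space d →L[ℝ] Space d) {C : ℝ} (hC : ∀ x, ‖f x‖ ≤ C * ‖x‖)
    (s : Finset (Fin d)) (v : Fin d → Space d) (hv : Orthonormal ℝ ((s : Set (Fin d)).domRestrict v))
    (hf : ∀ i ∈ s, f (v i) = 0) (u : Spinor d) :
    ‖spinSum α f u‖ ≤ ((d : ℝ) - s.card) * C * ‖u‖ := by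
  obtain ⟨b, hb⟩ := hv.exists_orthonormalBasis_extension_of_card_eq (by simp)
  rw [spinSum_eq_sum α b]
  have hcard : (sᶜ.card : ℝ) = (d : ℝ) - s.card := by
    rw [Finset.card_compl, Fintype.card_fin, Nat.cast_sub]
    simpa using s.card_le_univ
  rw [← Finset.sum_compl_add_sum s, Finset.sum_eq_zero (s := s), add_zero]
  · refine (norm_sum_le _ _).trans ((Finset.sum_le_card_nsmul _ _ (C * ‖u‖) fun i _ => ?_).trans ?_)
    · rw [norm_clifford h, norm_clifford h, b.norm_eq_one, one_mul]
      have := hC (b i)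
      rw [b.norm_eq_one, mul_one] at this
      gcongr
    · rw [nsmul_eq_mul, hcard, mul_assoc]
  · intro i hi
    rw [hb i hi, hf i hi]; simp

theorem toEuclideanCLM_skew {M : Matrix (Fin d) (Fin d) ℝ} (hM : ∀ j k, M k j = -M j k)
    (x y : Space d) :
    inner ℝ (Matrix.toEuclideanCLM (n := Fin d) (𝕜 := ℝ) M x) y
      = -inner ℝ x (Matrix.toEuclideanCLM (n := Fin d) (𝕜 := ℝ) M y) := by
  simp only [PiLp.inner_apply, Matrix.ofLp_toEuclideanCLM, Matrix.mulVec, dotProduct,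
    RCLike.inner_apply, conj_trivial]
  simp only [Finset.mul_sum, Finset.sum_mul]
  rw [Finset.sum_comm, ← Finset.sum_neg_distrib]
  refine Finset.sum_congr rfl fun j _ => ?_
  rw [← Finset.sum_neg_distrib]
  exact Finset.sum_congr rfl fun k _ => by rw [hM]; ring

theorem inner_skew_self {f : Space d →L[ℝ] Space d} (hf : ∀ x y, inner ℝ (f x) y = -inner ℝ x (f y))
    (x : Space d) : inner ℝ x (f x) = 0 := by
  have := hf x x
  rw [real_inner_comm] at this
  linarith

theorem sum_magnetic_eq_spinSum {α : Fin d → SpinorMatrix d} {M : Matrix (Fin d) (Fin d) ℝ}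
    (hM : ∀ j k, M k j = -M j k) (u : Spinor d) :
    ∑ j, ∑ k, M j k • act (α j) (act (α k) u)
      = -spinSum α (Matrix.toEuclideanCLM (n := Fin d) (𝕜 := ℝ) M) u := by
  rw [spinSum, ← Finset.sum_neg_distrib]
  refine Finset.sum_congr rfl fun j _ => ?_
  rw [clifford_basisVec, clifford_apply, map_sum, ← Finset.sum_neg_distrib]
  refine Finset.sum_congr rfl fun k _ => ?_
  rw [clm_real_smul, Matrix.ofLp_toEuclideanCLM]
  simp [hM j k]

/-- The compression of a skew map to the orthogonal complement of `x`. -/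
def compression (f : Space d →L[ℝ] Space d) (x : Space d) : Space d →L[ℝ] Space d :=
  f - ((‖x‖ ^ 2)⁻¹ • (innerSL ℝ x ∘L f)).smulRight x - ((‖x‖ ^ 2)⁻¹ • innerSL ℝ x).smulRight (f x)

theorem compression_apply (f : Space d →L[ℝ] Space d) (x z : Space d) :
    compression f x z = f z - ((‖x‖ ^ 2)⁻¹ * inner ℝ x (f z)) • x
      - ((‖x‖ ^ 2)⁻¹ * inner ℝ x z) • f x := by
  simp [compression]

theorem norm_sub_proj_le {x : Space d} (hx : x ≠ 0) (z : Space d) :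
    ‖z - ((‖x‖ ^ 2)⁻¹ * inner ℝ x z) • x‖ ≤ ‖z‖ := by
  have hx1 := norm_pos_iff.mpr hx
  rw [← sq_le_sq₀ (norm_nonneg _) (norm_nonneg _), norm_sub_sq_real, real_inner_smul_right,
    norm_smul, mul_pow, Real.norm_eq_abs, sq_abs, real_inner_comm x z]
  have : ((‖x‖ ^ 2)⁻¹ * inner ℝ x z) ^ 2 * ‖x‖ ^ 2
      = (‖x‖ ^ 2)⁻¹ * inner ℝ x z * inner ℝ x z := by field_simp
  rw [this]
  have : 0 ≤ (‖x‖ ^ 2)⁻¹ * inner ℝ x z * inner ℝ x z := by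
    rw [mul_assoc]; exact mul_nonneg (by positivity) (mul_self_nonneg _)
  linarith

/-- With P the projection along x, the compression is PfP; skewness enters through ⟨x, f x⟩ = 0. -/
theorem norm_compression_le {f : Space d →L[ℝ] Space d}
    (hf : ∀ x y, inner ℝ (f x) y = -inner ℝ x (f y)) {x : Space d} (hx : x ≠ 0) (z : Space d) :
    ‖compression f x z‖ ≤ ‖f‖ * ‖z‖ := by
  have e : compression f x z = f (z - ((‖x‖ ^ 2)⁻¹ * inner ℝ x z) • x)
      - ((‖x‖ ^ 2)⁻¹ * inner ℝ x (f (z - ((‖x‖ ^ 2)⁻¹ * inner ℝ x z) • x))) • x := by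
    rw [compression_apply, map_sub, map_smul, inner_sub_right, real_inner_smul_right,
      inner_skew_self hf x, mul_zero, sub_zero]
    abel
  rw [e]
  exact (norm_sub_proj_le hx _).trans ((f.le_opNorm _).trans
    (mul_le_mul_of_nonneg_left (norm_sub_proj_le hx _) (norm_nonneg _)))

theorem spinSum_smulRight (α : Fin d → SpinorMatrix d) (x y : Space d) (u : Spinor d) :
    spinSum α ((innerSL ℝ x).smulRight y) u = clifford α x (clifford α y u) := by
  rw [spinSum, clifford_apply α x]
  refine Finset.sum_congr rfl fun j _ => ?_
  simp [clifford_basisVec, EuclideanSpace.inner_single_right]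

/-- The difference of f and its compression is the rank two map built from x and f x. Its
contraction has two terms, α(x)α(f x) and −α(f x)α(x), which coincide because f x ⟂ x. -/
theorem spinSum_eq_compression {α : Fin d → SpinorMatrix d} {β : SpinorMatrix d}
    (h : IsDiracMatrices α β) {f : Space d →L[ℝ] Space d}
    (hf : ∀ x y, inner ℝ (f x) y = -inner ℝ x (f y)) (x : Space d) (u : Spinor d) :
    spinSum α f u = spinSum α (compression f x) u
      + (2 * (‖x‖ ^ 2)⁻¹) • clifford α x (clifford α (f x) u) := by
  have e : compression f x = f + (‖x‖ ^ 2)⁻¹ • (innerSL ℝ (f x)).smulRight x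
      - (‖x‖ ^ 2)⁻¹ • (innerSL ℝ x).smulRight (f x) := by
    ext1 z
    rw [compression_apply]
    simp [hf x z, smul_smul, sub_eq_add_neg]
  have e2 : spinSum α (compression f x) u = spinSum α f u
      + (‖x‖ ^ 2)⁻¹ • spinSum α ((innerSL ℝ (f x)).smulRight x) u
      - (‖x‖ ^ 2)⁻¹ • spinSum α ((innerSL ℝ x).smulRight (f x)) u := by
    rw [e]
    simp only [spinSum, Finset.smul_sum, ← Finset.sum_add_distrib, ← Finset.sum_sub_distrib]
    refine Finset.sum_congr rfl fun l _ => ?_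
    simp
  have e3 : clifford α (f x) (clifford α x u) = -clifford α x (clifford α (f x) u) := by
    rw [eq_neg_iff_add_eq_zero, clifford_clifford_add h, real_inner_comm, inner_skew_self hf]
    simp
  rw [e2, spinSum_smulRight, spinSum_smulRight, e3, mul_smul, two_smul, smul_neg]
  abel

/-- The compression acts on x^⊥ as a skew map, and d − 1 is odd. -/
theorem exists_unit_kernel_compression (hd : Even d) {f : Space d →L[ℝ] Space d}
    (hf : ∀ x y, inner ℝ (f x) y = -inner ℝ x (f y)) {x : Space d} (hx : x ≠ 0) :
    ∃ w, ‖w‖ = 1 ∧ inner ℝ x w = 0 ∧ compression f x w = 0 := by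
  have hx1 := norm_pos_iff.mpr hx
  let W : Submodule ℝ (Space d) := (ℝ ∙ x)ᗮ
  have hmem : ∀ z, z ∈ W ↔ inner ℝ x z = 0 := fun z => Submodule.mem_orthogonal_singleton_iff_inner_right
  have hc : ∀ z ∈ W, compression f x z ∈ W := by
    intro z hz
    rw [hmem] at hz ⊢
    rw [compression_apply, hz, inner_sub_right, inner_sub_right, real_inner_smul_right,
      real_inner_smul_right, real_inner_self_eq_norm_sq]
    field_simp; ring
  have hdim : Odd (Module.finrank ℝ W) := by
    have h1 := Submodule.finrank_add_finrank_orthogonal (ℝ ∙ x)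
    rw [finrank_span_singleton hx, finrank_euclideanSpace_fin] at h1
    change 1 + Module.finrank ℝ W = d at h1
    rw [← h1, add_comm, Nat.even_add_one, Nat.not_even_iff_odd] at hd
    exact hd
  obtain ⟨w, hw1, hw⟩ := exists_unit_kernel_of_skew hdim
    ((compression f x).toLinearMap.restrict hc) (fun y z => by
      have hy := (hmem _).mp y.2
      have hz := (hmem _).mp z.2
      rw [Submodule.coe_inner, Submodule.coe_inner, LinearMap.coe_restrict_apply,
        LinearMap.coe_restrict_apply, ContinuousLinearMap.coe_coe, compression_apply,
        compression_apply, hy, hz, inner_sub_left, inner_sub_left, inner_sub_right,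
        inner_sub_right, real_inner_smul_left, real_inner_smul_left, real_inner_smul_right,
        real_inner_smul_right, hf, hz, real_inner_comm x, hy]
      ring)
  exact ⟨w, hw1, (hmem _).mp w.2, congrArg Subtype.val hw⟩

theorem norm_spinSum_le_of_odd (hd : Odd d) {α : Fin d → SpinorMatrix d} {β : SpinorMatrix d}
    (h : IsDiracMatrices α β) {f : Space d →L[ℝ] Space d}
    (hf : ∀ x y, inner ℝ (f x) y = -inner ℝ x (f y)) (u : Spinor d) :
    ‖spinSum α f u‖ ≤ ((d : ℝ) - 1) * ‖f‖ * ‖u‖ := by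
  obtain ⟨w, hw1, hw⟩ := exists_unit_kernel_of_skew (by simpa using hd) f.toLinearMap hf
  have := norm_spinSum_le_of_kernel h f (fun x => f.le_opNorm x) {⟨0, hd.pos⟩} (fun _ => w)
    ⟨fun _ => hw1, fun i j hij => (hij (Subtype.ext (by
      have hi := i.2; have hj := j.2
      simp only [Finset.coe_singleton, Set.mem_singleton_iff] at hi hj
      rw [hi, hj]))).elim⟩ (fun i _ => hw) u
  simpa using this

/-- The compression kills x as well as the kernel vector found in x^⊥, so two summands drop out. -/
theorem norm_spinSum_compression_le (hd2 : 2 ≤ d) (hd : Even d) {α : Fin d → SpinorMatrix d}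
    {β : SpinorMatrix d} (h : IsDiracMatrices α β) {f : Space d →L[ℝ] Space d}
    (hf : ∀ x y, inner ℝ (f x) y = -inner ℝ x (f y)) {x : Space d} (hx : x ≠ 0) (u : Spinor d) :
    ‖spinSum α (compression f x) u‖ ≤ ((d : ℝ) - 2) * ‖f‖ * ‖u‖ := by
  obtain ⟨w, hw1, hxw, hw⟩ := exists_unit_kernel_compression hd hf hx
  have hx1 := norm_pos_iff.mpr hx
  have hne : (⟨0, by omega⟩ : Fin d) ≠ ⟨1, by omega⟩ := by simp
  -- Orthonormality is required only on the labels 0 and 1; the values at other labels play no role.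
  let v : Fin d → Space d := fun i => if i.1 = 0 then (‖x‖⁻¹ : ℝ) • x else w
  have hvn : ∀ i, ‖v i‖ = 1 := by
    intro i
    simp only [v]; split_ifs
    · rw [norm_smul, norm_inv, norm_norm, inv_mul_cancel₀ hx1.ne']
    · exact hw1
  have := norm_spinSum_le_of_kernel h (compression f x) (norm_compression_le hf hx)
    {⟨0, by omega⟩, ⟨1, by omega⟩} v ⟨fun i => hvn i, ?_⟩ ?_ u
  · rwa [Finset.card_pair hne, Nat.cast_ofNat] at this
  · rintro ⟨i, hi⟩ ⟨j, hj⟩ hij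
    simp only [Finset.coe_insert, Finset.coe_singleton, Set.mem_insert_iff,
      Set.mem_singleton_iff] at hi hj
    rcases hi with rfl | rfl <;> rcases hj with rfl | rfl
    · exact (hij rfl).elim
    · change inner ℝ (v ⟨0, by omega⟩) (v ⟨1, by omega⟩) = 0
      simp [v, real_inner_smul_left, hxw]
    · change inner ℝ (v ⟨1, by omega⟩) (v ⟨0, by omega⟩) = 0
      simp [v, real_inner_smul_right, real_inner_comm x, hxw]
    · exact (hij rfl).elim
  · intro i hi
    simp only [Finset.mem_insert, Finset.mem_singleton] at hi
    rcases hi with rfl | rfl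
    · simp only [v, if_true, map_smul, compression_apply, inner_skew_self hf,
        real_inner_self_eq_norm_sq]
      rw [inv_mul_cancel₀ (by positivity)]
      simp
    · simpa [v] using hw

/-- The spin part `½ ∑ M_{jk} Re⟨u, i α_j α_k u⟩` of the Lichnerowicz formula. -/
def spinForm (α : Fin d → SpinorMatrix d) (M : Matrix (Fin d) (Fin d) ℝ) (u : Spinor d) : ℝ :=
  1 / 2 * ∑ j, ∑ k, M j k * inner ℝ u (Complex.I • act (α j) (act (α k) u))

theorem spinForm_eq {α : Fin d → SpinorMatrix d} {M : Matrix (Fin d) (Fin d) ℝ}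
    (hM : ∀ j k, M k j = -M j k) (u : Spinor d) :
    spinForm α M u = -(1 / 2 * inner ℝ u
      (Complex.I • spinSum α (Matrix.toEuclideanCLM (n := Fin d) (𝕜 := ℝ) M) u)) := by
  have h := sum_magnetic_eq_spinSum (α := α) hM u
  rw [← neg_eq_iff_eq_neg] at h
  rw [spinForm, ← h, smul_neg, inner_neg_right, mul_neg, neg_neg]
  simp only [Finset.smul_sum, inner_sum]
  congr 1
  refine Finset.sum_congr rfl fun j _ => Finset.sum_congr rfl fun k _ => ?_
  rw [smul_comm, real_inner_smul_right]

theorem abs_real_inner_I_smul_le (u w : Spinor d) {C : ℝ} (hw : ‖w‖ ≤ C * ‖u‖) :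
    |inner ℝ u (Complex.I • w)| ≤ C * ‖u‖ ^ 2 := by
  refine (abs_real_inner_le_norm _ _).trans ?_
  rw [norm_smul, Complex.norm_I, one_mul]
  nlinarith [norm_nonneg u]

theorem abs_spinForm_le_of_odd (hd : Odd d) {α : Fin d → SpinorMatrix d} {β : SpinorMatrix d}
    (h : IsDiracMatrices α β) {M : Matrix (Fin d) (Fin d) ℝ} (hM : ∀ j k, M k j = -M j k)
    (u : Spinor d) : |spinForm α M u| ≤ (((d : ℝ) - 1) / 2) * (matrixNorm M * ‖u‖ ^ 2) := by
  rw [spinForm_eq hM, abs_neg, abs_mul, abs_of_pos (by norm_num : (0 : ℝ) < 1 / 2)]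
  have := abs_real_inner_I_smul_le u _ (norm_spinSum_le_of_odd hd h (toEuclideanCLM_skew hM) u)
  rw [matrixNorm]
  linarith

/-- The added term cancels the rank two part of the spin form. What remains is the compressed field,
hence d − 2 in place of d. -/
theorem abs_spinForm_add_le_of_even (hd2 : 2 ≤ d) (hd : Even d) {α : Fin d → SpinorMatrix d}
    {β : SpinorMatrix d} (h : IsDiracMatrices α β) {M : Matrix (Fin d) (Fin d) ℝ}
    (hM : ∀ j k, M k j = -M j k) {x : Space d} (hx : x ≠ 0) (u : Spinor d) :
    |spinForm α M u + (‖x‖ ^ 2)⁻¹ * inner ℝ u (Complex.I • clifford α x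
      (clifford α (Matrix.toEuclideanCLM (n := Fin d) (𝕜 := ℝ) M x) u))|
      ≤ (((d : ℝ) - 2) / 2) * (matrixNorm M * ‖u‖ ^ 2) := by
  have := abs_real_inner_I_smul_le u _
    (norm_spinSum_compression_le hd2 hd h (toEuclideanCLM_skew hM) hx u)
  rw [spinForm_eq hM, spinSum_eq_compression h (toEuclideanCLM_skew hM) x, smul_add,
    inner_add_right, smul_comm Complex.I, real_inner_smul_right, matrixNorm]
  rw [abs_le] at this ⊢
  constructor <;> linarith

/-! ### Integrability supplied by the operator domain and the Hardy-type bounds -/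

theorem integrable_of_abs_le_mul {p q F : Space d → ℝ} (hp : MemLp p 2 volume)
    (hq : MemLp q 2 volume) (hF : AEStronglyMeasurable F volume)
    (h : ∀ᵐ x, |F x| ≤ p x * q x) : Integrable F volume :=
  (hp.integrable_mul hq).mono' hF h

theorem abs_integral_le_of_abs_le_mul {p q F : Space d → ℝ} (hp : MemLp p 2 volume)
    (hq : MemLp q 2 volume) (h : ∀ᵐ x, |F x| ≤ p x * q x) :
    |∫ x, F x| ≤ √(∫ x, p x ^ 2) * √(∫ x, q x ^ 2) :=
  (norm_integral_le_of_norm_le (f := F) (hp.integrable_mul hq) h).trans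
    ((le_abs_self _).trans (abs_integral_mul_le hp hq))

/-- The operator `T = -i α · ∇_A` applied to `ψ ∈ H¹`. -/
def diracDeriv (α : Fin d → SpinorMatrix d) (A : Space d → Space d) (ψ : H1 d) (x : Space d) :
    Spinor d :=
  ∑ j, (-Complex.I) • act (α j) (magneticDeriv A j ψ x)

theorem memLp_act {f : Space d → Spinor d} (hf : MemLp f 2 volume)
    (L : Spinor d →L[ℂ] Spinor d) : MemLp (fun x => L (f x)) 2 volume :=
  L.comp_memLp' hf

theorem memLp_diracDeriv_of_domain {α : Fin d → SpinorMatrix d} {β : SpinorMatrix d} {m : ℝ}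
    {A : Space d → Space d} (hsa : (diracOp α β m A 0).domain = H1 d) (ψ : H1 d) :
    MemLp (diracDeriv α A ψ) 2 volume := by
  have hψ : (ψ : SpinorL2 d) ∈ (diracOp α β m A 0).domain := by
    rw [hsa]; exact ψ.2
  obtain ⟨h, hm⟩ := hψ
  refine (hm.sub ((memLp_act (Lp.memLp (ψ : SpinorL2 d)) (act β)).const_smul (m : ℂ))).ae_eq
    (Eventually.of_forall fun x => ?_)
  simp [diracExpr, diracDeriv, act]

theorem clifford_vectorPotential (α : Fin d → SpinorMatrix d) (A : Space d → Space d) (ψ : H1 d)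
    (x : Space d) : clifford α (A x) ((ψ : SpinorL2 d) x)
      = (∑ j, (-Complex.I) • act (α j) (weakDeriv j ψ x)) - diracDeriv α A ψ x := by
  rw [diracDeriv, clifford_apply, ← Finset.sum_sub_distrib]
  refine Finset.sum_congr rfl fun j _ => ?_
  rw [magneticDeriv_eq, map_sub, clm_real_smul, map_smul, smul_sub, sub_sub_cancel,
    smul_comm (-Complex.I), smul_smul]
  simp

/-- α(A)ψ = −iα·∇ψ − Tψ is a difference of L² functions, and |α(A)ψ| = |A||ψ|. Thus the information
that H¹ is the domain controls a potential that is only locally square integrable. -/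
theorem memLp_vectorPotential_smul {α : Fin d → SpinorMatrix d} {β : SpinorMatrix d}
    (h : IsDiracMatrices α β) {A : Space d → Space d} (hA : MemL2Loc A) {ψ : H1 d}
    (hT : MemLp (diracDeriv α A ψ) 2 volume) (j : Fin d) :
    MemLp (fun x => A x j • (ψ : SpinorL2 d) x) 2 volume := by
  have h1 : MemLp (fun x => clifford α (A x) ((ψ : SpinorL2 d) x)) 2 volume := by
    refine (MemLp.sub (f := fun x => ∑ j, (-Complex.I) • act (α j) (weakDeriv j ψ x))
      (memLp_finsetSum _ fun j _ =>
        (memLp_act (Lp.memLp (weakDeriv j ψ)) (act (α j))).const_smul (-Complex.I)) hT).ae_eq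
      (Eventually.of_forall fun x => (clifford_vectorPotential α A ψ x).symm)
  refine h1.mono (((hA.apply j).aestronglyMeasurable).smul
    (Lp.memLp (ψ : SpinorL2 d)).aestronglyMeasurable) (Eventually.of_forall fun x => ?_)
  rw [norm_smul, norm_clifford h]
  gcongr
  exact PiLp.norm_apply_le (A x) j

/-- The magnetic Dirichlet energy `∑_j ∫ |∂_j^A ψ|²` as a real number. -/
def energy (A : Space d → Space d) (ψ : H1 d) : ℝ := ∫ x, ∑ j, ‖magneticDeriv A j ψ x‖ ^ 2

theorem integrable_sum_norm_magneticDeriv_sq {A : Space d → Space d} {ψ : H1 d}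
    (hD : ∀ j, MemLp (magneticDeriv A j ψ) 2 volume) :
    Integrable (fun x => ∑ j, ‖magneticDeriv A j ψ x‖ ^ 2) volume :=
  integrable_finsetSum _ fun j _ => (hD j).norm.integrable_sq

theorem energy_nonneg (A : Space d → Space d) (ψ : H1 d) : 0 ≤ energy A ψ :=
  integral_nonneg fun _ => Finset.sum_nonneg fun _ _ => sq_nonneg _

theorem magneticEnergy_eq {A : Space d → Space d} {ψ : H1 d}
    (hD : ∀ j, MemLp (magneticDeriv A j ψ) 2 volume) :
    magneticEnergy A ψ = ENNReal.ofReal (energy A ψ) := by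
  rw [energy, ofReal_integral_eq_lintegral_ofReal (integrable_sum_norm_magneticDeriv_sq hD)
    (Eventually.of_forall fun _ => Finset.sum_nonneg fun _ _ => sq_nonneg _), magneticEnergy]
  refine lintegral_congr fun x => ?_
  rw [ENNReal.ofReal_sum_of_nonneg fun _ _ => sq_nonneg _]
  refine Finset.sum_congr rfl fun j _ => ?_
  rw [ENNReal.ofReal_pow (norm_nonneg _), ofReal_norm]

theorem HardyBound.integrable {A : Space d → Space d} {W : Space d → ℝ} {c : ℝ}
    (h : HardyBound A W c) (hc : 0 ≤ c) (hW : AEStronglyMeasurable W volume) (hW0 : ∀ x, 0 ≤ W x)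
    {ψ : H1 d} (hD : ∀ j, MemLp (magneticDeriv A j ψ) 2 volume) :
    Integrable (fun x => W x * ‖(ψ : SpinorL2 d) x‖ ^ 2) volume
      ∧ ∫ x, W x * ‖(ψ : SpinorL2 d) x‖ ^ 2 ≤ c * energy A ψ := by
  have hm : AEStronglyMeasurable (fun x => W x * ‖(ψ : SpinorL2 d) x‖ ^ 2) volume :=
    hW.mul ((Lp.memLp (ψ : SpinorL2 d)).aestronglyMeasurable.norm.pow 2)
  have h0 : 0 ≤ᵐ[volume] fun x => W x * ‖(ψ : SpinorL2 d) x‖ ^ 2 :=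
    Eventually.of_forall fun x => mul_nonneg (hW0 x) (sq_nonneg _)
  have h1 := h ψ
  rw [magneticEnergy_eq hD, ← ENNReal.ofReal_mul hc] at h1
  have hi : Integrable (fun x => W x * ‖(ψ : SpinorL2 d) x‖ ^ 2) volume := by
    refine ⟨hm, ?_⟩
    rw [hasFiniteIntegral_iff_ofReal h0]
    exact h1.trans_lt ENNReal.ofReal_lt_top
  refine ⟨hi, ?_⟩
  rw [← ofReal_integral_eq_lintegral_ofReal hi h0] at h1
  exact (ENNReal.ofReal_le_ofReal_iff (mul_nonneg hc (energy_nonneg A ψ))).mp h1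

theorem HardyBound.memLp {A : Space d → Space d} {W q : Space d → ℝ} {c : ℝ}
    (h : HardyBound A W (c ^ 2)) (hq : AEStronglyMeasurable q volume)
    (hW : ∀ x, W x = q x ^ 2) {ψ : H1 d} (hD : ∀ j, MemLp (magneticDeriv A j ψ) 2 volume) :
    MemLp (fun x => q x * ‖(ψ : SpinorL2 d) x‖) 2 volume
      ∧ ∫ x, (q x * ‖(ψ : SpinorL2 d) x‖) ^ 2 ≤ c ^ 2 * energy A ψ := by
  obtain rfl : W = fun x => q x ^ 2 := funext hW
  obtain ⟨h1, h2⟩ := h.integrable (sq_nonneg _) (hq.pow 2) (fun x => sq_nonneg _) hD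
  simp only [← mul_pow] at h1 h2
  exact ⟨(memLp_two_iff_integrable_sq
    (hq.mul (Lp.memLp (ψ : SpinorL2 d)).aestronglyMeasurable.norm)).mpr h1, h2⟩

/-- B is given only through its distributional pairing, so skewness holds almost everywhere, by the
fundamental lemma of the calculus of variations. -/
theorem magneticField_antisymm {A : Space d → Space d} {B : Space d → Matrix (Fin d) (Fin d) ℝ}
    (hB : ∀ j k, MemL2Loc (fun x => B x j k)) (hAB : IsMagneticField A B) :
    ∀ᵐ x, ∀ j k, B x k j = -B x j k := by
  rw [ae_all_iff]; intro j
  rw [ae_all_iff]; intro k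
  have h := ae_eq_zero_of_integral_contDiff_smul_eq_zero (μ := volume)
    (f := fun x => B x j k + B x k j)
    ((hB j k).locallyIntegrable.add (hB k j).locallyIntegrable) fun g hg hc => by
      have i1 := (hB j k).mul_integrable hg.continuous hc
      have i2 := (hB k j).mul_integrable hg.continuous hc
      simp only [smul_eq_mul, mul_add]
      rw [integral_add i1 i2]
      simp only [mul_comm (g _)]
      rw [hAB j k g hg hc, hAB k j g hg hc, ← integral_neg, ← integral_neg]
      rw [← sub_neg_eq_add, ← integral_neg, sub_eq_zero]
      exact integral_congr_ae (Eventually.of_forall fun x => by ring)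
  filter_upwards [h] with x hx
  linarith

theorem abs_apply_le_matrixNorm (M : Matrix (Fin d) (Fin d) ℝ) (j k : Fin d) :
    |M j k| ≤ matrixNorm M := by
  have h1 := (Matrix.toEuclideanCLM (n := Fin d) (𝕜 := ℝ) M).le_opNorm (basisVec k)
  have h2 := PiLp.norm_apply_le (Matrix.toEuclideanCLM (n := Fin d) (𝕜 := ℝ) M (basisVec k)) j
  rw [Matrix.ofLp_toEuclideanCLM] at h2
  simp only [basisVec, PiLp.norm_single, norm_one, mul_one] at h1
  simp at h2
  exact h2.trans h1

theorem aestronglyMeasurable_matrixNorm {B : Space d → Matrix (Fin d) (Fin d) ℝ}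
    (hB : ∀ j k, MemL2Loc (fun x => B x j k)) :
    AEStronglyMeasurable (fun x => matrixNorm (B x)) volume := by
  have h1 : AEStronglyMeasurable (fun x => (fun j k => B x j k : Fin d → Fin d → ℝ)) volume :=
    (aemeasurable_pi_lambda _ fun j => aemeasurable_pi_lambda _ fun k =>
      (hB j k).aestronglyMeasurable.aemeasurable).aestronglyMeasurable
  have h2 : Continuous fun M : Fin d → Fin d → ℝ => matrixNorm (Matrix.of M) := by
    let L : (Fin d → Fin d → ℝ) →ₗ[ℝ] (Space d →L[ℝ] Space d) :=
      (Matrix.toEuclideanCLM (n := Fin d) (𝕜 := ℝ)).toAlgEquiv.toLinearMap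
        ∘ₗ (Matrix.ofLinearEquiv ℝ).toLinearMap
    exact (LinearMap.continuous_of_finiteDimensional L).norm
  exact h2.comp_aestronglyMeasurable h1

theorem aestronglyMeasurable_of_continuousOn (hd : 0 < d) {E : Type*} [NormedAddCommGroup E]
    [SecondCountableTopology E] {f : Space d → E}
    (hf : ContinuousOn f {0}ᶜ) : AEStronglyMeasurable f volume := by
  have h := hf.aestronglyMeasurable (μ := volume) (measurableSet_singleton 0).compl
  rwa [Measure.restrict_eq_self_of_ae_mem] at h
  filter_upwards [ae_ne_zero hd] with x hx using hx

theorem contDiffOn_fderiv {v : Space d → ℝ} (hv : ContDiffOn ℝ ∞ v {0}ᶜ) :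
    ContinuousOn (fderiv ℝ v) {0}ᶜ :=
  hv.continuousOn_fderiv_of_isOpen isOpen_compl_singleton (by simp)

theorem norm_gradient (v : Space d → ℝ) (x : Space d) : ‖gradient v x‖ = ‖fderiv ℝ v x‖ := by
  rw [gradient, LinearIsometryEquiv.norm_map]

theorem diracDeriv_eq (α : Fin d → SpinorMatrix d) (A : Space d → Space d) (ψ : H1 d)
    (x : Space d) :
    diracDeriv α A ψ x = -(Complex.I • ∑ j, act (α j) (magneticDeriv A j ψ x)) := by
  rw [diracDeriv, Finset.smul_sum, ← Finset.sum_neg_distrib]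
  exact Finset.sum_congr rfl fun j _ => neg_smul _ _

theorem norm_diracDeriv (α : Fin d → SpinorMatrix d) (A : Space d → Space d) (ψ : H1 d)
    (x : Space d) : ‖diracDeriv α A ψ x‖ = ‖∑ j, act (α j) (magneticDeriv A j ψ x)‖ := by
  rw [diracDeriv_eq, norm_neg, norm_smul, Complex.norm_I, one_mul]

theorem memLp_inv_norm_mul {ψ : H1 d}
    (h : MemLp (fun x => ‖x‖⁻¹ • (ψ : SpinorL2 d) x) 2 volume) :
    MemLp (fun x => ‖x‖⁻¹ * ‖(ψ : SpinorL2 d) x‖) 2 volume := by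
  refine h.norm.ae_eq (Eventually.of_forall fun x => ?_)
  simp [norm_smul]

/-- Symmetry of T, tested on ψ: Re⟨ψ, α·∇_A ψ⟩ is a total divergence and integrates to 0, while by
the equation it equals −Im z |ψ|² pointwise. -/
theorem eigenvalue_im_eq_zero (hd : 3 ≤ d) {α : Fin d → SpinorMatrix d} {β : SpinorMatrix d}
    (h : IsDiracMatrices α β) {A : Space d → Space d} {ψ : H1 d}
    (hD : ∀ j, MemLp (magneticDeriv A j ψ) 2 volume) {w : Space d → ℝ} {z : ℂ}
    (hψ : (ψ : SpinorL2 d) ≠ 0)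
    (heq : ∀ᵐ x, diracDeriv α A ψ x + w x • act β ((ψ : SpinorL2 d) x)
      = z • (ψ : SpinorL2 d) x) : z.im = 0 := by
  have hu := Lp.memLp (ψ : SpinorL2 d)
  have hr := memLp_inv_norm_smul hd A ψ hD
  have i1 : ∀ j, Integrable (fun x => inner ℝ ((ψ : SpinorL2 d) x)
      (act (α j) (magneticDeriv A j ψ x))) volume := fun j => by
    simpa using integrable_inner_act hu (hD j) (act (α j)) (memLp_top_const (1 : ℝ))
  have hj : ∀ j, ∫ x, inner ℝ ((ψ : SpinorL2 d) x) (act (α j) (magneticDeriv A j ψ x)) = 0 := by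
    intro j
    have := integral_mul_inner_magneticDeriv_of_contDiffOn (by omega : 0 < d) A
      (h.hermitian_alpha j) (w := fun _ => 1) contDiffOn_const ψ j (by simpa using i1 j)
      (by simp) (by
        have := integrable_inner_act hr hu (act (α j)) (memLp_top_const (1 : ℝ))
        simpa [real_inner_smul_left] using this)
    simp only [one_mul, integral_const_mul] at this
    simpa using this
  have hs : ∫ x, ∑ j, inner ℝ ((ψ : SpinorL2 d) x) (act (α j) (magneticDeriv A j ψ x)) = 0 := by
    rw [integral_finsetSum _ fun j _ => i1 j]
    exact Finset.sum_eq_zero fun j _ => hj j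
  have he : ∫ x, ∑ j, inner ℝ ((ψ : SpinorL2 d) x) (act (α j) (magneticDeriv A j ψ x))
      = ∫ x, -z.im * ‖(ψ : SpinorL2 d) x‖ ^ 2 := by
    refine integral_congr_ae ?_
    filter_upwards [heq] with x hx
    have e1 : ∑ j, act (α j) (magneticDeriv A j ψ x)
        = Complex.I • (z • (ψ : SpinorL2 d) x - w x • act β ((ψ : SpinorL2 d) x)) := by
      rw [← hx, add_sub_cancel_right, diracDeriv_eq, smul_neg, smul_smul]
      simp
    rw [← inner_sum, e1, smul_sub, inner_sub_right, smul_comm Complex.I (w x), ← map_smul,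
      real_inner_smul_right, real_inner_act_I_self h.hermitian_beta, mul_zero, sub_zero, smul_smul,
      real_inner_eq_re, inner_smul_right, inner_self_eq_norm_sq_to_K]
    simp [← Complex.ofReal_pow]
  rw [hs, integral_const_mul, ← norm_sq_eq_integral] at he
  have : ‖(ψ : SpinorL2 d)‖ ^ 2 ≠ 0 := pow_ne_zero _ (norm_ne_zero_iff.mpr hψ)
  rcases mul_eq_zero.mp he.symm with h | h
  · linarith
  · exact absurd h this

theorem integrable_magneticField_mul_norm_sq {B : Space d → Matrix (Fin d) (Fin d) ℝ}
    (hd : 0 < d) (hB : ∀ j k, MemL2Loc (fun x => B x j k)) {ψ : H1 d}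
    (hr : MemLp (fun x => ‖x‖⁻¹ • (ψ : SpinorL2 d) x) 2 volume)
    (hBψ : MemLp (fun x => ‖x‖ * matrixNorm (B x) * ‖(ψ : SpinorL2 d) x‖) 2 volume)
    (j k : Fin d) : Integrable (fun x => B x j k * ‖(ψ : SpinorL2 d) x‖ ^ 2) volume := by
  refine integrable_of_abs_le_mul hBψ (memLp_inv_norm_mul hr)
    ((hB j k).aestronglyMeasurable.mul
      ((Lp.memLp (ψ : SpinorL2 d)).aestronglyMeasurable.norm.pow 2)) ?_
  filter_upwards [ae_ne_zero hd] with x hx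
  have hx1 := norm_pos_iff.mpr hx
  have : ‖x‖ * matrixNorm (B x) * ‖(ψ : SpinorL2 d) x‖ * (‖x‖⁻¹ * ‖(ψ : SpinorL2 d) x‖)
      = matrixNorm (B x) * ‖(ψ : SpinorL2 d) x‖ ^ 2 := by field_simp
  rw [this, abs_mul, abs_of_nonneg (sq_nonneg ‖(ψ : SpinorL2 d) x‖)]
  gcongr
  exact abs_apply_le_matrixNorm _ _ _

/-! ### The Lichnerowicz formula -/

/-- The Hermitian matrix `-(i/2)[α_j, α_k]`. -/
def spinMatrix (α : Fin d → SpinorMatrix d) (j k : Fin d) : SpinorMatrix d :=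
  (-Complex.I) • (α j * α k - if j = k then 1 else 0)

theorem isHermitian_spinMatrix {α : Fin d → SpinorMatrix d} {β : SpinorMatrix d}
    (h : IsDiracMatrices α β) (j k : Fin d) : (spinMatrix α j k).IsHermitian := by
  have h2 : α k * α j = (if j = k then 2 else 0) - α j * α k :=
    eq_sub_of_add_eq' (h.anticomm_alpha j k)
  rw [Matrix.IsHermitian, spinMatrix, Matrix.conjTranspose_smul, Matrix.conjTranspose_sub,
    Matrix.conjTranspose_mul, (h.hermitian_alpha j).eq, (h.hermitian_alpha k).eq, h2]
  have h3 : (-Complex.I) • (α j * α k - if j = k then (1 : SpinorMatrix d) else 0)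
      = Complex.I • ((if j = k then (1 : SpinorMatrix d) else 0) - α j * α k) := by
    rw [neg_smul, ← smul_neg, neg_sub]
  rw [h3]
  split_ifs with hjk
  · have : (2 : SpinorMatrix d) = 1 + 1 := by norm_num
    rw [Matrix.conjTranspose_one,
      show (2 : SpinorMatrix d) - α j * α k - 1 = 1 - α j * α k by rw [this]; abel]
    simp
  · simp

theorem act_spinMatrix (α : Fin d → SpinorMatrix d) (j k : Fin d) (u : Spinor d) :
    act (spinMatrix α j k) u
      = (-Complex.I) • (act (α j) (act (α k) u) - if j = k then u else 0) := by
  have e : act (α j * α k) u = act (α j) (act (α k) u) := by rw [act, map_mul]; rfl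
  rw [spinMatrix, act, map_smul, map_sub, smul_apply, sub_apply]
  split_ifs with hjk
  · rw [act_one, e]
  · rw [e]; simp

theorem I_smul_act_spinMatrix (α : Fin d → SpinorMatrix d) (j k : Fin d) (u : Spinor d) :
    Complex.I • act (spinMatrix α j k) u
      = act (α j) (act (α k) u) - if j = k then u else 0 := by
  rw [act_spinMatrix, smul_smul]; simp

/-- α_jα_k = δ_{jk} + iΓ_{jk} with Γ_{jk} Hermitian: the first part is the energy density, the
second has the shape required by the commutator identity, whose factor 2 explains ½ · 2. -/
theorem norm_diracDeriv_sq {α : Fin d → SpinorMatrix d} {β : SpinorMatrix d}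
    (h : IsDiracMatrices α β) (A : Space d → Space d) (ψ : H1 d) (x : Space d) :
    ‖diracDeriv α A ψ x‖ ^ 2 = ∑ j, ‖magneticDeriv A j ψ x‖ ^ 2
      + 1 / 2 * ∑ j, ∑ k, 2 * inner ℝ (magneticDeriv A j ψ x)
        (Complex.I • act (spinMatrix α j k) (magneticDeriv A k ψ x)) := by
  rw [norm_diracDeriv, ← real_inner_self_eq_norm_sq, sum_inner]
  simp only [real_inner_act_left (h.hermitian_alpha _), map_sum, inner_sum, I_smul_act_spinMatrix,
    inner_sub_right, ← Finset.mul_sum, Finset.sum_sub_distrib]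
  have : ∑ j, ∑ k, inner ℝ (magneticDeriv A j ψ x)
      (if j = k then magneticDeriv A k ψ x else 0) = ∑ j, ‖magneticDeriv A j ψ x‖ ^ 2 := by
    refine Finset.sum_congr rfl fun j _ => ?_
    rw [Finset.sum_eq_single j]
    · rw [if_pos rfl, real_inner_self_eq_norm_sq]
    · intro k _ hk; rw [if_neg hk.symm, inner_zero_right]
    · simp
  rw [this]; ring

theorem spinForm_eq_sum_spinMatrix (α : Fin d → SpinorMatrix d) {M : Matrix (Fin d) (Fin d) ℝ}
    (hM : ∀ j k, M k j = -M j k) (u : Spinor d) :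
    spinForm α M u = 1 / 2 * ∑ j, ∑ k, -(M j k * inner ℝ u (act (spinMatrix α j k) u)) := by
  rw [spinForm]
  congr 1
  refine Finset.sum_congr rfl fun j _ => Finset.sum_congr rfl fun k _ => ?_
  rw [act_spinMatrix]
  by_cases hjk : j = k
  · subst hjk
    have : M j j = 0 := by have := hM j j; linarith
    simp [this]
  · rw [if_neg hjk, sub_zero, neg_smul, inner_neg_right]; ring

/-- The Lichnerowicz formula. -/
theorem integral_norm_diracDeriv_sq (hd : 0 < d) {α : Fin d → SpinorMatrix d} {β : SpinorMatrix d}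
    (h : IsDiracMatrices α β) {A : Space d → Space d} {B : Space d → Matrix (Fin d) (Fin d) ℝ}
    (hA : MemL2Loc A) (hB : ∀ j k, MemL2Loc (fun x => B x j k)) (hAB : IsMagneticField A B)
    {ψ : H1 d} (hAψ : ∀ i, MemLp (fun x => A x i • (ψ : SpinorL2 d) x) 2 volume)
    (hr : MemLp (fun x => ‖x‖⁻¹ • (ψ : SpinorL2 d) x) 2 volume)
    (hBψ : MemLp (fun x => ‖x‖ * matrixNorm (B x) * ‖(ψ : SpinorL2 d) x‖) 2 volume) :
    Integrable (fun x => spinForm α (B x) ((ψ : SpinorL2 d) x)) volume ∧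
    ∫ x, ‖diracDeriv α A ψ x‖ ^ 2
      = energy A ψ + ∫ x, spinForm α (B x) ((ψ : SpinorL2 d) x) := by
  have hD := fun j => memLp_magneticDeriv (hAψ j)
  have hanti := magneticField_antisymm hB hAB
  have hBi := integrable_magneticField_mul_norm_sq hd hB hr hBψ
  have hu := Lp.memLp (ψ : SpinorL2 d)
  have i1 : ∀ j k, Integrable (fun x => 2 * inner ℝ (magneticDeriv A j ψ x)
      (Complex.I • act (spinMatrix α j k) (magneticDeriv A k ψ x))) volume := fun j k =>
    integrable_inner_act (hD j) (hD k) (Complex.I • act (spinMatrix α j k))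
      (memLp_top_const (2 : ℝ))
  have i2 : ∀ j k, Integrable (fun x => B x j k * inner ℝ ((ψ : SpinorL2 d) x)
      (act (spinMatrix α j k) ((ψ : SpinorL2 d) x))) volume := fun j k => by
    refine ((hBi j k).norm.mul_const ‖act (spinMatrix α j k)‖).mono'
      ((hB j k).aestronglyMeasurable.mul (hu.aestronglyMeasurable.inner
        (memLp_act hu _).aestronglyMeasurable)) (Eventually.of_forall fun x => ?_)
    rw [norm_mul, norm_mul, mul_assoc]
    gcongr
    refine (abs_real_inner_le_norm _ _).trans ?_
    rw [norm_pow, norm_norm, sq, mul_assoc]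
    gcongr
    rw [mul_comm]
    exact (act (spinMatrix α j k)).le_opNorm _
  have i3 : ∀ j k, Integrable (fun x => -(B x j k * inner ℝ ((ψ : SpinorL2 d) x)
      (act (spinMatrix α j k) ((ψ : SpinorL2 d) x)))) volume := fun j k => (i2 j k).neg
  have hsf : (fun x => 1 / 2 * ∑ j, ∑ k, -(B x j k * inner ℝ ((ψ : SpinorL2 d) x)
      (act (spinMatrix α j k) ((ψ : SpinorL2 d) x))))
      =ᵐ[volume] fun x => spinForm α (B x) ((ψ : SpinorL2 d) x) := by
    filter_upwards [hanti] with x hx using (spinForm_eq_sum_spinMatrix α hx _).symm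
  have isf : Integrable (fun x => 1 / 2 * ∑ j, ∑ k, -(B x j k * inner ℝ ((ψ : SpinorL2 d) x)
      (act (spinMatrix α j k) ((ψ : SpinorL2 d) x)))) volume :=
    (integrable_finsetSum _ fun j _ => integrable_finsetSum _ fun k _ =>
      i3 j k).const_mul _
  refine ⟨isf.congr hsf, ?_⟩
  simp only [norm_diracDeriv_sq h]
  rw [integral_add (integrable_sum_norm_magneticDeriv_sq hD)
    ((integrable_finsetSum _ fun j _ => integrable_finsetSum _ fun k _ => i1 j k).const_mul _),
    ← integral_congr_ae hsf, integral_const_mul, integral_const_mul, energy]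
  congr 2
  rw [integral_finsetSum _ fun j _ => integrable_finsetSum _ fun k _ => i1 j k,
    integral_finsetSum _ fun j _ => integrable_finsetSum _ fun k _ => i3 j k]
  refine Finset.sum_congr rfl fun j _ => ?_
  rw [integral_finsetSum _ fun k _ => i1 j k, integral_finsetSum _ fun k _ => i3 j k]
  refine Finset.sum_congr rfl fun k _ => ?_
  -- For each pair (j, k) the commutator identity with Γ_{jk} turns the product of gradients into a
  -- multiple of B_{jk}.
  rw [integral_inner_magneticDeriv_commutator hd hA hB hAB (isHermitian_spinMatrix h j k) ψ j k hAψ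
    hr (hBi j k), ← integral_neg]

/-! ### The virial identity, component by component -/

theorem tendsto_integral_fderiv_cutoff_weight (hd : 0 < d) {w F : Space d → ℝ}
    (hw : ContDiffOn ℝ ∞ w {0}ᶜ) (j : Fin d)
    (h1 : Integrable (fun x => fderiv ℝ w x (basisVec j) * F x) volume)
    (h2 : Integrable (fun x => ‖x‖⁻¹ * (w x * F x)) volume) :
    Tendsto (fun n => ∫ x, fderiv ℝ (fun x => cutoff d n x * w x) x (basisVec j) * F x) atTop
      (𝓝 (∫ x, fderiv ℝ w x (basisVec j) * F x)) := by
  have h := (tendsto_integral_fderiv_cutoff_mul hd h2 j).add (tendsto_integral_cutoff_mul hd h1)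
  rw [zero_add] at h
  refine h.congr fun n => ?_
  rw [← integral_add (integrable_fderiv_cutoff_mul hd h2 n j) (integrable_cutoff_mul h1 n)]
  refine integral_congr_ae ?_
  filter_upwards [ae_ne_zero hd] with x hx
  rw [fderiv_cutoff_mul hw n hx]; ring

theorem integrable_inner_of_memLp {f g : Space d → Spinor d} (hf : MemLp f 2 volume)
    (hg : MemLp g 2 volume) : Integrable (fun x => inner ℝ (f x) (g x)) volume := by
  simpa using integrable_inner_act hf hg (ContinuousLinearMap.id ℂ _) (memLp_top_const (1 : ℝ))

theorem integrable_mul_inner {f g : Space d → Spinor d} {w : Space d → ℝ}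
    (hw : MemLp w ∞ volume) (hf : MemLp f 2 volume)
    (hg : MemLp g 2 volume) : Integrable (fun x => w x * inner ℝ (f x) (g x)) volume := by
  simpa using integrable_inner_act hf hg (ContinuousLinearMap.id ℂ _) hw

/-- Integrability of `W Re⟨f, g⟩` when `|W| ‖f‖ ‖g‖` is dominated by a product of two square
integrable functions. -/
theorem integrable_mul_inner_of_le {f g : Space d → Spinor d} {w p q : Space d → ℝ}
    (hw : AEStronglyMeasurable w volume) (hf : MemLp f 2 volume) (hg : MemLp g 2 volume)
    (hp : MemLp p 2 volume) (hq : MemLp q 2 volume)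
    (h : ∀ᵐ x, |w x| * (‖f x‖ * ‖g x‖) ≤ p x * q x) :
    Integrable (fun x => w x * inner ℝ (f x) (g x)) volume := by
  refine integrable_of_abs_le_mul hp hq
    (hw.mul (hf.aestronglyMeasurable.inner hg.aestronglyMeasurable)) ?_
  filter_upwards [h] with x hx
  rw [abs_mul]
  exact (mul_le_mul_of_nonneg_left (abs_real_inner_le_norm _ _) (abs_nonneg _)).trans hx

theorem contDiffOn_coord_mul {w : Space d → ℝ} (hw : ContDiffOn ℝ ∞ w {0}ᶜ) (k : Fin d) :
    ContDiffOn ℝ ∞ (fun x => x k * w x) {0}ᶜ := (contDiff_coord k).contDiffOn.mul hw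

theorem fderiv_coord_mul {w : Space d → ℝ} (hw : ContDiffOn ℝ ∞ w {0}ᶜ) {x : Space d} (hx : x ≠ 0)
    (k : Fin d) : fderiv ℝ (fun x : Space d => x k * w x) x (basisVec k)
      = w x + x k * fderiv ℝ w x (basisVec k) := by
  have h1 : DifferentiableAt ℝ w x :=
    (hw.contDiffAt (isOpen_compl_singleton.mem_nhds hx)).differentiableAt (by simp)
  have h2 : DifferentiableAt ℝ (fun x : Space d => x k) x :=
    (contDiff_coord k).differentiable (by simp) x
  rw [fderiv_fun_mul h2 h1]
  simp only [add_apply, smul_apply, smul_eq_mul, fderiv_coord, if_true]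
  ring

theorem sum_inner_I_smul_alpha {α : Fin d → SpinorMatrix d} {β : SpinorMatrix d}
    (h : IsDiracMatrices α β) (A : Space d → Space d) (ψ : H1 d) (x : Space d) (u : Spinor d) :
    ∑ j, inner ℝ (magneticDeriv A j ψ x) (Complex.I • act (α j) u)
      = inner ℝ (diracDeriv α A ψ x) u := by
  rw [diracDeriv, sum_inner]
  refine Finset.sum_congr rfl fun j _ => ?_
  rw [neg_smul, inner_neg_left, real_inner_I_smul_left, neg_neg, ← map_smul,
    real_inner_act_left (h.hermitian_alpha j)]

theorem sum_inner_I_smul_alpha_right (α : Fin d → SpinorMatrix d)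
    (A : Space d → Space d) (ψ : H1 d) (x : Space d) (u : Spinor d) :
    ∑ j, inner ℝ u (Complex.I • act (α j) (magneticDeriv A j ψ x))
      = -inner ℝ u (diracDeriv α A ψ x) := by
  rw [diracDeriv_eq, inner_neg_right, neg_neg, Finset.smul_sum, inner_sum]

/-- One component of the virial identity, tested against the cut off dilation field. -/
theorem virial_component_cutoff {α : Fin d → SpinorMatrix d} {β : SpinorMatrix d}
    (h : IsDiracMatrices α β) {A : Space d → Space d} {B : Space d → Matrix (Fin d) (Fin d) ℝ}
    (hA : MemL2Loc A) (hB : ∀ j k, MemL2Loc (fun x => B x j k)) (hAB : IsMagneticField A B)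
    {ψ : H1 d} (hAψ : ∀ i, MemLp (fun x => A x i • (ψ : SpinorL2 d) x) 2 volume)
    (hBψ : ∀ j k, Integrable (fun x => B x j k * ‖(ψ : SpinorL2 d) x‖ ^ 2) volume)
    {w : Space d → ℝ} (hw : ContDiffOn ℝ ∞ w {0}ᶜ) {z : ℝ}
    (heq : ∀ᵐ x, diracDeriv α A ψ x + w x • act β ((ψ : SpinorL2 d) x)
      = z • (ψ : SpinorL2 d) x) (k : Fin d) (n : ℕ) :
    -(z * ∫ x, fderiv ℝ (fun x => cutoff d n x * x k) x (basisVec k) * ‖(ψ : SpinorL2 d) x‖ ^ 2)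
      + ∫ x, fderiv ℝ (fun x => cutoff d n x * (x k * w x)) x (basisVec k)
        * inner ℝ ((ψ : SpinorL2 d) x) (act β ((ψ : SpinorL2 d) x))
      = -(∑ j, ∫ x, fderiv ℝ (fun x => cutoff d n x * x k) x (basisVec j)
          * inner ℝ ((ψ : SpinorL2 d) x) (Complex.I • act (α j) (magneticDeriv A k ψ x)))
        - (∫ x, fderiv ℝ (fun x => cutoff d n x * x k) x (basisVec k)
          * inner ℝ ((ψ : SpinorL2 d) x) (diracDeriv α A ψ x))
        - ∑ j, ∫ x, cutoff d n x * x k * B x j k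
          * inner ℝ ((ψ : SpinorL2 d) x) (act (α j) ((ψ : SpinorL2 d) x)) := by
  have hu := Lp.memLp (ψ : SpinorL2 d)
  have hD := fun j => memLp_magneticDeriv (hAψ j)
  set g : Space d → ℝ := fun x => cutoff d n x * x k with hg
  have hck := (contDiff_coord (d := d) k).contDiffOn (s := {0}ᶜ)
  have hgs : ContDiff ℝ ∞ g := contDiff_cutoff_mul hck n
  have hgc : HasCompactSupport g := hasCompactSupport_cutoff_mul _ n
  have hg2 : MemLp g ∞ volume := memLp_top_of_hasCompactSupport hgs.continuous hgc
  set g' : Space d → ℝ := fun x => cutoff d n x * (x k * w x) with hg'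
  have hgs' : ContDiff ℝ ∞ g' := contDiff_cutoff_mul (contDiffOn_coord_mul hw k) n
  have hgc' : HasCompactSupport g' := hasCompactSupport_cutoff_mul _ n
  have hg2' : MemLp g' ∞ volume := memLp_top_of_hasCompactSupport hgs'.continuous hgc'
  -- The commutator identity with Γ = α_j and weight χ_n x_k, summed over j. The sum reassembles Tψ,
  -- so the commutator of T with the dilation generator is obtained without ever differentiating Tψ.
  have key := Finset.sum_congr (rfl : (Finset.univ : Finset (Fin d)) = _) fun j _ =>
    integral_mul_inner_magneticDeriv_antisymm hA hB hAB (h.hermitian_alpha j) hgs hgc ψ j k hAψ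
      (((hBψ j k).mul_of_top_right hg2).congr (Eventually.of_forall fun x => by
        simp only [Pi.mul_apply]; ring))
  rw [Finset.sum_sub_distrib, Finset.sum_add_distrib, Finset.sum_neg_distrib] at key
  have e1 : ∑ j, ∫ x, fderiv ℝ g x (basisVec k)
      * inner ℝ ((ψ : SpinorL2 d) x) (Complex.I • act (α j) (magneticDeriv A j ψ x))
      = -∫ x, fderiv ℝ g x (basisVec k)
        * inner ℝ ((ψ : SpinorL2 d) x) (diracDeriv α A ψ x) := by
    have i1 : ∀ j, Integrable (fun x => fderiv ℝ g x (basisVec k)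
        * inner ℝ ((ψ : SpinorL2 d) x) (Complex.I • act (α j) (magneticDeriv A j ψ x))) volume :=
      fun j => integrable_inner_act hu (hD j) (Complex.I • act (α j))
        (memLp_top_partial hgs hgc (basisVec k))
    rw [← integral_finsetSum _ fun j _ => i1 j, ← integral_neg]
    refine integral_congr_ae (Eventually.of_forall fun x => ?_)
    simp only [← Finset.mul_sum, sum_inner_I_smul_alpha_right, mul_neg]
  -- The left side is 2g Re⟨Tψ, ∂_k^A ψ⟩. Replacing Tψ by zψ − wβψ turns it into two terms that are
  -- both derivatives of quadratic forms, with matrices 1 and β.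
  have e2 : ∑ j, ∫ x, g x * (2 * inner ℝ (magneticDeriv A j ψ x)
        (Complex.I • act (α j) (magneticDeriv A k ψ x)))
      = -(z * ∫ x, fderiv ℝ g x (basisVec k) * ‖(ψ : SpinorL2 d) x‖ ^ 2)
      + ∫ x, fderiv ℝ g' x (basisVec k)
        * inner ℝ ((ψ : SpinorL2 d) x) (act β ((ψ : SpinorL2 d) x)) := by
    have a1 := integral_mul_inner_magneticDeriv A isHermitian_one hgs hgc ψ k
    have a2 := integral_mul_inner_magneticDeriv A h.hermitian_beta hgs' hgc' ψ k
    simp only [act_one, real_inner_self_eq_norm_sq] at a1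
    rw [← mul_neg, ← a1, ← sub_neg_eq_add _ (∫ x, fderiv ℝ g' x (basisVec k) * _), ← a2,
      ← integral_const_mul, ← integral_sub, ← integral_finsetSum]
    · refine integral_congr_ae ?_
      filter_upwards [heq] with x hx
      rw [← Finset.mul_sum, ← Finset.mul_sum, sum_inner_I_smul_alpha h, eq_sub_of_add_eq hx,
        inner_sub_left, real_inner_smul_left, real_inner_smul_left,
        real_inner_act_left h.hermitian_beta]
      simp only [hg, hg']; ring
    · intro j _
      have := (integrable_inner_act (hD j) (hD k) (Complex.I • act (α j)) hg2).const_mul 2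
      refine this.congr (Eventually.of_forall fun x => ?_)
      simp only [smul_apply]; ring
    · refine (((integrable_mul_inner hg2 hu (hD k)).const_mul 2).const_mul z).congr
        (Eventually.of_forall fun x => ?_)
      simp only; ring
    · refine ((integrable_inner_act hu (hD k) (act β) hg2').const_mul 2).congr
        (Eventually.of_forall fun x => ?_)
      simp only; ring
  rw [e1, e2] at key
  rw [key]; ring

/-- A weighted quadratic form is integrable when the weighted square of the norm is. -/
theorem integrable_mul_inner_act_self {u : Space d → Spinor d} (hu : AEStronglyMeasurable u volume)
    {w : Space d → ℝ} (hw : AEStronglyMeasurable w volume)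
    (h : Integrable (fun x => w x * ‖u x‖ ^ 2) volume) (L : Spinor d →L[ℂ] Spinor d) :
    Integrable (fun x => w x * inner ℝ (u x) (L (u x))) volume := by
  refine (h.norm.mul_const ‖L‖).mono' (hw.mul (hu.inner
    (L.continuous.comp_aestronglyMeasurable hu))) (Eventually.of_forall fun x => ?_)
  rw [norm_mul, norm_mul, mul_assoc]
  gcongr
  refine (abs_real_inner_le_norm _ _).trans ?_
  rw [norm_pow, norm_norm, sq, mul_assoc]
  gcongr
  rw [mul_comm]
  exact L.le_opNorm _

theorem abs_coord_le (x : Space d) (j : Fin d) : |x j| ≤ ‖x‖ := PiLp.norm_apply_le x j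

/-- Let the cutoff tend to 1. The derivative of the weight x_k is δ_{jk}, so one term of the sum
over j survives; the weight x_k w gives w + x_k ∂_k w. -/
theorem virial_component (hd : 0 < d) {α : Fin d → SpinorMatrix d} {β : SpinorMatrix d}
    (h : IsDiracMatrices α β) {A : Space d → Space d} {B : Space d → Matrix (Fin d) (Fin d) ℝ}
    (hA : MemL2Loc A) (hB : ∀ j k, MemL2Loc (fun x => B x j k)) (hAB : IsMagneticField A B)
    {ψ : H1 d} (hAψ : ∀ i, MemLp (fun x => A x i • (ψ : SpinorL2 d) x) 2 volume)
    (hr : MemLp (fun x => ‖x‖⁻¹ • (ψ : SpinorL2 d) x) 2 volume)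
    (hBψ : MemLp (fun x => ‖x‖ * matrixNorm (B x) * ‖(ψ : SpinorL2 d) x‖) 2 volume)
    {w : Space d → ℝ} (hw : ContDiffOn ℝ ∞ w {0}ᶜ)
    (hwψ : MemLp (fun x => |w x| * ‖(ψ : SpinorL2 d) x‖) 2 volume)
    (hw'ψ : MemLp (fun x => ‖x‖ * ‖fderiv ℝ w x‖ * ‖(ψ : SpinorL2 d) x‖) 2 volume) {z : ℝ}
    (heq : ∀ᵐ x, diracDeriv α A ψ x + w x • act β ((ψ : SpinorL2 d) x)
      = z • (ψ : SpinorL2 d) x) (k : Fin d) :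
    -(z * ∫ x, ‖(ψ : SpinorL2 d) x‖ ^ 2)
      + ∫ x, (w x + x k * fderiv ℝ w x (basisVec k))
        * inner ℝ ((ψ : SpinorL2 d) x) (act β ((ψ : SpinorL2 d) x))
      = -(∫ x, inner ℝ ((ψ : SpinorL2 d) x) (Complex.I • act (α k) (magneticDeriv A k ψ x)))
        - (∫ x, inner ℝ ((ψ : SpinorL2 d) x) (diracDeriv α A ψ x))
        - ∑ j, ∫ x, x k * B x j k
          * inner ℝ ((ψ : SpinorL2 d) x) (act (α j) ((ψ : SpinorL2 d) x)) := by
  have hu := Lp.memLp (ψ : SpinorL2 d)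
  have hD := fun j => memLp_magneticDeriv (hAψ j)
  have hT : MemLp (diracDeriv α A ψ) 2 volume :=
    memLp_finsetSum _ fun j _ => (memLp_act (hD j) (act (α j))).const_smul (-Complex.I)
  have hck := (contDiff_coord (d := d) k).contDiffOn (s := {0}ᶜ)
  have hwm : AEStronglyMeasurable w volume := aestronglyMeasurable_of_continuousOn hd hw.continuousOn
  have hw'm : AEStronglyMeasurable (fun x => fderiv ℝ w x (basisVec k)) volume :=
    aestronglyMeasurable_of_continuousOn hd ((contDiffOn_fderiv hw).clm_apply continuousOn_const)
  have hxm : AEStronglyMeasurable (fun x : Space d => x k) volume :=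
    (contDiff_coord k).continuous.aestronglyMeasurable
  have hBi := integrable_magneticField_mul_norm_sq hd hB hr hBψ
  have coord : ∀ F : Space d → ℝ, Integrable F volume → ∀ j,
      Tendsto (fun n => ∫ x, fderiv ℝ (fun x => cutoff d n x * x k) x (basisVec j) * F x) atTop
        (𝓝 (∫ x, (if j = k then 1 else 0) * F x)) := by
    intro F hF j
    have := tendsto_integral_fderiv_cutoff_weight (F := F) hd hck j ?_ ?_
    · simpa only [fderiv_coord] using this
    · simp only [fderiv_coord]; exact hF.const_mul _
    · refine hF.mono (measurable_norm.inv.aestronglyMeasurable.mul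
        (hxm.mul hF.aestronglyMeasurable)) ?_
      filter_upwards [ae_ne_zero hd] with x hx
      have hx1 := norm_pos_iff.mpr hx
      rw [norm_mul, norm_mul, ← mul_assoc, norm_inv, norm_norm]
      refine mul_le_of_le_one_left (norm_nonneg _) ?_
      rw [inv_mul_le_one₀ hx1]
      exact abs_coord_le x k
  have iw : Integrable (fun x => w x * ‖(ψ : SpinorL2 d) x‖ ^ 2) volume := by
    refine integrable_of_abs_le_mul hwψ hu.norm
      (hwm.mul (hu.aestronglyMeasurable.norm.pow 2)) (Eventually.of_forall fun x => ?_)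
    rw [abs_mul, abs_of_nonneg (sq_nonneg ‖(ψ : SpinorL2 d) x‖)]
    exact le_of_eq (by ring)
  have iw' : Integrable (fun x => (w x + x k * fderiv ℝ w x (basisVec k))
      * ‖(ψ : SpinorL2 d) x‖ ^ 2) volume := by
    have : Integrable (fun x => x k * fderiv ℝ w x (basisVec k) * ‖(ψ : SpinorL2 d) x‖ ^ 2)
        volume := by
      refine integrable_of_abs_le_mul hw'ψ hu.norm
        ((hxm.mul hw'm).mul (hu.aestronglyMeasurable.norm.pow 2)) (Eventually.of_forall fun x => ?_)
      rw [abs_mul, abs_mul, abs_of_nonneg (sq_nonneg ‖(ψ : SpinorL2 d) x‖)]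
      calc |x k| * |fderiv ℝ w x (basisVec k)| * ‖(ψ : SpinorL2 d) x‖ ^ 2
          ≤ ‖x‖ * ‖fderiv ℝ w x‖ * ‖(ψ : SpinorL2 d) x‖ ^ 2 := by
            gcongr
            · exact abs_coord_le x k
            · exact abs_fderiv_basisVec_le w x k
        _ = _ := by ring
    exact (iw.add this).congr (Eventually.of_forall fun x => by simp only [Pi.add_apply]; ring)
  have L1 := ((coord _ hu.norm.integrable_sq k).const_mul z).neg
  have iwβ : Integrable (fun x => fderiv ℝ (fun x : Space d => x k * w x) x (basisVec k)
      * inner ℝ ((ψ : SpinorL2 d) x) (act β ((ψ : SpinorL2 d) x))) volume := by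
    refine (integrable_mul_inner_act_self hu.aestronglyMeasurable (hwm.add (hxm.mul hw'm)) iw'
      (act β)).congr ?_
    filter_upwards [ae_ne_zero hd] with x hx
    rw [fderiv_coord_mul hw hx]; rfl
  have L2 := tendsto_integral_fderiv_cutoff_weight hd (contDiffOn_coord_mul hw k) k iwβ (by
    refine (integrable_mul_inner_act_self hu.aestronglyMeasurable hwm iw (act β)).mono
      (measurable_norm.inv.aestronglyMeasurable.mul ((hxm.mul hwm).mul
        (hu.aestronglyMeasurable.inner (memLp_act hu (act β)).aestronglyMeasurable))) ?_
    filter_upwards [ae_ne_zero hd] with x hx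
    have hx1 := norm_pos_iff.mpr hx
    rw [mul_assoc (x k), norm_mul, norm_mul (x k), ← mul_assoc, norm_inv, norm_norm]
    refine mul_le_of_le_one_left (norm_nonneg _) ?_
    rw [inv_mul_le_one₀ hx1]
    exact abs_coord_le x k)
  have L3 := (tendsto_finsetSum Finset.univ fun j _ => coord _
    (integrable_inner_of_memLp hu ((memLp_act (hD k) (act (α j))).const_smul Complex.I)) j).neg
  have L4 := coord _ (integrable_inner_of_memLp hu hT) k
  have i5 : ∀ j, Integrable (fun x => x k * B x j k
      * inner ℝ ((ψ : SpinorL2 d) x) (act (α j) ((ψ : SpinorL2 d) x))) volume := by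
    intro j
    refine integrable_mul_inner_act_self hu.aestronglyMeasurable
      (hxm.mul (hB j k).aestronglyMeasurable) ?_ (act (α j))
    refine integrable_of_abs_le_mul hBψ hu.norm ((hxm.mul (hB j k).aestronglyMeasurable).mul
      (hu.aestronglyMeasurable.norm.pow 2)) (Eventually.of_forall fun x => ?_)
    rw [abs_mul, Pi.mul_apply, abs_mul, abs_of_nonneg (sq_nonneg ‖(ψ : SpinorL2 d) x‖)]
    calc |x k| * |B x j k| * ‖(ψ : SpinorL2 d) x‖ ^ 2
        ≤ ‖x‖ * matrixNorm (B x) * ‖(ψ : SpinorL2 d) x‖ ^ 2 := by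
          gcongr
          · exact abs_coord_le x k
          · exact abs_apply_le_matrixNorm _ _ _
      _ = _ := by ring
  have L5 := tendsto_finsetSum Finset.univ fun j _ => tendsto_integral_cutoff_mul hd (i5 j)
  have key := tendsto_nhds_unique (L1.add L2) (((L3.sub L4).sub L5).congr fun n => by
    have := virial_component_cutoff h hA hB hAB hAψ hBi hw heq k n
    simp only [mul_assoc] at this ⊢
    exact this.symm)
  simp only [if_true, one_mul, ite_mul, zero_mul] at key
  rw [Finset.sum_eq_single k (fun j _ hj => by simp [hj]) (by simp)] at key
  simp only [if_true] at key
  rw [← Pi.neg_apply] at key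
  have e : ∫ x, (w x + x k * fderiv ℝ w x (basisVec k))
        * inner ℝ ((ψ : SpinorL2 d) x) (act β ((ψ : SpinorL2 d) x))
      = ∫ x, fderiv ℝ (fun x : Space d => x k * w x) x (basisVec k)
        * inner ℝ ((ψ : SpinorL2 d) x) (act β ((ψ : SpinorL2 d) x)) := by
    refine integral_congr_ae ?_
    filter_upwards [ae_ne_zero hd] with x hx
    rw [fderiv_coord_mul hw hx]
  rw [e]
  exact key

theorem fderiv_apply_self (w : Space d → ℝ) (x : Space d) :
    fderiv ℝ w x x = ∑ k, x k * fderiv ℝ w x (basisVec k) := by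
  have hx : x = ∑ k, x k • basisVec k := by
    ext i
    simp [Finset.sum_apply, basisVec, Pi.single_apply]
  have h := congrArg (fderiv ℝ w x) hx
  rw [map_sum] at h
  simpa only [map_smul, smul_eq_mul] using h

/-- The vector `B(x) x`. -/
def dilationField (B : Space d → Matrix (Fin d) (Fin d) ℝ) (x : Space d) : Space d :=
  Matrix.toEuclideanCLM (n := Fin d) (𝕜 := ℝ) (B x) x

theorem clifford_dilationField (α : Fin d → SpinorMatrix d)
    (B : Space d → Matrix (Fin d) (Fin d) ℝ) (x : Space d) (u : Spinor d) :
    clifford α (dilationField B x) u = ∑ k, ∑ j, (x k * B x j k) • act (α j) u := by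
  rw [clifford_apply, Finset.sum_comm]
  refine Finset.sum_congr rfl fun j _ => ?_
  rw [← Finset.sum_smul, dilationField, Matrix.ofLp_toEuclideanCLM]
  congr 1
  change ∑ k, B x j k * x k = _
  exact Finset.sum_congr rfl fun k _ => mul_comm _ _

theorem norm_dilationField_le (B : Space d → Matrix (Fin d) (Fin d) ℝ) (x : Space d) :
    ‖dilationField B x‖ ≤ ‖x‖ * matrixNorm (B x) :=
  (ContinuousLinearMap.le_opNorm _ _).trans_eq (mul_comm _ _)

theorem abs_fderiv_apply_self_le (w : Space d → ℝ) (x : Space d) :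
    |fderiv ℝ w x x| ≤ ‖x‖ * ‖fderiv ℝ w x‖ :=
  ((fderiv ℝ w x).le_opNorm x).trans_eq (mul_comm _ _)

/-! ### Integral identities for bound states -/

/-- A bound state of the Dirac operator `-i α · ∇_A + w β` with the energies that enter the method
of multipliers being finite. -/
structure IsBoundState (α : Fin d → SpinorMatrix d) (β : SpinorMatrix d) (A : Space d → Space d)
    (B : Space d → Matrix (Fin d) (Fin d) ℝ) (w : Space d → ℝ) (z : ℝ) (ψ : H1 d) : Prop where
  dirac : IsDiracMatrices α β
  memL2Loc_A : MemL2Loc A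
  memL2Loc_B : ∀ j k, MemL2Loc (fun x => B x j k)
  magnetic : IsMagneticField A B
  memLp_A : ∀ i, MemLp (fun x => A x i • (ψ : SpinorL2 d) x) 2 volume
  memLp_B : MemLp (fun x => ‖x‖ * matrixNorm (B x) * ‖(ψ : SpinorL2 d) x‖) 2 volume
  contDiffOn : ContDiffOn ℝ ∞ w {0}ᶜ
  memLp_w : MemLp (fun x => |w x| * ‖(ψ : SpinorL2 d) x‖) 2 volume
  memLp_fderiv : MemLp (fun x => ‖x‖ * ‖fderiv ℝ w x‖ * ‖(ψ : SpinorL2 d) x‖) 2 volume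
  eigen : ∀ᵐ x, diracDeriv α A ψ x + w x • act β ((ψ : SpinorL2 d) x) = z • (ψ : SpinorL2 d) x

namespace IsBoundState

variable {α : Fin d → SpinorMatrix d} {β : SpinorMatrix d} {A : Space d → Space d}
  {B : Space d → Matrix (Fin d) (Fin d) ℝ} {w : Space d → ℝ} {z : ℝ} {ψ : H1 d}

theorem memLp_D (S : IsBoundState α β A B w z ψ) (j : Fin d) :
    MemLp (magneticDeriv A j ψ) 2 volume := memLp_magneticDeriv (S.memLp_A j)

theorem memLp_T (S : IsBoundState α β A B w z ψ) : MemLp (diracDeriv α A ψ) 2 volume :=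
  memLp_finsetSum _ fun j _ => (memLp_act (S.memLp_D j) (act (α j))).const_smul (-Complex.I)

theorem aestronglyMeasurable_w (S : IsBoundState α β A B w z ψ) (hd : 0 < d) :
    AEStronglyMeasurable w volume :=
  aestronglyMeasurable_of_continuousOn hd S.contDiffOn.continuousOn

theorem aestronglyMeasurable_fderiv (S : IsBoundState α β A B w z ψ) (hd : 0 < d) :
    AEStronglyMeasurable (fderiv ℝ w) volume :=
  aestronglyMeasurable_of_continuousOn hd (contDiffOn_fderiv S.contDiffOn)

theorem aestronglyMeasurable_partial (S : IsBoundState α β A B w z ψ) (hd : 0 < d) (j : Fin d) :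
    AEStronglyMeasurable (fun x => fderiv ℝ w x (basisVec j)) volume :=
  aestronglyMeasurable_of_continuousOn hd
    ((contDiffOn_fderiv S.contDiffOn).clm_apply continuousOn_const)

theorem aestronglyMeasurable_radial (S : IsBoundState α β A B w z ψ) (hd : 0 < d) :
    AEStronglyMeasurable (fun x => fderiv ℝ w x x) volume :=
  aestronglyMeasurable_of_continuousOn hd
    ((contDiffOn_fderiv S.contDiffOn).clm_apply continuousOn_id)

theorem integrable_w (S : IsBoundState α β A B w z ψ) (hd : 0 < d) {f : Space d → Spinor d}
    (hf : MemLp f 2 volume) :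
    Integrable (fun x => w x * inner ℝ (act β ((ψ : SpinorL2 d) x)) (f x)) volume := by
  refine integrable_mul_inner_of_le (S.aestronglyMeasurable_w hd)
    (memLp_act (Lp.memLp (ψ : SpinorL2 d)) (act β)) hf S.memLp_w hf.norm
    (Eventually.of_forall fun x => ?_)
  rw [norm_act_beta S.dirac, mul_assoc]

theorem integrable_radial (S : IsBoundState α β A B w z ψ) (hd : 0 < d) {f : Space d → Spinor d}
    (hf : MemLp f 2 volume) :
    Integrable (fun x => fderiv ℝ w x x * inner ℝ (f x) (act β ((ψ : SpinorL2 d) x)))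
      volume := by
  refine integrable_mul_inner_of_le (S.aestronglyMeasurable_radial hd) hf
    (memLp_act (Lp.memLp (ψ : SpinorL2 d)) (act β)) S.memLp_fderiv hf.norm
    (Eventually.of_forall fun x => ?_)
  rw [norm_act_beta S.dirac, mul_comm ‖f x‖, ← mul_assoc]
  gcongr
  exact abs_fderiv_apply_self_le w x

theorem integrable_radial_w (S : IsBoundState α β A B w z ψ) (hd : 0 < d) :
    Integrable (fun x => fderiv ℝ w x x * (w x * ‖(ψ : SpinorL2 d) x‖ ^ 2)) volume := by
  refine integrable_of_abs_le_mul S.memLp_fderiv S.memLp_w ((S.aestronglyMeasurable_radial hd).mul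
    ((S.aestronglyMeasurable_w hd).mul
      ((Lp.memLp (ψ : SpinorL2 d)).aestronglyMeasurable.norm.pow 2)))
    (Eventually.of_forall fun x => ?_)
  rw [abs_mul, abs_mul, abs_of_nonneg (sq_nonneg ‖(ψ : SpinorL2 d) x‖)]
  calc |fderiv ℝ w x x| * (|w x| * ‖(ψ : SpinorL2 d) x‖ ^ 2)
      ≤ ‖x‖ * ‖fderiv ℝ w x‖ * (|w x| * ‖(ψ : SpinorL2 d) x‖ ^ 2) := by
        gcongr
        exact abs_fderiv_apply_self_le w x
    _ = _ := by ring

theorem integrable_coord_B (S : IsBoundState α β A B w z ψ) (j k : Fin d) {f : Space d → Spinor d}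
    (hf : MemLp f 2 volume) :
    Integrable (fun x => x k * B x j k * inner ℝ (f x) (act (α j) ((ψ : SpinorL2 d) x)))
      volume := by
  refine integrable_mul_inner_of_le
    (((contDiff_coord k).continuous.aestronglyMeasurable).mul
      (S.memL2Loc_B j k).aestronglyMeasurable) hf
    (memLp_act (Lp.memLp (ψ : SpinorL2 d)) (act (α j))) S.memLp_B hf.norm
    (Eventually.of_forall fun x => ?_)
  rw [norm_act_alpha S.dirac, abs_mul, mul_comm ‖f x‖, ← mul_assoc]
  gcongr
  · exact abs_coord_le x k
  · exact abs_apply_le_matrixNorm _ _ _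

theorem inner_clifford_dilationField (x : Space d) (u f : Spinor d) :
    inner ℝ f (clifford α (dilationField B x) u)
      = ∑ k, ∑ j, x k * B x j k * inner ℝ f (act (α j) u) := by
  simp only [clifford_dilationField, inner_sum, real_inner_smul_right]

theorem integrable_dilationField (S : IsBoundState α β A B w z ψ) {f : Space d → Spinor d}
    (hf : MemLp f 2 volume) :
    Integrable (fun x => inner ℝ (f x) (clifford α (dilationField B x) ((ψ : SpinorL2 d) x)))
      volume := by
  simp only [inner_clifford_dilationField]
  exact integrable_finsetSum _ fun k _ => integrable_finsetSum _ fun j _ =>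
    S.integrable_coord_B j k hf

theorem memLp_inv_norm (S : IsBoundState α β A B w z ψ) (hd : 3 ≤ d) :
    MemLp (fun x => ‖x‖⁻¹ * ‖(ψ : SpinorL2 d) x‖) 2 volume :=
  memLp_inv_norm_mul (memLp_inv_norm_smul hd A ψ S.memLp_D)

/-- The virial identity. -/
theorem virial (S : IsBoundState α β A B w z ψ) (hd : 3 ≤ d) :
    ∫ x, inner ℝ ((ψ : SpinorL2 d) x) (diracDeriv α A ψ x)
      = (∫ x, inner ℝ ((ψ : SpinorL2 d) x) (clifford α (dilationField B x) ((ψ : SpinorL2 d) x)))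
        + ∫ x, fderiv ℝ w x x * inner ℝ ((ψ : SpinorL2 d) x) (act β ((ψ : SpinorL2 d) x)) := by
  have hd0 : 0 < d := by omega
  have hu := Lp.memLp (ψ : SpinorL2 d)
  have hT := S.memLp_T
  have hs := Finset.sum_congr (rfl : (Finset.univ : Finset (Fin d)) = _) fun k _ =>
    virial_component hd0 S.dirac S.memL2Loc_A S.memL2Loc_B S.magnetic S.memLp_A
      (memLp_inv_norm_smul hd A ψ S.memLp_D) S.memLp_B S.contDiffOn S.memLp_w S.memLp_fderiv
      S.eigen k
  simp only [Finset.sum_add_distrib, Finset.sum_sub_distrib, Finset.sum_neg_distrib,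
    Finset.sum_const, Finset.card_univ, Fintype.card_fin, nsmul_eq_mul] at hs
  have iw := S.integrable_w hd0 hu
  simp only [real_inner_act_left S.dirac.hermitian_beta] at iw
  have ip : ∀ k : Fin d, Integrable (fun x => x k * fderiv ℝ w x (basisVec k)
      * inner ℝ ((ψ : SpinorL2 d) x) (act β ((ψ : SpinorL2 d) x))) volume := by
    intro k
    refine integrable_mul_inner_of_le
      (((contDiff_coord k).continuous.aestronglyMeasurable).mul
        (S.aestronglyMeasurable_partial hd0 k)) hu (memLp_act hu (act β)) S.memLp_fderiv hu.norm
      (Eventually.of_forall fun x => ?_)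
    rw [norm_act_beta S.dirac, abs_mul, ← mul_assoc]
    gcongr
    · exact abs_coord_le x k
    · exact abs_fderiv_basisVec_le w x k
  have e1 : ∑ k, ∫ x, (w x + x k * fderiv ℝ w x (basisVec k))
        * inner ℝ ((ψ : SpinorL2 d) x) (act β ((ψ : SpinorL2 d) x))
      = d * (∫ x, w x * inner ℝ ((ψ : SpinorL2 d) x) (act β ((ψ : SpinorL2 d) x)))
        + ∫ x, fderiv ℝ w x x * inner ℝ ((ψ : SpinorL2 d) x) (act β ((ψ : SpinorL2 d) x)) := by
    simp only [add_mul]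
    rw [Finset.sum_congr rfl fun k _ => integral_add iw (ip k), Finset.sum_add_distrib,
      Finset.sum_const, Finset.card_univ, Fintype.card_fin, nsmul_eq_mul,
      ← integral_finsetSum _ fun k _ => ip k]
    simp only [fderiv_apply_self, Finset.sum_mul]
  have i2 : ∀ k, Integrable (fun x => inner ℝ ((ψ : SpinorL2 d) x)
      (Complex.I • act (α k) (magneticDeriv A k ψ x))) volume := fun k =>
    integrable_inner_of_memLp hu ((memLp_act (S.memLp_D k) (act (α k))).const_smul Complex.I)
  have e2 : ∑ k, ∫ x, inner ℝ ((ψ : SpinorL2 d) x)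
      (Complex.I • act (α k) (magneticDeriv A k ψ x))
      = -∫ x, inner ℝ ((ψ : SpinorL2 d) x) (diracDeriv α A ψ x) := by
    rw [← integral_finsetSum _ fun k _ => i2 k]
    simp only [sum_inner_I_smul_alpha_right]
    rw [integral_neg]
  have e3 : ∑ k, ∑ j, ∫ x, x k * B x j k
        * inner ℝ ((ψ : SpinorL2 d) x) (act (α j) ((ψ : SpinorL2 d) x))
      = ∫ x, inner ℝ ((ψ : SpinorL2 d) x)
        (clifford α (dilationField B x) ((ψ : SpinorL2 d) x)) := by
    simp only [inner_clifford_dilationField]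
    rw [integral_finsetSum _ fun k _ => integrable_finsetSum _ fun j _ =>
      S.integrable_coord_B j k hu]
    exact Finset.sum_congr rfl fun k _ =>
      (integral_finsetSum _ fun j _ => S.integrable_coord_B j k hu).symm
  -- The equation tested against ψ. It cancels all terms carrying the dimension d after summation
  -- over k, leaving one copy of ⟨ψ,Tψ⟩.
  have e4 : z * ∫ x, ‖(ψ : SpinorL2 d) x‖ ^ 2
      = (∫ x, inner ℝ ((ψ : SpinorL2 d) x) (diracDeriv α A ψ x))
        + ∫ x, w x * inner ℝ ((ψ : SpinorL2 d) x) (act β ((ψ : SpinorL2 d) x)) := by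
    rw [← integral_const_mul, ← integral_add (integrable_inner_of_memLp hu hT) iw]
    refine integral_congr_ae ?_
    filter_upwards [S.eigen] with x hx
    rw [← real_inner_self_eq_norm_sq, ← real_inner_smul_right, ← hx, inner_add_right,
      real_inner_smul_right]
  rw [e1, e2, e3, e4] at hs
  linarith

/-- The virial identity after multiplication by the eigenvalue. -/
theorem virial_eigen (S : IsBoundState α β A B w z ψ) (hd : 3 ≤ d) :
    (∫ x, ‖diracDeriv α A ψ x‖ ^ 2)
        + ∫ x, w x * inner ℝ (act β ((ψ : SpinorL2 d) x)) (diracDeriv α A ψ x)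
      = (∫ x, inner ℝ (diracDeriv α A ψ x)
          (clifford α (dilationField B x) ((ψ : SpinorL2 d) x)))
        + ((∫ x, fderiv ℝ w x x * inner ℝ (diracDeriv α A ψ x) (act β ((ψ : SpinorL2 d) x)))
          + ∫ x, fderiv ℝ w x x * (w x * ‖(ψ : SpinorL2 d) x‖ ^ 2)) := by
  have hd0 : 0 < d := by omega
  have hT := S.memLp_T
  have hv := congrArg (fun t => z * t) (S.virial hd)
  simp only [mul_add] at hv
  have e1 : z * ∫ x, inner ℝ ((ψ : SpinorL2 d) x) (diracDeriv α A ψ x)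
      = (∫ x, ‖diracDeriv α A ψ x‖ ^ 2)
        + ∫ x, w x * inner ℝ (act β ((ψ : SpinorL2 d) x)) (diracDeriv α A ψ x) := by
    rw [← integral_const_mul, ← integral_add hT.norm.integrable_sq (S.integrable_w hd0 hT)]
    refine integral_congr_ae ?_
    filter_upwards [S.eigen] with x hx
    rw [← real_inner_smul_left, ← hx, inner_add_left, real_inner_smul_left,
      real_inner_self_eq_norm_sq]
  -- The part wβψ of zψ contributes nothing, because βα(Bx) is anti-Hermitian.
  have e2 : z * ∫ x, inner ℝ ((ψ : SpinorL2 d) x)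
        (clifford α (dilationField B x) ((ψ : SpinorL2 d) x))
      = ∫ x, inner ℝ (diracDeriv α A ψ x)
          (clifford α (dilationField B x) ((ψ : SpinorL2 d) x)) := by
    rw [← integral_const_mul]
    refine integral_congr_ae ?_
    filter_upwards [S.eigen] with x hx
    rw [← real_inner_smul_left, ← hx, inner_add_left, real_inner_smul_left,
      real_inner_beta_clifford S.dirac, mul_zero, add_zero]
  -- Here the part wβψ meets βψ and leaves w|ψ|².
  have e3 : z * ∫ x, fderiv ℝ w x x * inner ℝ ((ψ : SpinorL2 d) x) (act β ((ψ : SpinorL2 d) x))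
      = (∫ x, fderiv ℝ w x x * inner ℝ (diracDeriv α A ψ x) (act β ((ψ : SpinorL2 d) x)))
          + ∫ x, fderiv ℝ w x x * (w x * ‖(ψ : SpinorL2 d) x‖ ^ 2) := by
    rw [← integral_const_mul, ← integral_add (S.integrable_radial hd0 hT)
      (S.integrable_radial_w hd0)]
    refine integral_congr_ae ?_
    filter_upwards [S.eigen] with x hx
    rw [mul_left_comm, ← real_inner_smul_left, ← hx, inner_add_left, real_inner_smul_left,
      real_inner_self_eq_norm_sq, norm_act_beta S.dirac, mul_add]
  rw [e1, e2, e3] at hv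
  exact hv

/-- Allows Re⟨βψ,Tψ⟩ to be written as a sum of Re⟨ψ, Γ_j ∂_j^A ψ⟩ with Hermitian Γ_j, hence as half
a divergence. -/
theorem isHermitian_beta_alpha (h : IsDiracMatrices α β) (j : Fin d) :
    ((-Complex.I) • (β * α j)).IsHermitian := by
  have h1 : α j * β = -(β * α j) := eq_neg_of_add_eq_zero_left (h.anticomm_beta j)
  rw [Matrix.IsHermitian, Matrix.conjTranspose_smul, Matrix.conjTranspose_mul,
    (h.hermitian_alpha j).eq, h.hermitian_beta.eq, h1]
  simp

theorem act_beta_alpha_apply (j : Fin d) (u : Spinor d) :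
    act ((-Complex.I) • (β * α j)) u = act β ((-Complex.I) • act (α j) u) := by
  rw [act, map_smul, map_mul, map_smul]; rfl

/-- The mass term is controlled by the gradient of the potential. -/
theorem abs_integral_mass_le (S : IsBoundState α β A B w z ψ) (hd : 3 ≤ d) :
    |∫ x, w x * inner ℝ (act β ((ψ : SpinorL2 d) x)) (diracDeriv α A ψ x)|
      ≤ 1 / 2 * ∫ x, ‖fderiv ℝ w x‖ * ‖(ψ : SpinorL2 d) x‖ ^ 2 := by
  have hd0 : 0 < d := by omega
  have hu := Lp.memLp (ψ : SpinorL2 d)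
  have hr := S.memLp_inv_norm hd
  have ig : Integrable (fun x => ‖fderiv ℝ w x‖ * ‖(ψ : SpinorL2 d) x‖ ^ 2) volume := by
    refine integrable_of_abs_le_mul S.memLp_fderiv hr
      ((S.aestronglyMeasurable_fderiv hd0).norm.mul (hu.aestronglyMeasurable.norm.pow 2)) ?_
    filter_upwards [ae_ne_zero hd0] with x hx
    have hx1 := norm_pos_iff.mpr hx
    rw [abs_of_nonneg (by positivity)]
    apply le_of_eq; field_simp
  have i1 : ∀ j, Integrable (fun x => w x * inner ℝ ((ψ : SpinorL2 d) x)
      (act ((-Complex.I) • (β * α j)) (magneticDeriv A j ψ x))) volume := fun j => by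
    simp only [act_beta_alpha_apply, ← real_inner_act_left S.dirac.hermitian_beta]
    exact S.integrable_w hd0 ((memLp_act (S.memLp_D j) (act (α j))).const_smul (-Complex.I))
  have i2 : ∀ j, Integrable (fun x => fderiv ℝ w x (basisVec j) * inner ℝ ((ψ : SpinorL2 d) x)
      (act ((-Complex.I) • (β * α j)) ((ψ : SpinorL2 d) x))) volume := fun j =>
    integrable_mul_inner_act_self hu.aestronglyMeasurable (S.aestronglyMeasurable_partial hd0 j)
      (ig.mono ((S.aestronglyMeasurable_partial hd0 j).mul (hu.aestronglyMeasurable.norm.pow 2))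
        (Eventually.of_forall fun x => by
          rw [norm_mul, norm_mul, norm_norm]
          gcongr
          exact abs_fderiv_basisVec_le w x j)) _
  have i3 : ∀ j, Integrable (fun x => ‖x‖⁻¹ * (w x * inner ℝ ((ψ : SpinorL2 d) x)
      (act ((-Complex.I) • (β * α j)) ((ψ : SpinorL2 d) x)))) volume := fun j => by
    have hrm : MemLp (fun x => ‖x‖⁻¹ • (ψ : SpinorL2 d) x) 2 volume :=
      memLp_inv_norm_smul hd A ψ S.memLp_D
    have := S.integrable_w hd0 ((memLp_act hrm (act (α j))).const_smul (-Complex.I))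
    refine this.congr (Eventually.of_forall fun x => ?_)
    simp only [act_beta_alpha_apply, ← real_inner_act_left S.dirac.hermitian_beta, clm_real_smul,
      Pi.smul_apply]
    rw [smul_comm (-Complex.I), real_inner_smul_right]; ring
  have hs := Finset.sum_congr (rfl : (Finset.univ : Finset (Fin d)) = _) fun j _ =>
    integral_mul_inner_magneticDeriv_of_contDiffOn hd0 A (isHermitian_beta_alpha S.dirac j)
      S.contDiffOn ψ j (i1 j) (i2 j) (i3 j)
  have e1 : ∑ j, ∫ x, w x * (2 * inner ℝ ((ψ : SpinorL2 d) x)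
        (act ((-Complex.I) • (β * α j)) (magneticDeriv A j ψ x)))
      = 2 * ∫ x, w x * inner ℝ (act β ((ψ : SpinorL2 d) x)) (diracDeriv α A ψ x) := by
    rw [← integral_const_mul, ← integral_finsetSum]
    · refine integral_congr_ae (Eventually.of_forall fun x => ?_)
      simp only [act_beta_alpha_apply, ← real_inner_act_left S.dirac.hermitian_beta, diracDeriv,
        inner_sum, Finset.mul_sum]
      exact Finset.sum_congr rfl fun j _ => by ring
    · intro j _
      exact ((i1 j).const_mul 2).congr (Eventually.of_forall fun x => by simp only; ring)
  rw [e1, Finset.sum_neg_distrib, ← integral_finsetSum _ fun j _ => i2 j] at hs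
  have hb : ‖∫ x, ∑ j, fderiv ℝ w x (basisVec j) * inner ℝ ((ψ : SpinorL2 d) x)
      (act ((-Complex.I) • (β * α j)) ((ψ : SpinorL2 d) x))‖
      ≤ ∫ x, ‖fderiv ℝ w x‖ * ‖(ψ : SpinorL2 d) x‖ ^ 2 := by
    refine norm_integral_le_of_norm_le ig (Eventually.of_forall fun x => ?_)
    -- Summed over j the form is that of −iβα(∇w), whose norm is |∇w|; estimating term by term would
    -- lose a dimensional factor.
    have e : ∑ j, fderiv ℝ w x (basisVec j) * inner ℝ ((ψ : SpinorL2 d) x)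
        (act ((-Complex.I) • (β * α j)) ((ψ : SpinorL2 d) x))
        = inner ℝ ((ψ : SpinorL2 d) x) (act β ((-Complex.I)
          • clifford α (gradient w x) ((ψ : SpinorL2 d) x))) := by
      rw [clifford_apply, Finset.smul_sum, map_sum, inner_sum]
      refine Finset.sum_congr rfl fun j _ => ?_
      rw [smul_comm (-Complex.I), clm_real_smul, real_inner_smul_right, act_beta_alpha_apply]
      congr 1
      have : gradient w x j = inner ℝ (gradient w x) (basisVec j) := by
        rw [basisVec, EuclideanSpace.inner_single_right]; simp
      rw [this, gradient, InnerProductSpace.toDual_symm_apply]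
    rw [e]
    refine (abs_real_inner_le_norm _ _).trans (le_of_eq ?_)
    rw [norm_act_beta S.dirac, norm_smul, norm_neg, Complex.norm_I, one_mul,
      norm_clifford S.dirac, norm_gradient]
    ring
  rw [Real.norm_eq_abs] at hb
  rw [eq_neg_iff_add_eq_zero, ← eq_neg_iff_add_eq_zero] at hs
  have h2 : |2 * ∫ x, w x * inner ℝ (act β ((ψ : SpinorL2 d) x)) (diracDeriv α A ψ x)|
      ≤ ∫ x, ‖fderiv ℝ w x‖ * ‖(ψ : SpinorL2 d) x‖ ^ 2 := by rw [hs, abs_neg]; exact hb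
  rw [abs_mul, abs_two] at h2
  linarith

end IsBoundState

/-! ### Radial derivative, sharp Hardy inequality and the shifted Dirac derivative -/

theorem aestronglyMeasurable_clifford (α : Fin d → SpinorMatrix d) {f : Space d → Spinor d}
    (hf : AEStronglyMeasurable f volume) :
    AEStronglyMeasurable (fun x => clifford α x (f x)) volume := by
  simp only [clifford_apply]
  exact Finset.aestronglyMeasurable_fun_sum _ fun j _ =>
    ((contDiff_coord j).continuous.aestronglyMeasurable).smul
      ((act (α j)).continuous.comp_aestronglyMeasurable hf)

/-- The radial magnetic derivative `x/|x| · ∇_A ψ`. -/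
def radialDeriv (A : Space d → Space d) (ψ : H1 d) (x : Space d) : Spinor d :=
  ∑ j, (‖x‖⁻¹ * x j) • magneticDeriv A j ψ x

theorem sum_sq_unit {x : Space d} (hx : x ≠ 0) : ∑ j, (‖x‖⁻¹ * x j) ^ 2 = 1 := by
  have hx1 := norm_pos_iff.mpr hx
  simp only [mul_pow, ← Finset.mul_sum, ← norm_sq_eq_sum]
  field_simp

theorem sum_norm_sub_radial_sq (A : Space d → Space d) (ψ : H1 d) {x : Space d} (hx : x ≠ 0) :
    ∑ j, ‖magneticDeriv A j ψ x - (‖x‖⁻¹ * x j) • radialDeriv A ψ x‖ ^ 2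
      = ∑ j, ‖magneticDeriv A j ψ x‖ ^ 2 - ‖radialDeriv A ψ x‖ ^ 2 := by
  have h1 : ∀ j, ‖magneticDeriv A j ψ x - (‖x‖⁻¹ * x j) • radialDeriv A ψ x‖ ^ 2
      = ‖magneticDeriv A j ψ x‖ ^ 2
        - 2 * inner ℝ ((‖x‖⁻¹ * x j) • magneticDeriv A j ψ x) (radialDeriv A ψ x)
        + (‖x‖⁻¹ * x j) ^ 2 * ‖radialDeriv A ψ x‖ ^ 2 := by
    intro j
    rw [norm_sub_sq_real, norm_smul, mul_pow, Real.norm_eq_abs, sq_abs, real_inner_smul_left,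
      real_inner_smul_right]
  simp only [h1, Finset.sum_add_distrib, Finset.sum_sub_distrib, ← Finset.mul_sum, ← sum_inner,
    ← Finset.sum_mul, sum_sq_unit hx]
  rw [← radialDeriv, real_inner_self_eq_norm_sq]
  ring

theorem norm_radialDeriv_sq_le (A : Space d → Space d) (ψ : H1 d) {x : Space d} (hx : x ≠ 0) :
    ‖radialDeriv A ψ x‖ ^ 2 ≤ ∑ j, ‖magneticDeriv A j ψ x‖ ^ 2 := by
  rw [← sub_nonneg, ← sum_norm_sub_radial_sq A ψ hx]
  exact Finset.sum_nonneg fun _ _ => sq_nonneg _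

theorem memLp_radialDeriv (hd : 0 < d) {A : Space d → Space d} {ψ : H1 d}
    (hD : ∀ j, MemLp (magneticDeriv A j ψ) 2 volume) :
    MemLp (radialDeriv A ψ) 2 volume := by
  have hm : AEStronglyMeasurable (radialDeriv A ψ) volume :=
    Finset.aestronglyMeasurable_fun_sum _ fun j _ =>
      ((measurable_norm.inv.aestronglyMeasurable).mul
        (contDiff_coord j).continuous.aestronglyMeasurable).smul (hD j).aestronglyMeasurable
  rw [← memLp_norm_iff hm, memLp_two_iff_integrable_sq hm.norm]
  refine (integrable_sum_norm_magneticDeriv_sq hD).mono' (hm.norm.pow 2) ?_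
  filter_upwards [ae_ne_zero hd] with x hx
  rw [Real.norm_of_nonneg (sq_nonneg _)]
  exact norm_radialDeriv_sq_le A ψ hx

theorem integral_inner_radialDeriv (hd : 3 ≤ d) {A : Space d → Space d} {ψ : H1 d}
    (hD : ∀ j, MemLp (magneticDeriv A j ψ) 2 volume) :
    ∫ x, ‖x‖⁻¹ * inner ℝ ((ψ : SpinorL2 d) x) (radialDeriv A ψ x)
      = -(((d : ℝ) - 2) / 2) * ∫ x, (‖x‖⁻¹ * ‖(ψ : SpinorL2 d) x‖) ^ 2 := by
  simp only [mul_pow, inv_pow]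
  rw [← integral_radial_magneticDeriv hd A ψ hD]
  refine integral_congr_ae (Eventually.of_forall fun x => ?_)
  simp only [radialDeriv, inner_sum, Finset.mul_sum, real_inner_smul_right]
  exact Finset.sum_congr rfl fun j _ => by ring

/-- The radial form of the magnetic Hardy inequality. -/
theorem hardy_radial (hd : 3 ≤ d) {A : Space d → Space d} {ψ : H1 d}
    (hD : ∀ j, MemLp (magneticDeriv A j ψ) 2 volume) :
    (((d : ℝ) - 2) / 2) ^ 2 * ∫ x, (‖x‖⁻¹ * ‖(ψ : SpinorL2 d) x‖) ^ 2
      ≤ ∫ x, ‖radialDeriv A ψ x‖ ^ 2 := by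
  have hr := memLp_inv_norm_mul (memLp_inv_norm_smul hd A ψ hD)
  have hR := memLp_radialDeriv (by omega) hD
  have h1 := abs_integral_le_of_abs_le_mul (F := fun x => ‖x‖⁻¹ *
    inner ℝ ((ψ : SpinorL2 d) x) (radialDeriv A ψ x)) hr hR.norm (Eventually.of_forall fun x => by
      rw [abs_mul, abs_of_nonneg (inv_nonneg.mpr (norm_nonneg x)), mul_assoc]
      exact mul_le_mul_of_nonneg_left (abs_real_inner_le_norm _ _)
        (inv_nonneg.mpr (norm_nonneg x)))
  rw [integral_inner_radialDeriv hd hD] at h1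
  set Z := ∫ x, (‖x‖⁻¹ * ‖(ψ : SpinorL2 d) x‖) ^ 2
  set P := ∫ x, ‖radialDeriv A ψ x‖ ^ 2
  have hZ : 0 ≤ Z := integral_nonneg fun x => sq_nonneg _
  have hP : 0 ≤ P := integral_nonneg fun x => sq_nonneg _
  have ha : 0 ≤ ((d : ℝ) - 2) / 2 := by
    have : (3 : ℝ) ≤ d := by exact_mod_cast hd
    linarith
  rw [abs_mul, abs_neg, abs_of_nonneg ha, abs_of_nonneg hZ, ← Real.sqrt_mul hZ] at h1
  have h2 := pow_le_pow_left₀ (by positivity) h1 2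
  rw [Real.sq_sqrt (by positivity), mul_pow] at h2
  rcases hZ.eq_or_lt with h0 | h0
  · rw [← h0]; simpa using hP
  · nlinarith

theorem integral_radialDeriv_sq_le (hd : 0 < d) {A : Space d → Space d} {ψ : H1 d}
    (hD : ∀ j, MemLp (magneticDeriv A j ψ) 2 volume) :
    ∫ x, ‖radialDeriv A ψ x‖ ^ 2 ≤ energy A ψ := by
  refine integral_mono_ae (memLp_radialDeriv hd hD).norm.integrable_sq
    (integrable_sum_norm_magneticDeriv_sq hD) ?_
  filter_upwards [ae_ne_zero hd] with x hx using norm_radialDeriv_sq_le A ψ hx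

/-- The Dirac derivative with part of its radial component removed. -/
def shiftedDirac (α : Fin d → SpinorMatrix d) (A : Space d → Space d) (ψ : H1 d) (x : Space d) :
    Spinor d :=
  diracDeriv α A ψ x - (‖x‖ ^ 2)⁻¹ • (Complex.I • clifford α x ((ψ : SpinorL2 d) x))

/-- Decompose ∂_j^A ψ into (x_j/|x|)ρ + E_j with ρ the radial derivative. The cross term with ρ is
kept exactly, since it integrates to −(d−2)‖ψ/|x|‖²; the tangential part is handled by Young's
inequality with a free parameter l and |∑α_j E_j|² ≤ d∑|E_j|². -/
theorem norm_shiftedDirac_sq_le {α : Fin d → SpinorMatrix d} {β : SpinorMatrix d}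
    (h : IsDiracMatrices α β) (A : Space d → Space d) (ψ : H1 d) {x : Space d} (hx : x ≠ 0)
    {l : ℝ} (hl : 0 < l) :
    ‖shiftedDirac α A ψ x‖ ^ 2 ≤ ‖diracDeriv α A ψ x‖ ^ 2
      + 2 * (‖x‖⁻¹ * inner ℝ ((ψ : SpinorL2 d) x) (radialDeriv A ψ x))
      + l * (∑ j, ‖magneticDeriv A j ψ x‖ ^ 2 - ‖radialDeriv A ψ x‖ ^ 2)
      + (d / l + 1) * (‖x‖⁻¹ * ‖(ψ : SpinorL2 d) x‖) ^ 2 := by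
  have hx1 := norm_pos_iff.mpr hx
  set u := (ψ : SpinorL2 d) x
  set ρ := radialDeriv A ψ x
  set E : Fin d → Spinor d := fun j => magneticDeriv A j ψ x - (‖x‖⁻¹ * x j) • ρ with hE
  have e1 : ∑ j, act (α j) (magneticDeriv A j ψ x)
      = ‖x‖⁻¹ • clifford α x ρ + ∑ j, act (α j) (E j) := by
    rw [clifford_apply, Finset.smul_sum, ← Finset.sum_add_distrib]
    refine Finset.sum_congr rfl fun j _ => ?_
    rw [hE, map_sub, clm_real_smul, smul_smul, add_sub_cancel]
  have e2 : inner ℝ (diracDeriv α A ψ x) (Complex.I • clifford α x u)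
      = -(‖x‖ * inner ℝ u ρ) - inner ℝ (∑ j, act (α j) (E j)) (clifford α x u) := by
    rw [diracDeriv_eq, inner_neg_left, real_inner_I_smul_I_smul, e1, inner_add_left,
      real_inner_smul_left, ← real_inner_clifford_left h, clifford_clifford_self h,
      real_inner_smul_left, real_inner_comm ρ u]
    field_simp
    ring
  have e3 : ‖shiftedDirac α A ψ x‖ ^ 2 = ‖diracDeriv α A ψ x‖ ^ 2
      + 2 * (‖x‖⁻¹ * inner ℝ u ρ)
      + 2 * ((‖x‖ ^ 2)⁻¹ * inner ℝ (∑ j, act (α j) (E j)) (clifford α x u))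
      + (‖x‖⁻¹ * ‖u‖) ^ 2 := by
    rw [shiftedDirac, norm_sub_sq_real, real_inner_smul_right, e2, norm_smul, norm_smul,
      Complex.norm_I, norm_clifford h, norm_inv, norm_pow, norm_norm]
    field_simp
    ring
  have hS := norm_sum_act_alpha_sq_le h E
  have e4 : ∑ j, ‖E j‖ ^ 2 = ∑ j, ‖magneticDeriv A j ψ x‖ ^ 2 - ‖ρ‖ ^ 2 :=
    sum_norm_sub_radial_sq A ψ hx
  rw [e4] at hS
  set s := ‖∑ j, act (α j) (E j)‖
  set G := ∑ j, ‖magneticDeriv A j ψ x‖ ^ 2 - ‖ρ‖ ^ 2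
  have e5 : (‖x‖ ^ 2)⁻¹ * inner ℝ (∑ j, act (α j) (E j)) (clifford α x u)
      ≤ s * (‖x‖⁻¹ * ‖u‖) := by
    have := (le_abs_self _).trans (abs_real_inner_le_norm (∑ j, act (α j) (E j)) (clifford α x u))
    rw [norm_clifford h] at this
    calc _ ≤ (‖x‖ ^ 2)⁻¹ * (s * (‖x‖ * ‖u‖)) := by gcongr
      _ = _ := by field_simp
  have hd : 0 < (d : ℝ) := by
    rcases Nat.eq_zero_or_pos d with rfl | hd
    · exact absurd (Subsingleton.elim x 0) hx
    · exact_mod_cast hd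
  set t := ‖x‖⁻¹ * ‖u‖
  have e6 : 2 * (s * t) ≤ l * G + d / l * t ^ 2 := by
    have h1 : l * (s ^ 2 / d) ≤ l * G := by
      gcongr
      rw [div_le_iff₀ hd]; linarith
    have h2 : 0 ≤ l / d * (s - d / l * t) ^ 2 := by positivity
    have h3 : l / d * (s - d / l * t) ^ 2 = l * (s ^ 2 / d) - 2 * (s * t) + d / l * t ^ 2 := by
      field_simp; ring
    linarith
  rw [e3]
  linarith

namespace IsBoundState

variable {α : Fin d → SpinorMatrix d} {β : SpinorMatrix d} {A : Space d → Space d}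
  {B : Space d → Matrix (Fin d) (Fin d) ℝ} {w : Space d → ℝ} {z : ℝ} {ψ : H1 d}

theorem memLp_shiftedDirac (S : IsBoundState α β A B w z ψ) (hd : 3 ≤ d) :
    MemLp (shiftedDirac α A ψ) 2 volume := by
  refine S.memLp_T.sub ?_
  have hm : AEStronglyMeasurable (fun x : Space d => (‖x‖ ^ 2)⁻¹ •
      (Complex.I • clifford α x ((ψ : SpinorL2 d) x))) volume :=
    ((measurable_norm.pow_const 2).inv.aestronglyMeasurable).smul
      ((aestronglyMeasurable_clifford α (Lp.memLp (ψ : SpinorL2 d)).aestronglyMeasurable).const_smul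
        Complex.I)
  refine (S.memLp_inv_norm hd).mono hm ?_
  filter_upwards [ae_ne_zero (by omega : 0 < d)] with x hx
  have hx1 := norm_pos_iff.mpr hx
  rw [norm_smul, norm_smul, Complex.norm_I, norm_clifford S.dirac, norm_inv, norm_pow, norm_norm,
    norm_mul, norm_inv, norm_norm, norm_norm]
  apply le_of_eq; field_simp

theorem integral_norm_shiftedDirac_sq_le (S : IsBoundState α β A B w z ψ) (hd : 3 ≤ d)
    {l : ℝ} (hl : 0 < l) :
    ∫ x, ‖shiftedDirac α A ψ x‖ ^ 2 ≤ (∫ x, ‖diracDeriv α A ψ x‖ ^ 2)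
      - ((d : ℝ) - 2) * (∫ x, (‖x‖⁻¹ * ‖(ψ : SpinorL2 d) x‖) ^ 2)
      + l * (energy A ψ - ∫ x, ‖radialDeriv A ψ x‖ ^ 2)
      + (d / l + 1) * ∫ x, (‖x‖⁻¹ * ‖(ψ : SpinorL2 d) x‖) ^ 2 := by
  have hd0 : 0 < d := by omega
  have hR := memLp_radialDeriv hd0 S.memLp_D
  have hr : MemLp (fun x => ‖x‖⁻¹ • (ψ : SpinorL2 d) x) 2 volume :=
    memLp_inv_norm_smul hd A ψ S.memLp_D
  have i1 := S.memLp_T.norm.integrable_sq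
  have i2 : Integrable (fun x => 2 * (‖x‖⁻¹ * inner ℝ ((ψ : SpinorL2 d) x) (radialDeriv A ψ x)))
      volume := by
    refine ((integrable_inner_of_memLp hr hR).const_mul 2).congr (Eventually.of_forall fun x => ?_)
    simp only [real_inner_smul_left]
  have i3 : Integrable (fun x => l * (∑ j, ‖magneticDeriv A j ψ x‖ ^ 2 - ‖radialDeriv A ψ x‖ ^ 2))
      volume :=
    ((integrable_sum_norm_magneticDeriv_sq S.memLp_D).sub hR.norm.integrable_sq).const_mul l
  have i4 := (S.memLp_inv_norm hd).integrable_sq.const_mul (d / l + 1)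
  have h := integral_mono_ae (S.memLp_shiftedDirac hd).norm.integrable_sq
    (((i1.add i2).add i3).add i4) (by
      filter_upwards [ae_ne_zero hd0] with x hx using norm_shiftedDirac_sq_le S.dirac A ψ hx hl)
  rw [integral_add' ((i1.add i2).add i3) i4, integral_add' (i1.add i2) i3, integral_add' i1 i2,
    integral_const_mul, integral_const_mul, integral_const_mul,
    integral_inner_radialDeriv hd S.memLp_D,
    integral_sub (integrable_sum_norm_magneticDeriv_sq S.memLp_D) hR.norm.integrable_sq] at h
  rw [energy]
  linarith

theorem abs_inner_dilationField_le (S : IsBoundState α β A B w z ψ) (x : Space d) (f : Spinor d) :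
    |inner ℝ f (clifford α (dilationField B x) ((ψ : SpinorL2 d) x))|
      ≤ ‖f‖ * (‖x‖ * matrixNorm (B x) * ‖(ψ : SpinorL2 d) x‖) := by
  refine (abs_real_inner_le_norm _ _).trans ?_
  rw [norm_clifford S.dirac]
  gcongr
  exact norm_dilationField_le B x

theorem lichnerowicz (S : IsBoundState α β A B w z ψ) (hd : 3 ≤ d) :
    Integrable (fun x => spinForm α (B x) ((ψ : SpinorL2 d) x)) volume ∧
    ∫ x, ‖diracDeriv α A ψ x‖ ^ 2
      = energy A ψ + ∫ x, spinForm α (B x) ((ψ : SpinorL2 d) x) :=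
  integral_norm_diracDeriv_sq (by omega) S.dirac S.memL2Loc_A S.memL2Loc_B S.magnetic S.memLp_A
    (memLp_inv_norm_smul hd A ψ S.memLp_D) S.memLp_B

/-- The magnetic contribution, in odd dimensions. -/
theorem magnetic_le_of_odd (S : IsBoundState α β A B w z ψ) (hd : 3 ≤ d) (hodd : Odd d) :
    (∫ x, inner ℝ (diracDeriv α A ψ x) (clifford α (dilationField B x) ((ψ : SpinorL2 d) x)))
        - ∫ x, spinForm α (B x) ((ψ : SpinorL2 d) x)
      ≤ √(∫ x, (‖x‖ * matrixNorm (B x) * ‖(ψ : SpinorL2 d) x‖) ^ 2)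
        * (√(∫ x, ‖diracDeriv α A ψ x‖ ^ 2)
          + ((d : ℝ) - 1) / 2 * √(∫ x, (‖x‖⁻¹ * ‖(ψ : SpinorL2 d) x‖) ^ 2)) := by
  have h1 := abs_integral_le_of_abs_le_mul S.memLp_T.norm S.memLp_B (Eventually.of_forall fun x =>
    S.abs_inner_dilationField_le x (diracDeriv α A ψ x))
  have hr := S.memLp_inv_norm hd
  have hd1 : 0 ≤ ((d : ℝ) - 1) / 2 := by
    have : (3 : ℝ) ≤ d := by exact_mod_cast hd
    linarith
  have h2 : |∫ x, spinForm α (B x) ((ψ : SpinorL2 d) x)|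
      ≤ ∫ x, ((d : ℝ) - 1) / 2 * ((‖x‖ * matrixNorm (B x) * ‖(ψ : SpinorL2 d) x‖)
        * (‖x‖⁻¹ * ‖(ψ : SpinorL2 d) x‖)) := by
    have ib : Integrable (fun x => ‖x‖ * matrixNorm (B x) * ‖(ψ : SpinorL2 d) x‖
        * (‖x‖⁻¹ * ‖(ψ : SpinorL2 d) x‖)) volume := S.memLp_B.integrable_mul hr
    rw [← Real.norm_eq_abs]
    refine norm_integral_le_of_norm_le (ib.const_mul _) ?_
    filter_upwards [magneticField_antisymm S.memL2Loc_B S.magnetic,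
      ae_ne_zero (by omega : 0 < d)] with x hx hx0
    have hx1 := norm_pos_iff.mpr hx0
    refine (abs_spinForm_le_of_odd hodd S.dirac hx _).trans (le_of_eq ?_)
    field_simp
  rw [integral_const_mul] at h2
  have h3 := (le_abs_self _).trans (abs_integral_mul_le S.memLp_B hr)
  have h4 := mul_le_mul_of_nonneg_left h3 hd1
  rw [abs_le] at h1 h2
  linarith [h1.2, h2.1]

/-- The magnetic contribution, in even dimensions. -/
theorem magnetic_le_of_even (S : IsBoundState α β A B w z ψ) (hd : 3 ≤ d) (heven : Even d) :
    (∫ x, inner ℝ (diracDeriv α A ψ x) (clifford α (dilationField B x) ((ψ : SpinorL2 d) x)))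
        - ∫ x, spinForm α (B x) ((ψ : SpinorL2 d) x)
      ≤ √(∫ x, (‖x‖ * matrixNorm (B x) * ‖(ψ : SpinorL2 d) x‖) ^ 2)
        * (√(∫ x, ‖shiftedDirac α A ψ x‖ ^ 2)
          + ((d : ℝ) - 2) / 2 * √(∫ x, (‖x‖⁻¹ * ‖(ψ : SpinorL2 d) x‖) ^ 2)) := by
  have hτ := S.memLp_shiftedDirac hd
  have h1 := abs_integral_le_of_abs_le_mul hτ.norm S.memLp_B (Eventually.of_forall fun x =>
    S.abs_inner_dilationField_le x (shiftedDirac α A ψ x))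
  have hr := S.memLp_inv_norm hd
  have hd1 : 0 ≤ ((d : ℝ) - 2) / 2 := by
    have : (3 : ℝ) ≤ d := by exact_mod_cast hd
    linarith
  have i1 := S.integrable_dilationField S.memLp_T
  have i2 := S.integrable_dilationField hτ
  have i3 := (S.lichnerowicz hd).1
  -- The shift of Tψ produces exactly the term |x|⁻²⟨ψ, iα(x)α(Bx)ψ⟩ that reduces the spin form to
  -- the compressed field.
  have e : (∫ x, inner ℝ (diracDeriv α A ψ x)
        (clifford α (dilationField B x) ((ψ : SpinorL2 d) x)))
        - (∫ x, spinForm α (B x) ((ψ : SpinorL2 d) x))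
      - (∫ x, inner ℝ (shiftedDirac α A ψ x)
        (clifford α (dilationField B x) ((ψ : SpinorL2 d) x)))
      = ∫ x, -(spinForm α (B x) ((ψ : SpinorL2 d) x) + (‖x‖ ^ 2)⁻¹ * inner ℝ ((ψ : SpinorL2 d) x)
        (Complex.I • clifford α x (clifford α (dilationField B x) ((ψ : SpinorL2 d) x)))) := by
    have i13 := i1.sub i3
    simp only [Pi.sub_def] at i13
    rw [← integral_sub i1 i3, ← integral_sub i13 i2]
    refine integral_congr_ae (Eventually.of_forall fun x => ?_)
    simp only [shiftedDirac, inner_sub_left, real_inner_smul_left,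
      real_inner_I_smul_left, real_inner_clifford_left S.dirac, map_smul]
    ring
  have h2 : |∫ x, -(spinForm α (B x) ((ψ : SpinorL2 d) x)
      + (‖x‖ ^ 2)⁻¹ * inner ℝ ((ψ : SpinorL2 d) x)
        (Complex.I • clifford α x (clifford α (dilationField B x) ((ψ : SpinorL2 d) x))))|
      ≤ ∫ x, ((d : ℝ) - 2) / 2 * ((‖x‖ * matrixNorm (B x) * ‖(ψ : SpinorL2 d) x‖)
        * (‖x‖⁻¹ * ‖(ψ : SpinorL2 d) x‖)) := by
    have ib : Integrable (fun x => ‖x‖ * matrixNorm (B x) * ‖(ψ : SpinorL2 d) x‖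
        * (‖x‖⁻¹ * ‖(ψ : SpinorL2 d) x‖)) volume := S.memLp_B.integrable_mul hr
    rw [← Real.norm_eq_abs]
    refine norm_integral_le_of_norm_le (ib.const_mul _) ?_
    filter_upwards [magneticField_antisymm S.memL2Loc_B S.magnetic,
      ae_ne_zero (by omega : 0 < d)] with x hx hx0
    have hx1 := norm_pos_iff.mpr hx0
    rw [norm_neg]
    refine (abs_spinForm_add_le_of_even (by omega) heven S.dirac hx hx0 _).trans (le_of_eq ?_)
    field_simp
  rw [integral_const_mul] at h2
  have h3 := (le_abs_self _).trans (abs_integral_mul_le S.memLp_B hr)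
  have h4 := mul_le_mul_of_nonneg_left h3 hd1
  rw [abs_le] at h1 h2
  linarith [h1.2, h2.2]

end IsBoundState

/-! ### Scalar inequalities behind the constants -/

/-- Used with a = (d−2)/2, so that a + ½ = (d−1)/2 and 1/(2a) = 1/(d−2); Z is the Hardy integral, X
= ‖Tψ‖² and Y the energy. -/
theorem sqrt_add_mul_sqrt_le_of_odd {a X Y Z : ℝ} (ha : 0 < a)
    (hZY : a ^ 2 * Z ≤ Y) (hXY : X ≤ Y) :
    √X + (a + 1 / 2) * √Z ≤ (2 + 1 / (2 * a)) * √Y := by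
  have h1 : √X ≤ √Y := Real.sqrt_le_sqrt hXY
  have h2 : a * √Z ≤ √Y := by
    rw [← Real.sqrt_sq ha.le, ← Real.sqrt_mul (sq_nonneg a)]
    exact Real.sqrt_le_sqrt hZY
  have h3 : (a + 1 / 2) * √Z = (1 + 1 / (2 * a)) * (a * √Z) := by field_simp
  have h4 : (1 + 1 / (2 * a)) * (a * √Z) ≤ (1 + 1 / (2 * a)) * √Y := by gcongr
  linarith

/-- Used with d = 2n + 2, so n = (d−2)/2; W is the squared norm of the shifted Dirac derivative and
P the radial energy. The gain over the trivial estimate is that at the Hardy extremal n²Z = Y the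
tangential energy Y − P vanishes. -/
theorem sqrt_add_mul_sqrt_le_of_even {n : ℕ} (hn : 1 ≤ n) {P W X Y Z : ℝ} (hY : 0 ≤ Y)
    (hZ : 0 ≤ Z) (hZP : (n : ℝ) ^ 2 * Z ≤ P) (hPY : P ≤ Y) (hXY : X ≤ Y)
    (hW : ∀ l : ℝ, 0 < l → W ≤ X - 2 * n * Z + l * (Y - P) + ((2 * n + 2) / l + 1) * Z) :
    √W + n * √Z ≤ (2 + 1 / (2 * n)) * √Y := by
  obtain ⟨y, hy, rfl⟩ : ∃ y : ℝ, 0 ≤ y ∧ Y = y ^ 2 := ⟨√Y, Real.sqrt_nonneg _, (Real.sq_sqrt hY).symm⟩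
  obtain ⟨s, hs, rfl⟩ : ∃ s : ℝ, 0 ≤ s ∧ Z = s ^ 2 := ⟨√Z, Real.sqrt_nonneg _, (Real.sq_sqrt hZ).symm⟩
  rw [Real.sqrt_sq hy, Real.sqrt_sq hs]
  have hn0 : (1 : ℝ) ≤ n := by exact_mod_cast hn
  have hsy : n * s ≤ y := by
    have h : ((n : ℝ) * s) ^ 2 ≤ y ^ 2 := by rw [mul_pow]; linarith
    exact (sq_le_sq₀ (by positivity) hy).mp h
  have hK : 0 ≤ 1 / (2 * (n : ℝ)) := by positivity
  have hb : 0 ≤ (2 + 1 / (2 * (n : ℝ))) * y - n * s := by nlinarith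
  have hW' : ∀ l : ℝ, 0 < l →
      W ≤ y ^ 2 - 2 * n * s ^ 2 + l * (y ^ 2 - n ^ 2 * s ^ 2) + ((2 * n + 2) / l + 1) * s ^ 2 := by
    intro l hl
    have h := hW l hl
    have : l * (y ^ 2 - P) ≤ l * (y ^ 2 - n ^ 2 * s ^ 2) := by gcongr
    linarith
  suffices h : W ≤ ((2 + 1 / (2 * (n : ℝ))) * y - n * s) ^ 2 by
    have := Real.sqrt_le_sqrt h
    rw [Real.sqrt_sq hb] at this
    linarith
  rcases (by omega : n = 1 ∨ n = 2 ∨ 3 ≤ n) with rfl | rfl | h3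
  -- For n = 1 and n = 2 the choice l = 1 gives too weak a bound when ns = y; with l = 2 the
  -- difference is a positive definite quadratic form in y and s.
  · have h := hW' 2 (by norm_num)
    norm_num at h ⊢
    nlinarith [sq_nonneg (y - s), sq_nonneg (y - 4 / 5 * s), sq_nonneg y]
  · have h := hW' 2 (by norm_num)
    norm_num at h ⊢
    nlinarith [sq_nonneg (y - 24 / 9 * s), sq_nonneg y, sq_nonneg (y - 9 / 4 * s)]
  -- For large n the choice l = 1 is the natural one: with p = ns fixed, the difference tends to (2y
  -- − p)² − (2y² − p²) = 2(y − p)². The corrections in q = 1/n have the right sign once 11q/4 ≤ 1,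
  -- which holds for n ≥ 3.
  · have h := hW' 1 one_pos
    have h3' : (3 : ℝ) ≤ n := by exact_mod_cast h3
    obtain ⟨p, hp⟩ : ∃ p : ℝ, p = n * s := ⟨_, rfl⟩
    obtain ⟨q, hq⟩ : ∃ q : ℝ, q = (n : ℝ)⁻¹ := ⟨_, rfl⟩
    have hnq : n * q = 1 := by rw [hq]; exact mul_inv_cancel₀ (by positivity)
    have hq0 : 0 < q := by rw [hq]; positivity
    have hq3 : q ≤ 1 / 3 := by nlinarith
    have hs' : s = q * p := by rw [hp, ← mul_assoc, mul_comm q, hnq, one_mul]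
    have e1 : (2 + 1 / (2 * (n : ℝ))) = 2 + q / 2 := by rw [hq]; field_simp
    rw [← hp] at hsy
    have hp0 : 0 ≤ p := by rw [hp]; positivity
    rw [e1, ← hp]
    have h4 : W ≤ 2 * y ^ 2 - p ^ 2 + 3 * q ^ 2 * p ^ 2 := by
      have : (n : ℝ) ^ 2 * s ^ 2 = p ^ 2 := by rw [hp]; ring
      rw [this] at h
      have h5 : s ^ 2 = q ^ 2 * p ^ 2 := by rw [hs']; ring
      nlinarith
    have e2 : ((2 + q / 2) * y - p) ^ 2 - (2 * y ^ 2 - p ^ 2 + 3 * q ^ 2 * p ^ 2)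
        = q * (1 - 11 / 4 * q) * y ^ 2
          + (y - p) * (2 * (2 + q / 2) * y - (2 - 3 * q ^ 2) * (y + p)) := by ring
    have h6 : 0 ≤ q * (1 - 11 / 4 * q) * y ^ 2 := by
      have : 0 ≤ 1 - 11 / 4 * q := by linarith
      positivity
    have h7 : 0 ≤ 2 * (2 + q / 2) * y - (2 - 3 * q ^ 2) * (y + p) := by
      nlinarith [mul_nonneg hq0.le hy, mul_nonneg (sq_nonneg q) hy, mul_nonneg (sq_nonneg q) hp0]
    have h8 : 0 ≤ (y - p) * (2 * (2 + q / 2) * y - (2 - 3 * q ^ 2) * (y + p)) :=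
      mul_nonneg (by linarith) h7
    linarith

theorem sqrt_le_mul_sqrt {c F Y : ℝ} (hc : 0 ≤ c) (h : F ≤ c ^ 2 * Y) : √F ≤ c * √Y := by
  conv_rhs => rw [← Real.sqrt_sq hc, ← Real.sqrt_mul (sq_nonneg c)]
  exact Real.sqrt_le_sqrt h

/-- Here p² = ‖Tψ‖², y² is the energy, Q the spin term, K the mass term and δ = 1/(d−2). Compare
everything with the larger of p² and y². For p ≥ y the virial identity alone bounds p² by a proper
fraction of itself. For p ≤ y one eliminates p² by the Lichnerowicz formula, and T₁ − Q has to be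
estimated jointly. -/
theorem smallness_contradiction {ε₁ ε₂ δ R p y K Q T₁ T₂ T₃ G : ℝ} (hε₁ : 0 ≤ ε₁) (hε₂ : 0 ≤ ε₂)
    (hδ : 0 ≤ δ) (hR0 : 0 ≤ R) (hy : 0 < y)
    (hsmall : (2 + δ) * ε₁ + (1 + δ) * ε₂ + R < 1) (hL : p * p = y * y + Q)
    (hV : p * p + K = T₁ + (T₂ + T₃)) (hM : p ≤ y → T₁ - Q ≤ (2 + δ) * ε₁ * (y * y))
    (h1 : T₁ ≤ p * (ε₁ * y)) (h2 : T₂ ≤ p * (ε₂ * y)) (h3 : T₃ ≤ R * (y * y))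
    (hG : G ≤ 2 * δ * ε₂ * (y * y)) (hK : -(1 / 2 * G) ≤ K) : False := by
  rcases le_total p y with hpy | hpy
  · have h4 := hM hpy
    have h5 : p * (ε₂ * y) ≤ y * (ε₂ * y) := by gcongr
    have h6 := mul_pos (mul_pos hy hy) (sub_pos.mpr hsmall)
    linarith
  · have hp' : 0 < p := hy.trans_le hpy
    have h4 : p * (ε₁ * y) ≤ p * (ε₁ * p) := by gcongr
    have h5 : p * (ε₂ * y) ≤ p * (ε₂ * p) := by gcongr
    have h6 : (R + δ * ε₂) * (y * y) ≤ (R + δ * ε₂) * (p * p) := by gcongr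
    have h7 : 0 ≤ (1 + δ) * ε₁ * (p * p) := by positivity
    have h8 := mul_pos (mul_pos hp' hp') (sub_pos.mpr hsmall)
    linarith

/-! ### Absence of bound states -/

namespace IsBoundState

variable {α : Fin d → SpinorMatrix d} {β : SpinorMatrix d} {A : Space d → Space d}
  {B : Space d → Matrix (Fin d) (Fin d) ℝ} {w : Space d → ℝ} {z : ℝ} {ψ : H1 d}

theorem hardy (S : IsBoundState α β A B w z ψ) (hd : 3 ≤ d) :
    (((d : ℝ) - 2) / 2) ^ 2 * ∫ x, (‖x‖⁻¹ * ‖(ψ : SpinorL2 d) x‖) ^ 2 ≤ energy A ψ :=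
  (hardy_radial hd S.memLp_D).trans (integral_radialDeriv_sq_le (by omega) S.memLp_D)

/-- By Hardy's inequality, zero energy would force |x|⁻¹ψ = 0. -/
theorem energy_pos (S : IsBoundState α β A B w z ψ) (hd : 3 ≤ d) (hψ : (ψ : SpinorL2 d) ≠ 0) :
    0 < energy A ψ := by
  have hd3 : (3 : ℝ) ≤ d := by exact_mod_cast hd
  have hZ : 0 < ∫ x, (‖x‖⁻¹ * ‖(ψ : SpinorL2 d) x‖) ^ 2 := by
    refine lt_of_le_of_ne (integral_nonneg fun _ => sq_nonneg _) fun h0 => hψ ?_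
    have h1 := (integral_eq_zero_iff_of_nonneg (fun _ => sq_nonneg _)
      (S.memLp_inv_norm hd).integrable_sq).mp h0.symm
    refine Lp.eq_zero_iff_ae_eq_zero.mpr ?_
    filter_upwards [h1, ae_ne_zero (by omega : 0 < d)] with x hx hx0
    have hx2 := (mul_eq_zero.mp (pow_eq_zero_iff two_ne_zero |>.mp hx)).resolve_left
      (inv_ne_zero (norm_ne_zero_iff.mpr hx0))
    exact norm_eq_zero.mp hx2
  have ha : 0 < ((d : ℝ) - 2) / 2 := by linarith
  exact (mul_pos (pow_pos ha 2) hZ).trans_le (S.hardy hd)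

/-- The parities use different linear algebra, a kernel vector of B or the compression to x^⊥, but
arrive at the same constant. -/
theorem magnetic_le (S : IsBoundState α β A B w z ψ) (hd : 3 ≤ d)
    (hXY : ∫ x, ‖diracDeriv α A ψ x‖ ^ 2 ≤ energy A ψ) {ε : ℝ} (hε : 0 ≤ ε)
    (hB : ∫ x, (‖x‖ * matrixNorm (B x) * ‖(ψ : SpinorL2 d) x‖) ^ 2 ≤ ε ^ 2 * energy A ψ) :
    (∫ x, inner ℝ (diracDeriv α A ψ x) (clifford α (dilationField B x) ((ψ : SpinorL2 d) x)))
        - ∫ x, spinForm α (B x) ((ψ : SpinorL2 d) x)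
      ≤ (2 + 1 / ((d : ℝ) - 2)) * ε * energy A ψ := by
  have hd3 : (3 : ℝ) ≤ d := by exact_mod_cast hd
  have hY := energy_nonneg A ψ
  have hZ : 0 ≤ ∫ x, (‖x‖⁻¹ * ‖(ψ : SpinorL2 d) x‖) ^ 2 := integral_nonneg fun _ => sq_nonneg _
  have h2a : 2 * (((d : ℝ) - 2) / 2) = d - 2 := by ring
  have hb := sqrt_le_mul_sqrt hε hB
  have fin : ∀ {t : ℝ}, 0 ≤ t → t ≤ (2 + 1 / ((d : ℝ) - 2)) * √(energy A ψ) →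
      √(∫ x, (‖x‖ * matrixNorm (B x) * ‖(ψ : SpinorL2 d) x‖) ^ 2) * t
        ≤ (2 + 1 / ((d : ℝ) - 2)) * ε * energy A ψ := by
    intro t ht0 ht
    calc _ ≤ (ε * √(energy A ψ)) * ((2 + 1 / ((d : ℝ) - 2)) * √(energy A ψ)) := by gcongr
      _ = (2 + 1 / ((d : ℝ) - 2)) * ε * (√(energy A ψ) * √(energy A ψ)) := by ring
      _ = _ := by rw [Real.mul_self_sqrt hY]
  rcases Nat.even_or_odd d with he | ho
  · refine (S.magnetic_le_of_even hd he).trans (fin ?_ ?_)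
    · have : 0 ≤ ((d : ℝ) - 2) / 2 := by linarith
      positivity
    · obtain ⟨k, hk⟩ := he
      obtain ⟨n, rfl⟩ : ∃ n, k = n + 1 := ⟨k - 1, by omega⟩
      have hdn : (d : ℝ) = 2 * n + 2 := by rw [hk]; push_cast; ring
      have hn : ((d : ℝ) - 2) / 2 = n := by rw [hdn]; ring
      have h := sqrt_add_mul_sqrt_le_of_even (n := n) (by omega) hY hZ
        (by rw [← hn]; exact hardy_radial hd S.memLp_D)
        (integral_radialDeriv_sq_le (by omega) S.memLp_D) hXY (fun l hl => by
          have := S.integral_norm_shiftedDirac_sq_le hd hl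
          rwa [hdn, add_sub_cancel_right] at this)
      rwa [← hn, h2a] at h
  · refine (S.magnetic_le_of_odd hd ho).trans (fin ?_ ?_)
    · have : 0 ≤ ((d : ℝ) - 1) / 2 := by linarith
      positivity
    · have h := sqrt_add_mul_sqrt_le_of_odd (by linarith : 0 < ((d : ℝ) - 2) / 2) (S.hardy hd) hXY
      rw [h2a] at h
      convert h using 3
      ring

/-- The method of multipliers excludes bound states for small fields. -/
theorem eq_zero_of_small (S : IsBoundState α β A B w z ψ) (hd : 3 ≤ d) {ε₁ ε₂ R : ℝ}
    (hε₁ : 0 ≤ ε₁) (hε₂ : 0 ≤ ε₂)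
    (hB : ∫ x, (‖x‖ * matrixNorm (B x) * ‖(ψ : SpinorL2 d) x‖) ^ 2 ≤ ε₁ ^ 2 * energy A ψ)
    (hw : ∫ x, (‖x‖ * ‖fderiv ℝ w x‖ * ‖(ψ : SpinorL2 d) x‖) ^ 2 ≤ ε₂ ^ 2 * energy A ψ)
    (hR0 : 0 ≤ R)
    (hR : ∫ x, fderiv ℝ w x x * (w x * ‖(ψ : SpinorL2 d) x‖ ^ 2) ≤ R * energy A ψ)
    (hsmall : (2 + 1 / ((d : ℝ) - 2)) * ε₁ + (1 + 1 / ((d : ℝ) - 2)) * ε₂ + R < 1) :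
    (ψ : SpinorL2 d) = 0 := by
  by_contra hψ
  have hd3 : (3 : ℝ) ≤ d := by exact_mod_cast hd
  have hδ : 0 ≤ 1 / ((d : ℝ) - 2) := by
    have : 0 < (d : ℝ) - 2 := by linarith
    positivity
  have hY := S.energy_pos hd hψ
  have hL := (S.lichnerowicz hd).2
  have hV := S.virial_eigen hd
  have hK := S.abs_integral_mass_le hd
  have hr := S.memLp_inv_norm hd
  have hM := fun h => S.magnetic_le hd h hε₁ hB
  have hb := sqrt_le_mul_sqrt hε₁ hB
  have hg := sqrt_le_mul_sqrt hε₂ hw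
  have h1 := abs_integral_le_of_abs_le_mul S.memLp_T.norm S.memLp_B (Eventually.of_forall fun x =>
    S.abs_inner_dilationField_le x (diracDeriv α A ψ x))
  have h2 := abs_integral_le_of_abs_le_mul (F := fun x => fderiv ℝ w x x *
      inner ℝ (diracDeriv α A ψ x) (act β ((ψ : SpinorL2 d) x))) S.memLp_T.norm S.memLp_fderiv
    (Eventually.of_forall fun x => by
      rw [abs_mul]
      have h3 := abs_real_inner_le_norm (diracDeriv α A ψ x) (act β ((ψ : SpinorL2 d) x))
      rw [norm_act_beta S.dirac] at h3
      calc _ ≤ (‖x‖ * ‖fderiv ℝ w x‖) * (‖diracDeriv α A ψ x‖ * ‖(ψ : SpinorL2 d) x‖) := by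
            gcongr
            exact abs_fderiv_apply_self_le w x
        _ = _ := by ring)
  have h3 : ∫ x, ‖fderiv ℝ w x‖ * ‖(ψ : SpinorL2 d) x‖ ^ 2
      ≤ √(∫ x, (‖x‖ * ‖fderiv ℝ w x‖ * ‖(ψ : SpinorL2 d) x‖) ^ 2)
        * √(∫ x, (‖x‖⁻¹ * ‖(ψ : SpinorL2 d) x‖) ^ 2) := by
    refine (le_abs_self _).trans (abs_integral_le_of_abs_le_mul S.memLp_fderiv hr ?_)
    filter_upwards [ae_ne_zero (by omega : 0 < d)] with x hx
    have hx1 := norm_pos_iff.mpr hx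
    rw [abs_of_nonneg (by positivity)]
    apply le_of_eq; field_simp
  -- 2/(d−2) is the Hardy constant; it is the source of δε₂ in the bound for the mass term.
  have hH : √(∫ x, (‖x‖⁻¹ * ‖(ψ : SpinorL2 d) x‖) ^ 2)
      ≤ 2 * (1 / ((d : ℝ) - 2)) * √(energy A ψ) := by
    have ha : 0 < ((d : ℝ) - 2) / 2 := by linarith
    refine sqrt_le_mul_sqrt (by positivity) ?_
    have := S.hardy hd
    rw [← le_div_iff₀' (by positivity)] at this
    refine this.trans (le_of_eq ?_)
    field_simp
  set X := ∫ x, ‖diracDeriv α A ψ x‖ ^ 2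
  set Y := energy A ψ
  have hX : 0 ≤ X := integral_nonneg fun _ => sq_nonneg _
  set δ := 1 / ((d : ℝ) - 2)
  set p := √X
  set y := √Y
  have hp : p * p = X := Real.mul_self_sqrt hX
  have hy : y * y = Y := Real.mul_self_sqrt hY.le
  have hy0 : 0 < y := Real.sqrt_pos.mpr hY
  have h1' : p * √(∫ x, (‖x‖ * matrixNorm (B x) * ‖(ψ : SpinorL2 d) x‖) ^ 2) ≤ p * (ε₁ * y) := by
    gcongr
  have h2' : p * √(∫ x, (‖x‖ * ‖fderiv ℝ w x‖ * ‖(ψ : SpinorL2 d) x‖) ^ 2) ≤ p * (ε₂ * y) := by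
    gcongr
  have h3' : ∫ x, ‖fderiv ℝ w x‖ * ‖(ψ : SpinorL2 d) x‖ ^ 2 ≤ 2 * δ * ε₂ * Y := by
    refine h3.trans ?_
    calc _ ≤ (ε₂ * y) * (2 * δ * y) := by gcongr
      _ = _ := by rw [← hy]; ring
  have h1a := (le_abs_self _).trans (h1.trans h1')
  have h2a := (le_abs_self _).trans (h2.trans h2')
  have hKa := (abs_le.mp hK).1
  generalize (∫ x, w x * inner ℝ (act β ((ψ : SpinorL2 d) x)) (diracDeriv α A ψ x)) = K at *
  generalize (∫ x, inner ℝ (diracDeriv α A ψ x)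
    (clifford α (dilationField B x) ((ψ : SpinorL2 d) x))) = T₁ at *
  generalize (∫ x, fderiv ℝ w x x *
    inner ℝ (diracDeriv α A ψ x) (act β ((ψ : SpinorL2 d) x))) = T₂ at *
  generalize (∫ x, fderiv ℝ w x x * (w x * ‖(ψ : SpinorL2 d) x‖ ^ 2)) = T₃ at *
  generalize (∫ x, spinForm α (B x) ((ψ : SpinorL2 d) x)) = Q at *
  generalize (∫ x, ‖fderiv ℝ w x‖ * ‖(ψ : SpinorL2 d) x‖ ^ 2) = G at *
  rw [← hp] at hV hL
  rw [← hy] at hM hL hR h3'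
  refine smallness_contradiction hε₁ hε₂ hδ hR0 hy0 hsmall hL hV ?_ h1a h2a hR h3' hKa
  intro h
  exact hM (((Real.sqrt_le_sqrt_iff hY.le).mp h).trans hy.ge)

end IsBoundState

/-- Mass and scalar potential multiply the same matrix β, so they merge into the single weight w = m
+ v, with ∇w = ∇v. -/
theorem isBoundState_of_eigenvector (hd : 3 ≤ d) {α : Fin d → SpinorMatrix d}
    {β : SpinorMatrix d} (h : IsDiracMatrices α β) {m : ℝ} {A : Space d → Space d}
    {B : Space d → Matrix (Fin d) (Fin d) ℝ} (hA : MemL2Loc A)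
    (hB : ∀ j k, MemL2Loc (fun x => B x j k)) (hAB : IsMagneticField A B)
    (hdom : (diracOp α β m A 0).domain = H1 d) {v : Space d → ℝ}
    (hv : ContDiffOn ℝ ∞ v {0}ᶜ) {ε₁ ε₂ ε₃ : ℝ}
    (h_B : HardyBound A (fun x => ‖x‖ ^ 2 * matrixNorm (B x) ^ 2) (ε₁ ^ 2))
    (h_grad : HardyBound A (fun x => ‖x‖ ^ 2 * ‖gradient v x‖ ^ 2) (ε₂ ^ 2))
    (h_v : HardyBound A (fun x => |v x| ^ 2) (ε₃ ^ 2)) {ψ : H1 d} (hψ : (ψ : SpinorL2 d) ≠ 0)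
    {z : ℂ} (heq : ∀ᵐ x, diracExpr α β m A (scalarPotential β v) ψ x
      = z • (ψ : SpinorL2 d) x) :
    ∃ r : ℝ, IsBoundState α β A B (fun x => m + v x) r ψ := by
  have hd0 : 0 < d := by omega
  have hu := Lp.memLp (ψ : SpinorL2 d)
  have hAψ := memLp_vectorPotential_smul h hA (memLp_diracDeriv_of_domain hdom ψ)
  have hD := fun j => memLp_magneticDeriv (hAψ j)
  have hw : ContDiffOn ℝ ∞ (fun x => m + v x) {0}ᶜ := contDiffOn_const.add hv
  have hvm := aestronglyMeasurable_of_continuousOn hd0 hv.continuousOn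
  have hfd : ∀ x, fderiv ℝ (fun x => m + v x) x = fderiv ℝ v x := fun x => fderiv_const_add m
  have heq' : ∀ᵐ x, diracDeriv α A ψ x + (m + v x) • act β ((ψ : SpinorL2 d) x)
      = z • (ψ : SpinorL2 d) x := by
    filter_upwards [heq] with x hx
    have e : act (scalarPotential β v x) ((ψ : SpinorL2 d) x)
        = v x • act β ((ψ : SpinorL2 d) x) := by
      rw [scalarPotential, act, map_smul, smul_apply, real_smul_eq]
    rw [← hx, diracExpr, ← diracDeriv, e, real_smul_eq, add_smul, add_assoc]
  have hz := eigenvalue_im_eq_zero hd h hD hψ heq'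
  obtain ⟨hv1, -⟩ := h_v.memLp (q := fun x => |v x|) hvm.norm (fun _ => rfl) hD
  refine ⟨z.re, ⟨h, hA, hB, hAB, hAψ, ?_, hw, ?_, ?_, ?_⟩⟩
  · exact (h_B.memLp (measurable_norm.aestronglyMeasurable.mul (aestronglyMeasurable_matrixNorm hB))
      (fun x => (mul_pow _ _ 2).symm) hD).1
  · refine ((hu.norm.const_mul |m|).add hv1).mono
      ((aestronglyMeasurable_const.add hvm).norm.mul hu.aestronglyMeasurable.norm)
      (Eventually.of_forall fun x => ?_)
    rw [Pi.add_apply, ← add_mul, norm_mul, norm_mul, Real.norm_eq_abs, abs_abs,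
      Real.norm_of_nonneg (by positivity : 0 ≤ |m| + |v x|)]
    gcongr
    exact abs_add_le _ _
  · simp only [hfd]
    refine (h_grad.memLp (q := fun x => ‖x‖ * ‖fderiv ℝ v x‖)
      (measurable_norm.aestronglyMeasurable.mul
        (aestronglyMeasurable_of_continuousOn hd0 (contDiffOn_fderiv hv)).norm) (fun x => ?_) hD).1
    rw [norm_gradient, mul_pow]
  · filter_upwards [heq'] with x hx
    rw [hx, ← real_smul_eq]
    congr 1
    exact Complex.ext rfl (by simp [hz])

/-- The part of (x·∇v)(m + v) with m is bounded by the ε₄ hypothesis, absent when m = 0; the part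
with v by Cauchy–Schwarz between the ε₂ and ε₃ bounds. -/
theorem HardyBound.integral_radial_le (hd : 0 < d) {m : ℝ} (hm : 0 ≤ m) {A : Space d → Space d}
    {v : Space d → ℝ} (hv : ContDiffOn ℝ ∞ v {0}ᶜ) {ε₂ ε₃ ε₄ : ℝ} (hε₂ : 0 ≤ ε₂) (hε₃ : 0 ≤ ε₃)
    (h_grad : HardyBound A (fun x => ‖x‖ ^ 2 * ‖gradient v x‖ ^ 2) (ε₂ ^ 2))
    (h_mass : m ≠ 0 → HardyBound A (fun x => ‖x‖ * ‖gradient v x‖) (ε₄ ^ 2))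
    (h_v : HardyBound A (fun x => |v x| ^ 2) (ε₃ ^ 2)) {ψ : H1 d}
    (hD : ∀ j, MemLp (magneticDeriv A j ψ) 2 volume) :
    ∫ x, fderiv ℝ v x x * ((m + v x) * ‖(ψ : SpinorL2 d) x‖ ^ 2)
      ≤ (m * ε₄ ^ 2 + ε₂ * ε₃) * energy A ψ := by
  have hvm := aestronglyMeasurable_of_continuousOn hd hv.continuousOn
  have hxv : AEStronglyMeasurable (fun x => ‖x‖ * ‖fderiv ℝ v x‖) volume :=
    measurable_norm.aestronglyMeasurable.mul
      (aestronglyMeasurable_of_continuousOn hd (contDiffOn_fderiv hv)).norm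
  have hY := energy_nonneg A ψ
  simp only [norm_gradient] at h_grad h_mass
  obtain ⟨hv1, hv2⟩ := h_v.memLp (q := fun x => |v x|) hvm.norm (fun _ => rfl) hD
  obtain ⟨hg1, hg2⟩ := h_grad.memLp (q := fun x => ‖x‖ * ‖fderiv ℝ v x‖) hxv
    (fun x => (mul_pow _ _ 2).symm) hD
  obtain ⟨hm1, hm2⟩ : Integrable (fun x => m * (‖x‖ * ‖fderiv ℝ v x‖ * ‖(ψ : SpinorL2 d) x‖ ^ 2))
      volume ∧ ∫ x, m * (‖x‖ * ‖fderiv ℝ v x‖ * ‖(ψ : SpinorL2 d) x‖ ^ 2)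
        ≤ m * (ε₄ ^ 2 * energy A ψ) := by
    by_cases h0 : m = 0
    · simp [h0]
    · obtain ⟨h1, h2⟩ := (h_mass h0).integrable (sq_nonneg _) hxv (fun x => by positivity) hD
      refine ⟨h1.const_mul m, ?_⟩
      rw [integral_const_mul]
      gcongr
  have hgv : Integrable (fun x => (‖x‖ * ‖fderiv ℝ v x‖ * ‖(ψ : SpinorL2 d) x‖)
      * (|v x| * ‖(ψ : SpinorL2 d) x‖)) volume := hg1.integrable_mul hv1
  have h1 : ∫ x, fderiv ℝ v x x * ((m + v x) * ‖(ψ : SpinorL2 d) x‖ ^ 2)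
      ≤ (∫ x, m * (‖x‖ * ‖fderiv ℝ v x‖ * ‖(ψ : SpinorL2 d) x‖ ^ 2))
        + ∫ x, (‖x‖ * ‖fderiv ℝ v x‖ * ‖(ψ : SpinorL2 d) x‖) * (|v x| * ‖(ψ : SpinorL2 d) x‖) := by
    have hsum : Integrable (fun x => m * (‖x‖ * ‖fderiv ℝ v x‖ * ‖(ψ : SpinorL2 d) x‖ ^ 2)
        + (‖x‖ * ‖fderiv ℝ v x‖ * ‖(ψ : SpinorL2 d) x‖) * (|v x| * ‖(ψ : SpinorL2 d) x‖))
        volume := hm1.add hgv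
    rw [← integral_add hm1 hgv]
    refine (le_abs_self _).trans ?_
    rw [← Real.norm_eq_abs]
    refine norm_integral_le_of_norm_le hsum (Eventually.of_forall fun x => ?_)
    rw [norm_mul, norm_mul, Real.norm_eq_abs, Real.norm_eq_abs,
      Real.norm_of_nonneg (sq_nonneg ‖(ψ : SpinorL2 d) x‖)]
    calc _ ≤ (‖x‖ * ‖fderiv ℝ v x‖) * ((m + |v x|) * ‖(ψ : SpinorL2 d) x‖ ^ 2) := by
          gcongr
          · exact abs_fderiv_apply_self_le v x
          · exact (abs_add_le _ _).trans_eq (by rw [abs_of_nonneg hm])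
      _ = _ := by ring
  have h2 := (le_abs_self _).trans (abs_integral_mul_le hg1 hv1)
  have h3 : √(∫ x, (‖x‖ * ‖fderiv ℝ v x‖ * ‖(ψ : SpinorL2 d) x‖) ^ 2)
      * √(∫ x, (|v x| * ‖(ψ : SpinorL2 d) x‖) ^ 2) ≤ ε₂ * ε₃ * energy A ψ := by
    calc _ ≤ (ε₂ * √(energy A ψ)) * (ε₃ * √(energy A ψ)) := by
          gcongr
          · exact sqrt_le_mul_sqrt hε₂ hg2
          · exact sqrt_le_mul_sqrt hε₃ hv2
      _ = ε₂ * ε₃ * (√(energy A ψ) * √(energy A ψ)) := by ring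
      _ = _ := by rw [Real.mul_self_sqrt hY]
  linarith

theorem eq_zero_of_eigenvector (hd : 3 ≤ d) {α : Fin d → SpinorMatrix d}
    {β : SpinorMatrix d} (h : IsDiracMatrices α β) {m : ℝ} (hm : 0 ≤ m) {A : Space d → Space d}
    {B : Space d → Matrix (Fin d) (Fin d) ℝ} (hA : MemL2Loc A)
    (hB : ∀ j k, MemL2Loc (fun x => B x j k)) (hAB : IsMagneticField A B)
    (hdom : (diracOp α β m A 0).domain = H1 d) {v : Space d → ℝ}
    (hv_smooth : ContDiffOn ℝ ∞ v {0}ᶜ) {ε₁ ε₂ ε₃ ε₄ : ℝ} (hε₁ : 0 ≤ ε₁) (hε₂ : 0 ≤ ε₂)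
    (hε₃ : 0 ≤ ε₃)
    (hsmall : (4 * (d : ℝ) - 6) / ((d : ℝ) - 2) * ε₁ + 2 * ε₂ * ε₃ + 2 * m * ε₄ ^ 2
      + (4 * (d : ℝ) - 4) / ((d : ℝ) - 2) * ε₂ < 2)
    (h_B : HardyBound A (fun x => ‖x‖ ^ 2 * matrixNorm (B x) ^ 2) (ε₁ ^ 2))
    (h_grad : HardyBound A (fun x => ‖x‖ ^ 2 * ‖gradient v x‖ ^ 2) (ε₂ ^ 2))
    (h_mass : m ≠ 0 → HardyBound A (fun x => ‖x‖ * ‖gradient v x‖) (ε₄ ^ 2))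
    (h_v : HardyBound A (fun x => |v x| ^ 2) (ε₃ ^ 2)) {ψ : H1 d}
    {z : ℂ} (heq : ∀ᵐ x, diracExpr α β m A (scalarPotential β v) ψ x
      = z • (ψ : SpinorL2 d) x) : (ψ : SpinorL2 d) = 0 := by
  by_contra hψ
  obtain ⟨r, S⟩ := isBoundState_of_eigenvector hd h hA hB hAB hdom hv_smooth h_B h_grad h_v hψ heq
  have hd0 : 0 < d := by omega
  have hd3 : (3 : ℝ) ≤ d := by exact_mod_cast hd
  have hd2 : (d : ℝ) - 2 ≠ 0 := by linarith
  have hfd : ∀ x, fderiv ℝ (fun x => m + v x) x = fderiv ℝ v x := fun x => fderiv_const_add m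
  have hB2 := (h_B.memLp (measurable_norm.aestronglyMeasurable.mul
    (aestronglyMeasurable_matrixNorm hB)) (fun x => (mul_pow _ _ 2).symm) S.memLp_D).2
  have hg2 := (h_grad.memLp (q := fun x => ‖x‖ * ‖fderiv ℝ v x‖)
      (measurable_norm.aestronglyMeasurable.mul
        (aestronglyMeasurable_of_continuousOn hd0 (contDiffOn_fderiv hv_smooth)).norm)
      (fun x => by rw [norm_gradient, mul_pow]) S.memLp_D).2
  refine hψ (S.eq_zero_of_small hd (R := m * ε₄ ^ 2 + ε₂ * ε₃) hε₁ hε₂ hB2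
    (by simpa only [hfd] using hg2) (by positivity) ?_ ?_)
  · simp only [hfd]
    exact HardyBound.integral_radial_le hd0 hm hv_smooth hε₂ hε₃ h_grad h_mass h_v S.memLp_D
  -- Half of the smallness hypothesis reads (2+δ)ε₁ + 2(1+δ)ε₂ + R < 1 with δ = 1/(d−2) and R = mε₄²
  -- + ε₂ε₃. Only (1+δ)ε₂ is required, so one copy of it is discarded.
  · have e1 : (4 * (d : ℝ) - 6) / ((d : ℝ) - 2) = 2 * (2 + 1 / ((d : ℝ) - 2)) := by
      field_simp; ring
    have e2 : (4 * (d : ℝ) - 4) / ((d : ℝ) - 2) = 4 * (1 + 1 / ((d : ℝ) - 2)) := by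
      field_simp; ring
    rw [e1, e2] at hsmall
    have hδ : 0 ≤ 1 / ((d : ℝ) - 2) * ε₂ := by
      have : 0 < (d : ℝ) - 2 := by linarith
      positivity
    linarith

end DiracOperator

end

theorem theorem1p9 (d : ℕ) (hd : 3 ≤ d)
    (α : Fin d → DiracOperator.SpinorMatrix d) (β : DiracOperator.SpinorMatrix d)
    (hαβ : DiracOperator.IsDiracMatrices α β)
    (m : ℝ) (hm : 0 ≤ m)
    (A : DiracOperator.Space d → DiracOperator.Space d)
    (B : DiracOperator.Space d → Matrix (Fin d) (Fin d) ℝ)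
    (hA : DiracOperator.MemL2Loc A)
    (hB : ∀ j k, DiracOperator.MemL2Loc (fun x => B x j k))
    (hAB : DiracOperator.IsMagneticField A B)
    (hsa : DiracOperator.SelfAdjointOnH1 α β m A)
    (v : DiracOperator.Space d → ℝ)
    (hv_loc : LocallyIntegrable v volume)
    (hv_smooth : ContDiffOn ℝ ∞ v {0}ᶜ)
    (hv_bdd : ∀ r > 0, ∃ C : ℝ, ∀ x : DiracOperator.Space d, r ≤ ‖x‖ → |v x| ≤ C)
    (hv_rel : DiracOperator.RelativelyBounded α β m A (DiracOperator.scalarPotential β v))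
    (ε₁ ε₂ ε₃ ε₄ : ℝ) (hε₁ : 0 ≤ ε₁) (hε₂ : 0 ≤ ε₂) (hε₃ : 0 ≤ ε₃) (hε₄ : 0 ≤ ε₄)
    (hsmall : (4 * (d : ℝ) - 6) / ((d : ℝ) - 2) * ε₁ + 2 * ε₂ * ε₃ + 2 * m * ε₄ ^ 2
      + (4 * (d : ℝ) - 4) / ((d : ℝ) - 2) * ε₂ < 2)
    (h_B : DiracOperator.HardyBound A
      (fun x => ‖x‖ ^ 2 * DiracOperator.matrixNorm (B x) ^ 2) (ε₁ ^ 2))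
    (h_grad : DiracOperator.HardyBound A (fun x => ‖x‖ ^ 2 * ‖gradient v x‖ ^ 2) (ε₂ ^ 2))
    (h_mass : m ≠ 0 → DiracOperator.HardyBound A (fun x => ‖x‖ * ‖gradient v x‖) (ε₄ ^ 2))
    (h_v : DiracOperator.HardyBound A (fun x => |v x| ^ 2) (ε₃ ^ 2)) :
    DiracOperator.pointSpectrum
      (DiracOperator.diracOp α β m A (DiracOperator.scalarPotential β v)) = ∅ := by
  refine Set.eq_empty_of_forall_notMem ?_
  rintro z ⟨⟨ψ, hψ⟩, hψ0, hz⟩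
  obtain ⟨hψ1, hψ2⟩ := id hψ
  have hfun : DiracOperator.diracOp α β m A (DiracOperator.scalarPotential β v) ⟨ψ, hψ⟩
      = hψ.choose_spec.toLp := rfl
  have heq : ∀ᵐ x, DiracOperator.diracExpr α β m A (DiracOperator.scalarPotential β v) ⟨ψ, hψ1⟩ x = z • ψ x := by
    have h1 := hψ.choose_spec.coeFn_toLp
    rw [← hfun, hz] at h1
    filter_upwards [h1, Lp.coeFn_smul z ψ] with x hx hx2
    rw [← hx, hx2]; rfl
  exact hψ0 (DiracOperator.eq_zero_of_eigenvector hd hαβ hm hA hB hAB hsa.1 hv_smooth hε₁ hε₂ hε₃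
    hsmall h_B h_grad h_mass h_v (ψ := ⟨ψ, hψ1⟩) heq)
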